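/- Let $G$ be a Lie groupoid over a smooth manifold $M$ (Hausdorff and second countable; the manifold of arrows, also denoted $G$, need not be Hausdorff; $M$ and $G$ have constant dimension), with source $s$ and target $t$. **Conventions.** For an abelian Lie group $A$ (written multiplicatively), $H^1_{\mathrm{diff}}(G,A)$ is the group of smooth functions $c:G\to A$ with $c(gh)=c(g)c(h)$ for all composable $g,h$, modulo those of the form $c(g)=f(s(g))/f(t(g))$ with $f:M\to A$ smooth; $H^1_{\mathrm{diff}}(G)$ is the real vector space obtained for the additive group $A=\mathbb R$; $\mathbb Z_2=\{\pm1\}$. A 1-dimensional representation of $G$ is a smooth real line bundle $L\to M$ with a smooth linear action of $G$, an arrow $g:x\to y$ acting as a map $L_x\to L_y$; $\mathrm{Rep}^1(G)$ is the group of isomorphism classes of such representations, with the tensor product. If $\sigma$ is a nowhere vanishing smooth section of $L$, then $g\cdot\sigma(s(g))=\tilde c_\sigma(g)\,\sigma(t(g))$ defines a cocycle $\tilde c_\sigma:G\to\mathbb R^*$. For an open cover $\mathcal U$ of $M$, $G_{\mathcal U}$ is the pull-back of $G$ along the canonical map $\coprod_{U\in\mathcal U}U\to M$, which is a Lie groupoid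 over $\coprod_{U\in\mathcal U}U$, and $L_{\mathcal U}$ is the representation of $G_{\mathcal U}$ obtained by pulling back $L$. Put $$\check H^1_{\mathrm{diff}}(G,A)=\varinjlim_{\mathcal U}H^1_{\mathrm{diff}}(G_{\mathcal U},A),$$ the filtered colimit over the open covers of $M$ with respect to refinement. **Statement.** 1. For every open cover $\mathcal U$ of $M$, the pull-back map $H^1_{\mathrm{diff}}(G)\to H^1_{\mathrm{diff}}(G_{\mathcal U})$ is an isomorphism. 2. For every 1-dimensional representation $L$ of $G$ there is an open cover $\mathcal U$ such that $L_{\mathcal U}$ has a nowhere vanishing smooth section, and $L\otimes L$ has a nowhere vanishing smooth section on $M$. The following classes are well defined, i.e. they depend only on the isomorphism class of $L$ and not on the choices of covers and sections: * $\check\theta_G(L)\in\check H^1_{\mathrm{diff}}(G,\mathbb R^*)$, the class of $[\tilde c_\sigma]\in H^1_{\mathrm{diff}}(G_{\mathcal U},\mathbb R^*)$, for any open cover $\mathcal U$ and any nowhere vanishing smooth section $\sigma$ of $L_{\mathcal U}$; * $w(L)\in\check H^1_{\mathrm{diff}}(G,\mathbb Z_2)$, the class of $[\mathrm{sign}\circ\tilde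 c_\sigma]\in H^1_{\mathrm{diff}}(G_{\mathcal U},\mathbb Z_2)$, for the same $\mathcal U$ and $\sigma$; * $\theta_G(L)\in H^1_{\mathrm{diff}}(G)$, equal to $[\ln|\tilde c_\sigma|]$ for any nowhere vanishing smooth section $\sigma$ of $L$ if there is one, and to $\tfrac12\theta_G(L\otimes L)$ for every $L$. 3. The map $\check\theta_G$ is an isomorphism of groups $$\check\theta_G:\mathrm{Rep}^1(G)\xrightarrow{\ \sim\ }\check H^1_{\mathrm{diff}}(G,\mathbb R^*).$$ 4. There is an isomorphism of groups $$\Phi:\check H^1_{\mathrm{diff}}(G,\mathbb R^*)\xrightarrow{\ \sim\ }H^1_{\mathrm{diff}}(G)\times\check H^1_{\mathrm{diff}}(G,\mathbb Z_2),$$ induced by $\mathbb R^*\cong\mathbb R\times\mathbb Z_2$, $\lambda\mapsto(\ln|\lambda|,\mathrm{sign}(\lambda))$, and the isomorphisms of 1: for every open cover $\mathcal U$ and every $[c]\in H^1_{\mathrm{diff}}(G_{\mathcal U},\mathbb R^*)$, the first component of $\Phi([c])$ is the class in $H^1_{\mathrm{diff}}(G)$ whose pull-back to $G_{\mathcal U}$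 is $[\ln|c|]$, and the second component is the class of $[\mathrm{sign}\circ c]$. 5. For every 1-dimensional representation $L$ of $G$, $\Phi(\check\theta_G(L))=(\theta_G(L),w(L))$. -/

import Mathlib

open Bundle TopologicalSpace Set
open scoped Manifold ContDiff Topology TensorProduct

universe u v w u' v' w'

noncomputable section

/-! ### Disjoint unions of open subsets of a manifold -/

/-- The disjoint union of a family of open subsets of a topological space, with the disjoint
union topology. -/
def DisjUnion {X : Type u} [TopologicalSpace X] {ι : Type v} (O : ι → Opens X) : Type (max u v) :=
  Σ i, O i

namespace DisjUnion

variable {X : Type u} [TopologicalSpace X] {ι : Type v} {O : ι → Opens X}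

instance : TopologicalSpace (DisjUnion O) := inferInstanceAs (TopologicalSpace (Σ i, O i))

/-- The canonical map of the disjoint union to the ambient space. -/
def val (p : DisjUnion O) : X := p.2.1

/-- The index of the summand in which a point lies. -/
def idx (p : DisjUnion O) : ι := p.1

/-- The point `x`, regarded as a point of the summand of index `i`. -/
def mk (i : ι) (x : X) (hx : x ∈ O i) : DisjUnion O := ⟨i, x, hx⟩

@[simp] theorem val_mk (i : ι) (x : X) (hx : x ∈ O i) : val (mk i x hx : DisjUnion O) = x := rfl
@[simp] theorem idx_mk (i : ι) (x : X) (hx : x ∈ O i) : idx (mk i x hx : DisjUnion O) = i := rfl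

theorem val_mem (p : DisjUnion O) : p.val ∈ O p.idx := p.2.2

theorem ext' {p q : DisjUnion O} (h₁ : p.idx = q.idx) (h₂ : p.val = q.val) : p = q := by
  obtain ⟨i, x, hx⟩ := p
  obtain ⟨j, y, hy⟩ := q
  change i = j at h₁
  change x = y at h₂
  subst h₁ h₂
  rfl

theorem continuous_val : Continuous (val : DisjUnion O → X) :=
  continuous_sigma fun _ => continuous_subtype_val

theorem isOpenMap_val : IsOpenMap (val : DisjUnion O → X) :=
  isOpenMap_sigma.2 fun i => (O i).isOpen.isOpenMap_subtype_val

theorem isOpen_idx_eq (i : ι) : IsOpen {q : DisjUnion O | q.idx = i} := by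
  refine isOpen_sigma_iff.2 fun j => ?_
  by_cases h : j = i
  · convert isOpen_univ
    exact eq_univ_of_forall fun _ => h
  · convert isOpen_empty
    exact eq_empty_of_forall_notMem fun _ => h

theorem eventually_idx (p : DisjUnion O) : ∀ᶠ q in 𝓝 p, q.idx = p.idx :=
  (isOpen_idx_eq p.idx).mem_nhds rfl

theorem isLocalHomeomorph_val : IsLocalHomeomorph (val : DisjUnion O → X) := by
  rw [isLocalHomeomorph_iff_isOpenEmbedding_restrict]
  intro p
  refine ⟨_, eventually_idx p, ?_⟩
  refine .of_continuous_injective_isOpenMap (continuous_val.comp continuous_subtype_val) ?_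
    (isOpenMap_val.domRestrict (isOpen_idx_eq p.idx))
  rintro ⟨q, hq⟩ ⟨q', hq'⟩ hqq
  exact Subtype.ext (ext' (Eq.trans hq (Eq.symm hq')) hqq)

theorem continuousWithinAt_iff {Y : Type*} [TopologicalSpace Y] {f : Y → DisjUnion O} {s : Set Y}
    {y : Y} : ContinuousWithinAt f s y ↔
      ContinuousWithinAt (val ∘ f) s y ∧ ∀ᶠ y' in 𝓝[s] y, (f y').idx = (f y).idx := by
  constructor
  · intro h
    exact ⟨continuous_val.continuousAt.comp_continuousWithinAt h,
      h.eventually (eventually_idx (f y))⟩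
  · rintro ⟨h₁, h₂⟩
    rw [ContinuousWithinAt, Filter.tendsto_def]
    intro t ht
    have ht' : val '' (t ∩ {q : DisjUnion O | q.idx = (f y).idx}) ∈ 𝓝 ((f y).val) :=
      isOpenMap_val.image_mem_nhds (Filter.inter_mem ht (eventually_idx (f y)))
    filter_upwards [h₁ ht', h₂] with y' hy₁ hy₂
    obtain ⟨q, ⟨hq, hz⟩, hqy⟩ := hy₁
    have : f y' = q := ext' (hy₂.trans (Eq.symm hz)) hqy.symm
    change f y' ∈ t
    rw [this]
    exact hq

variable {H : Type*} [TopologicalSpace H] {E : Type*} [NormedAddCommGroup E] [NormedSpace ℝ E]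
  {I : ModelWithCorners ℝ E H}

theorem compatible_aux (f f' : OpenPartialHomeomorph (DisjUnion O) X) (hf : val = f)
    (hf' : val = f') (c c' : OpenPartialHomeomorph X H)
    (hc : c.symm ≫ₕ c' ∈ contDiffGroupoid ∞ I) :
    (f ≫ₕ c).symm ≫ₕ (f' ≫ₕ c') ∈ contDiffGroupoid ∞ I := by
  set e := (f ≫ₕ c).symm ≫ₕ (f' ≫ₕ c') with he
  have hS : IsOpen e.source := e.open_source
  have key : ∀ y ∈ e.source, f' (f.symm (c.symm y)) = c.symm y := by
    intro y hy
    simp only [he, mfld_simps] at hy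
    rw [← hf', hf, f.right_inv hy.1.2]
  have hsub : e.source ⊆ (c.symm ≫ₕ c').source := by
    intro y hy
    have hk := key y hy
    simp only [he, mfld_simps] at hy ⊢
    rw [hk] at hy
    exact ⟨hy.1.1, hy.2.2⟩
  refine (contDiffGroupoid ∞ I).mem_of_eqOnSource
    (closedUnderRestriction' hc hS) ⟨?_, ?_⟩
  · rw [OpenPartialHomeomorph.restr_source' _ _ hS, inter_eq_right.2 hsub]
  · intro y hy
    simp only [OpenPartialHomeomorph.restr_apply, he, OpenPartialHomeomorph.coe_trans,
      OpenPartialHomeomorph.trans_symm_eq_symm_trans_symm, Function.comp_apply]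
    rw [key y hy]

variable [ChartedSpace H X]

/-- The charts of the disjoint union are the charts of the ambient space, precomposed with
local inverses of the inclusions of the summands. -/
instance : ChartedSpace H (DisjUnion O) where
  atlas := {e | ∃ f : OpenPartialHomeomorph (DisjUnion O) X, val = f ∧
    ∃ c ∈ atlas H X, e = f ≫ₕ c}
  chartAt p := (isLocalHomeomorph_val p).choose ≫ₕ chartAt H p.val
  mem_chart_source p := by
    have h := (isLocalHomeomorph_val p).choose_spec
    rw [OpenPartialHomeomorph.trans_source]
    refine ⟨h.1, ?_⟩
    rw [mem_preimage, ← h.2]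
    exact mem_chart_source H p.val
  chart_mem_atlas p :=
    ⟨_, (isLocalHomeomorph_val p).choose_spec.2, _, chart_mem_atlas H p.val, rfl⟩

instance [IsManifold I ∞ X] : IsManifold I ∞ (DisjUnion O) where
  compatible := by
    rintro _ _ ⟨f, hf, c, hc, rfl⟩ ⟨f', hf', c', hc', rfl⟩
    exact compatible_aux f f' hf hf' c c' (HasGroupoid.compatible hc hc')

theorem mem_maximalAtlas [IsManifold I ∞ X] (f : OpenPartialHomeomorph (DisjUnion O) X)
    (hf : val = f) (c : OpenPartialHomeomorph X H) (hc : c ∈ IsManifold.maximalAtlas I ∞ X) :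
    f ≫ₕ c ∈ IsManifold.maximalAtlas I ∞ (DisjUnion O) := by
  rw [IsManifold.maximalAtlas, mem_maximalAtlas_iff]
  rintro _ ⟨f', hf', c', hc', rfl⟩
  have h := mem_maximalAtlas_iff.1 hc c' hc'
  exact ⟨compatible_aux f f' hf hf' c c' h.1, compatible_aux f' f hf' hf c' c h.2⟩

variable {Y : Type*} [TopologicalSpace Y] {H' : Type*} [TopologicalSpace H'] [ChartedSpace H' Y]
  {E' : Type*} [NormedAddCommGroup E'] [NormedSpace ℝ E'] {I' : ModelWithCorners ℝ E' H'}

/-- A map to the disjoint union is smooth iff it is smooth as a map to the ambient space and the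
index is locally constant. -/
theorem contMDiffWithinAt_iff {f : Y → DisjUnion O} {s : Set Y} {y : Y} :
    ContMDiffWithinAt I' I ∞ f s y ↔
      ContMDiffWithinAt I' I ∞ (val ∘ f) s y ∧ ∀ᶠ y' in 𝓝[s] y, (f y').idx = (f y).idx := by
  have hcd : ∀ q : DisjUnion O, (extChartAt I q : DisjUnion O → E) = extChartAt I q.val ∘ val := by
    intro q
    have h := (isLocalHomeomorph_val q).choose_spec.2
    have : (chartAt H q : DisjUnion O → H) = chartAt H q.val ∘ val := by
      change ((isLocalHomeomorph_val q).choose ≫ₕ chartAt H q.val : DisjUnion O → H) = _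
      rw [OpenPartialHomeomorph.coe_trans, ← h]
    ext1 z
    simp [extChartAt, this]
  rw [_root_.contMDiffWithinAt_iff, _root_.contMDiffWithinAt_iff, continuousWithinAt_iff]
  have : (extChartAt I (f y) ∘ f ∘ (extChartAt I' y).symm) =
      (extChartAt I ((val ∘ f) y) ∘ (val ∘ f) ∘ (extChartAt I' y).symm) := by
    rw [hcd]; rfl
  rw [this]
  tauto

theorem contMDiff_iff {f : Y → DisjUnion O} :
    ContMDiff I' I ∞ f ↔
      ContMDiff I' I ∞ (val ∘ f) ∧ ∀ y, ∀ᶠ y' in 𝓝 y, (f y').idx = (f y).idx := by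
  simp only [ContMDiff, ← contMDiffWithinAt_univ, contMDiffWithinAt_iff, nhdsWithin_univ,
    forall_and]

theorem contMDiff_val : ContMDiff I I ∞ (val : DisjUnion O → X) :=
  (contMDiff_iff.1 (contMDiff_id (M := DisjUnion O))).1

end DisjUnion

/-! ### Lie groupoids -/

/-- A Lie groupoid over the `n`-dimensional manifold `M`, with `m`-dimensional manifold of arrows
`G` (not assumed to be Hausdorff). An arrow `g` goes from `src g` to `tgt g`, and `mul g h` is the
composition `g ∘ h`; only its values on composable pairs, `src g = tgt h`, are meaningful. The
space of composable pairs is an embedded submanifold of `G × G`, so that smoothness of the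
multiplication is smoothness on this subset. -/
structure LieGroupoid (n m : ℕ) (M : Type u) (G : Type w)
    [TopologicalSpace M] [ChartedSpace (EuclideanSpace ℝ (Fin n)) M]
    [TopologicalSpace G] [ChartedSpace (EuclideanSpace ℝ (Fin m)) G] where
  src : C^∞⟮𝓡 m, G; 𝓡 n, M⟯
  tgt : C^∞⟮𝓡 m, G; 𝓡 n, M⟯
  one : C^∞⟮𝓡 n, M; 𝓡 m, G⟯
  inv : C^∞⟮𝓡 m, G; 𝓡 m, G⟯
  mul : G → G → G
  src_one : ∀ x, src (one x) = x
  tgt_one : ∀ x, tgt (one x) = x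
  src_inv : ∀ g, src (inv g) = tgt g
  tgt_inv : ∀ g, tgt (inv g) = src g
  src_mul : ∀ g h, src g = tgt h → src (mul g h) = src h
  tgt_mul : ∀ g h, src g = tgt h → tgt (mul g h) = tgt g
  mul_assoc : ∀ g h k, src g = tgt h → src h = tgt k → mul (mul g h) k = mul g (mul h k)
  one_mul : ∀ g, mul (one (tgt g)) g = g
  mul_one : ∀ g, mul g (one (src g)) = g
  inv_mul : ∀ g, mul (inv g) g = one (src g)
  mul_inv : ∀ g, mul g (inv g) = one (tgt g)
  isSubmersion_src : Manifold.IsSubmersion (𝓡 m) (𝓡 n) ∞ src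
  contMDiffOn_mul : ContMDiffOn ((𝓡 m).prod (𝓡 m)) (𝓡 m) ∞ (fun p : G × G => mul p.1 p.2)
    {p | src p.1 = tgt p.2}

namespace LieGroupoid

variable {n m : ℕ} {M : Type u} {G : Type w}
  [TopologicalSpace M] [ChartedSpace (EuclideanSpace ℝ (Fin n)) M]
  [TopologicalSpace G] [ChartedSpace (EuclideanSpace ℝ (Fin m)) G]
  {n' m' : ℕ} {M' : Type u'} {G' : Type w'}
  [TopologicalSpace M'] [ChartedSpace (EuclideanSpace ℝ (Fin n')) M']
  [TopologicalSpace G'] [ChartedSpace (EuclideanSpace ℝ (Fin m')) G']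

/-- The arrows of a Lie groupoid from `x` to `y`. -/
def Arrow (𝒢 : LieGroupoid n m M G) (x y : M) : Type w := {g : G // 𝒢.src g = x ∧ 𝒢.tgt g = y}

/-- An element of `G`, as an arrow from its source to its target. -/
def arrow (𝒢 : LieGroupoid n m M G) (g : G) : 𝒢.Arrow (𝒢.src g) (𝒢.tgt g) := ⟨g, rfl, rfl⟩

/-- The unit arrow at `x`. -/
def unit (𝒢 : LieGroupoid n m M G) (x : M) : 𝒢.Arrow x x := ⟨𝒢.one x, 𝒢.src_one x, 𝒢.tgt_one x⟩

/-- Composition of arrows. -/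
def Arrow.comp {𝒢 : LieGroupoid n m M G} {x y z : M} (g : 𝒢.Arrow y z) (h : 𝒢.Arrow x y) :
    𝒢.Arrow x z :=
  ⟨𝒢.mul g.1 h.1, (𝒢.src_mul _ _ (g.2.1.trans h.2.2.symm)).trans h.2.1,
    (𝒢.tgt_mul _ _ (g.2.1.trans h.2.2.symm)).trans g.2.2⟩

/-- A morphism of Lie groupoids: a smooth functor. -/
structure Hom (𝒢' : LieGroupoid n' m' M' G') (𝒢 : LieGroupoid n m M G) where
  base : C^∞⟮𝓡 n', M'; 𝓡 n, M⟯
  arr : C^∞⟮𝓡 m', G'; 𝓡 m, G⟯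
  src_arr : ∀ g, 𝒢.src (arr g) = base (𝒢'.src g)
  tgt_arr : ∀ g, 𝒢.tgt (arr g) = base (𝒢'.tgt g)
  arr_one : ∀ x, arr (𝒢'.one x) = 𝒢.one (base x)
  arr_mul : ∀ g h, 𝒢'.src g = 𝒢'.tgt h → arr (𝒢'.mul g h) = 𝒢.mul (arr g) (arr h)

/-- The action of a morphism of Lie groupoids on arrows. -/
def Hom.map {𝒢' : LieGroupoid n' m' M' G'} {𝒢 : LieGroupoid n m M G} (Φ : 𝒢'.Hom 𝒢) {x y : M'}
    (g : 𝒢'.Arrow x y) : 𝒢.Arrow (Φ.base x) (Φ.base y) :=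
  ⟨Φ.arr g.1, by rw [Φ.src_arr, g.2.1], by rw [Φ.tgt_arr, g.2.2]⟩

end LieGroupoid

/-! ### Open covers and the pull-back of a Lie groupoid along an open cover -/

/-- An open cover of `M`. -/
structure OpenCover (M : Type u) [TopologicalSpace M] where
  carrier : Set (Opens M)
  covers : ∀ x, ∃ U ∈ carrier, x ∈ U

namespace OpenCover

variable {M : Type u} [TopologicalSpace M]

/-- Open covers are ordered by refinement: `𝒰 ≤ 𝒱` iff `𝒱` is finer than `𝒰`, i.e., every member
of `𝒱` is contained in a member of `𝒰`. -/
instance : Preorder (OpenCover M) where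
  le 𝒰 𝒱 := ∀ V ∈ 𝒱.carrier, ∃ U ∈ 𝒰.carrier, V ≤ U
  le_refl 𝒰 V hV := ⟨V, hV, le_rfl⟩
  le_trans 𝒰 𝒱 𝒲 h₁ h₂ W hW := by
    obtain ⟨V, hV, hWV⟩ := h₂ W hW
    obtain ⟨U, hU, hVU⟩ := h₁ V hV
    exact ⟨U, hU, hWV.trans hVU⟩

instance : Nonempty (OpenCover M) := ⟨⟨{⊤}, fun _ => ⟨⊤, rfl, trivial⟩⟩⟩

instance : IsDirectedOrder (OpenCover M) where
  directed 𝒰 𝒱 := by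
    refine ⟨⟨{W | ∃ U ∈ 𝒰.carrier, ∃ V ∈ 𝒱.carrier, W = U ⊓ V}, fun x => ?_⟩, ?_, ?_⟩
    · obtain ⟨U, hU, hx⟩ := 𝒰.covers x
      obtain ⟨V, hV, hx'⟩ := 𝒱.covers x
      exact ⟨U ⊓ V, ⟨U, hU, V, hV, rfl⟩, hx, hx'⟩
    · rintro _ ⟨U, hU, V, hV, rfl⟩
      exact ⟨U, hU, inf_le_left⟩
    · rintro _ ⟨U, hU, V, hV, rfl⟩
      exact ⟨V, hV, inf_le_right⟩

/-- The disjoint union of the members of an open cover. -/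
abbrev Space (𝒰 : OpenCover M) : Type u := DisjUnion (fun U : 𝒰.carrier => U.1)

end OpenCover

namespace LieGroupoid

variable {n m : ℕ} {M : Type u} {G : Type w}
  [TopologicalSpace M] [ChartedSpace (EuclideanSpace ℝ (Fin n)) M]
  [TopologicalSpace G] [ChartedSpace (EuclideanSpace ℝ (Fin m)) G]

/-- The open set of arrows of `𝒢` from a point of `U` to a point of `V`. -/
def arrowOpens (𝒢 : LieGroupoid n m M G) (U V : Opens M) : Opens G where
  carrier := {g | 𝒢.src g ∈ U ∧ 𝒢.tgt g ∈ V}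
  is_open' := (U.isOpen.preimage 𝒢.src.contMDiff.continuous).inter
    (V.isOpen.preimage 𝒢.tgt.contMDiff.continuous)

/-- The space of arrows of the pull-back of `𝒢` to the disjoint union of the members of an open
cover: the triples `(U, g, V)` with `g` an arrow from a point of `U` to a point of `V`. -/
abbrev CoverArrows (𝒢 : LieGroupoid n m M G) (𝒰 : OpenCover M) : Type (max u w) :=
  DisjUnion (fun UV : 𝒰.carrier × 𝒰.carrier => 𝒢.arrowOpens UV.1 UV.2)

variable (𝒢 : LieGroupoid n m M G) (𝒰 : OpenCover M)

theorem CoverArrows.src_mem (a : 𝒢.CoverArrows 𝒰) : 𝒢.src a.val ∈ (a.idx.1 : Opens M) :=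
  a.val_mem.1

theorem CoverArrows.tgt_mem (a : 𝒢.CoverArrows 𝒰) : 𝒢.tgt a.val ∈ (a.idx.2 : Opens M) :=
  a.val_mem.2

theorem isSubmersion_lift {O : Type*} {O' : Type*} {A : O → Opens G} {B : O' → Opens M}
    [IsManifold (𝓡 n) ∞ M] [IsManifold (𝓡 m) ∞ G]
    (f : DisjUnion A → DisjUnion B) (f₀ : G → M)
    (hf : Continuous f) (hff : ∀ a, (f a).val = f₀ a.val)
    (h₀ : Manifold.IsSubmersion (𝓡 m) (𝓡 n) ∞ f₀) : Manifold.IsSubmersion (𝓡 m) (𝓡 n) ∞ f := by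
  obtain ⟨F, i₁, i₂, h⟩ := h₀
  refine ⟨F, i₁, i₂, fun a => ?_⟩
  have ha := h a.val
  obtain ⟨p, hp⟩ := DisjUnion.isLocalHomeomorph_val a
  obtain ⟨q, hq⟩ := DisjUnion.isLocalHomeomorph_val (f a)
  refine .mk_of_continuousAt hf.continuousAt ha.equiv (p ≫ₕ ha.domChart) (q ≫ₕ ha.codChart)
    ?_ ?_ (DisjUnion.mem_maximalAtlas p hp.2 _ ha.domChart_mem_maximalAtlas)
    (DisjUnion.mem_maximalAtlas q hq.2 _ ha.codChart_mem_maximalAtlas) ?_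
  · rw [OpenPartialHomeomorph.trans_source]
    refine ⟨hp.1, ?_⟩
    rw [mem_preimage, ← hp.2]
    exact ha.mem_domChart_source
  · rw [OpenPartialHomeomorph.trans_source]
    refine ⟨hq.1, ?_⟩
    rw [mem_preimage, ← hq.2, hff]
    exact ha.mem_codChart_source
  · intro y hy
    have hy' : y ∈ (ha.domChart.extend (𝓡 m)).target ∧
        (ha.domChart.extend (𝓡 m)).symm y ∈ p.target := by
      simp only [mfld_simps] at hy ⊢
      tauto
    rw [← ha.writtenInCharts hy'.1]
    have hr : (p (p.symm ((ha.domChart.extend (𝓡 m)).symm y))) =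
      (ha.domChart.extend (𝓡 m)).symm y := p.right_inv hy'.2
    refine congrArg (ha.codChart.extend (𝓡 n)) (?_ : q (f (p.symm _)) = f₀ _)
    rw [← hq.2, hff]
    exact congrArg f₀ ((congrFun hp.2 _).trans hr)

open Classical in
/-- The composition of arrows of the pull-back (with a junk value on pairs that are not
composable). -/
def coverMul (a b : 𝒢.CoverArrows 𝒰) : 𝒢.CoverArrows 𝒰 :=
  if h : 𝒢.src a.val = 𝒢.tgt b.val then
    .mk (b.idx.1, a.idx.2) (𝒢.mul a.val b.val)
      ⟨by rw [𝒢.src_mul _ _ h]; exact CoverArrows.src_mem 𝒢 𝒰 b,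
        by rw [𝒢.tgt_mul _ _ h]; exact CoverArrows.tgt_mem 𝒢 𝒰 a⟩
  else a

variable {𝒰} in
theorem val_coverMul {a b : 𝒢.CoverArrows 𝒰} (h : 𝒢.src a.val = 𝒢.tgt b.val) :
    (𝒢.coverMul 𝒰 a b).val = 𝒢.mul a.val b.val := by
  rw [coverMul, dif_pos h]; rfl

variable {𝒰} in
theorem idx_coverMul {a b : 𝒢.CoverArrows 𝒰} (h : 𝒢.src a.val = 𝒢.tgt b.val) :
    (𝒢.coverMul 𝒰 a b).idx = (b.idx.1, a.idx.2) := by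
  rw [coverMul, dif_pos h]; rfl

/-- The pull-back of a Lie groupoid over `M` along the canonical map to `M` from the disjoint union
of the members of an open cover of `M`: the arrows from the copy of `x` in `U` to the copy of `y`
in `V` are the arrows from `x` to `y`. -/
def cover [IsManifold (𝓡 n) ∞ M] [IsManifold (𝓡 m) ∞ G] :
    LieGroupoid n m 𝒰.Space (𝒢.CoverArrows 𝒰) where
  src := ⟨fun a => .mk a.idx.1 (𝒢.src a.val) (CoverArrows.src_mem 𝒢 𝒰 a),
    DisjUnion.contMDiff_iff.2 ⟨𝒢.src.contMDiff.comp DisjUnion.contMDiff_val, fun a =>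
      (DisjUnion.eventually_idx a).mono fun b hb => congrArg Prod.fst hb⟩⟩
  tgt := ⟨fun a => .mk a.idx.2 (𝒢.tgt a.val) (CoverArrows.tgt_mem 𝒢 𝒰 a),
    DisjUnion.contMDiff_iff.2 ⟨𝒢.tgt.contMDiff.comp DisjUnion.contMDiff_val, fun a =>
      (DisjUnion.eventually_idx a).mono fun b hb => congrArg Prod.snd hb⟩⟩
  one := ⟨fun x => .mk (x.idx, x.idx) (𝒢.one x.val)
      ⟨by rw [𝒢.src_one]; exact x.val_mem, by rw [𝒢.tgt_one]; exact x.val_mem⟩,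
    DisjUnion.contMDiff_iff.2 ⟨𝒢.one.contMDiff.comp DisjUnion.contMDiff_val, fun a =>
      (DisjUnion.eventually_idx a).mono fun b hb => congrArg (fun i => (i, i)) hb⟩⟩
  inv := ⟨fun a => .mk (a.idx.2, a.idx.1) (𝒢.inv a.val)
      ⟨by rw [𝒢.src_inv]; exact CoverArrows.tgt_mem 𝒢 𝒰 a,
        by rw [𝒢.tgt_inv]; exact CoverArrows.src_mem 𝒢 𝒰 a⟩,
    DisjUnion.contMDiff_iff.2 ⟨𝒢.inv.contMDiff.comp DisjUnion.contMDiff_val, fun a =>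
      (DisjUnion.eventually_idx a).mono fun b hb => congrArg Prod.swap hb⟩⟩
  mul := 𝒢.coverMul 𝒰
  src_one x := DisjUnion.ext' rfl (𝒢.src_one _)
  tgt_one x := DisjUnion.ext' rfl (𝒢.tgt_one _)
  src_inv a := DisjUnion.ext' rfl (𝒢.src_inv _)
  tgt_inv a := DisjUnion.ext' rfl (𝒢.tgt_inv _)
  src_mul a b h := by
    have h' : 𝒢.src a.val = 𝒢.tgt b.val := congrArg DisjUnion.val h
    have hi := congrArg Prod.fst (𝒢.idx_coverMul h')
    refine DisjUnion.ext' hi ?_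
    exact (congrArg 𝒢.src (𝒢.val_coverMul h')).trans (𝒢.src_mul _ _ h')
  tgt_mul a b h := by
    have h' : 𝒢.src a.val = 𝒢.tgt b.val := congrArg DisjUnion.val h
    have hi := congrArg Prod.snd (𝒢.idx_coverMul h')
    refine DisjUnion.ext' hi ?_
    exact (congrArg 𝒢.tgt (𝒢.val_coverMul h')).trans (𝒢.tgt_mul _ _ h')
  mul_assoc a b c h₁ h₂ := by
    have h₁' : 𝒢.src a.val = 𝒢.tgt b.val := congrArg DisjUnion.val h₁
    have h₂' : 𝒢.src b.val = 𝒢.tgt c.val := congrArg DisjUnion.val h₂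
    have h₃ : 𝒢.src (𝒢.coverMul 𝒰 a b).val = 𝒢.tgt c.val := by
      rw [𝒢.val_coverMul h₁', 𝒢.src_mul _ _ h₁', h₂']
    have h₄ : 𝒢.src a.val = 𝒢.tgt (𝒢.coverMul 𝒰 b c).val := by
      rw [𝒢.val_coverMul h₂', 𝒢.tgt_mul _ _ h₂', h₁']
    refine DisjUnion.ext' ?_ ?_
    · rw [𝒢.idx_coverMul h₃, 𝒢.idx_coverMul h₄, 𝒢.idx_coverMul h₁', 𝒢.idx_coverMul h₂']
    · rw [𝒢.val_coverMul h₃, 𝒢.val_coverMul h₄, 𝒢.val_coverMul h₁', 𝒢.val_coverMul h₂',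
        𝒢.mul_assoc _ _ _ h₁' h₂']
  one_mul a := by
    have h : 𝒢.src (𝒢.one (𝒢.tgt a.val)) = 𝒢.tgt a.val := 𝒢.src_one _
    refine DisjUnion.ext' (𝒢.idx_coverMul h) (Eq.trans (𝒢.val_coverMul ?_) (𝒢.one_mul _))
    exact h
  mul_one a := by
    have h : 𝒢.src a.val = 𝒢.tgt (𝒢.one (𝒢.src a.val)) := (𝒢.tgt_one _).symm
    refine DisjUnion.ext' (𝒢.idx_coverMul h) (Eq.trans (𝒢.val_coverMul ?_) (𝒢.mul_one _))
    exact h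
  inv_mul a := by
    have h : 𝒢.src (𝒢.inv a.val) = 𝒢.tgt a.val := 𝒢.src_inv _
    refine DisjUnion.ext' (𝒢.idx_coverMul h) (Eq.trans (𝒢.val_coverMul ?_) (𝒢.inv_mul _))
    exact h
  mul_inv a := by
    have h : 𝒢.src a.val = 𝒢.tgt (𝒢.inv a.val) := (𝒢.tgt_inv _).symm
    refine DisjUnion.ext' (𝒢.idx_coverMul h) (Eq.trans (𝒢.val_coverMul ?_) (𝒢.mul_inv _))
    exact h
  isSubmersion_src := by
    refine isSubmersion_lift _ 𝒢.src ?_ (fun _ => rfl) 𝒢.isSubmersion_src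
    exact ContMDiff.continuous (I := 𝓡 m) (I' := 𝓡 n) (n := ∞)
      (DisjUnion.contMDiff_iff.2 ⟨𝒢.src.contMDiff.comp DisjUnion.contMDiff_val, fun a =>
        (DisjUnion.eventually_idx a).mono fun b hb => congrArg Prod.fst hb⟩)
  contMDiffOn_mul := by
    rintro ⟨a, b⟩ hab
    have hab' : 𝒢.src a.val = 𝒢.tgt b.val := congrArg DisjUnion.val hab
    refine DisjUnion.contMDiffWithinAt_iff.2 ⟨?_, ?_⟩
    · have h₁ : ContMDiffWithinAt ((𝓡 m).prod (𝓡 m)) (𝓡 m) ∞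
          (fun p : 𝒢.CoverArrows 𝒰 × 𝒢.CoverArrows 𝒰 => 𝒢.mul p.1.val p.2.val)
          {p | 𝒢.src p.1.val = 𝒢.tgt p.2.val} (a, b) :=
        (𝒢.contMDiffOn_mul (a.val, b.val) hab').comp (a, b)
          (((DisjUnion.contMDiff_val.comp contMDiff_fst).prodMk
            (DisjUnion.contMDiff_val.comp contMDiff_snd)).contMDiffAt.contMDiffWithinAt)
          (fun _ h => h)
      refine (h₁.mono ?_).congr (fun p hp => ?_) ?_
      · intro p hp
        exact congrArg DisjUnion.val hp
      · exact 𝒢.val_coverMul (congrArg DisjUnion.val hp)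
      · exact 𝒢.val_coverMul hab'
    · have h₁ : ∀ᶠ p : 𝒢.CoverArrows 𝒰 × 𝒢.CoverArrows 𝒰 in 𝓝 (a, b), p.1.idx = a.idx :=
        (continuous_fst.tendsto (a, b)).eventually (DisjUnion.eventually_idx a)
      have h₂ : ∀ᶠ p : 𝒢.CoverArrows 𝒰 × 𝒢.CoverArrows 𝒰 in 𝓝 (a, b), p.2.idx = b.idx :=
        (continuous_snd.tendsto (a, b)).eventually (DisjUnion.eventually_idx b)
      filter_upwards [nhdsWithin_le_nhds h₁, nhdsWithin_le_nhds h₂, self_mem_nhdsWithin]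
        with p hp₁ hp₂ hp
      exact (𝒢.idx_coverMul (congrArg DisjUnion.val hp)).trans
        (by rw [hp₁, hp₂]; exact (𝒢.idx_coverMul hab').symm)

variable [IsManifold (𝓡 n) ∞ M] [IsManifold (𝓡 m) ∞ G]

/-- The canonical morphism from the pull-back of `𝒢` along an open cover to `𝒢`. -/
def coverMap : (𝒢.cover 𝒰).Hom 𝒢 where
  base := ⟨DisjUnion.val, DisjUnion.contMDiff_val⟩
  arr := ⟨DisjUnion.val, DisjUnion.contMDiff_val⟩
  src_arr _ := rfl
  tgt_arr _ := rfl
  arr_one _ := rfl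
  arr_mul a b h := by
    have h' : 𝒢.src a.val = 𝒢.tgt b.val := congrArg DisjUnion.val h
    exact 𝒢.val_coverMul h'

variable {𝒰} {𝒱 : OpenCover M}

/-- The morphism between the pull-backs of `𝒢` along two open covers that is induced by a
choice `r`, for each member of the finer one, of a member of the other one containing it. -/
def refineMap (r : 𝒱.carrier → 𝒰.carrier) (hr : ∀ V, V.1 ≤ (r V).1) :
    (𝒢.cover 𝒱).Hom (𝒢.cover 𝒰) where
  base := ⟨fun x => .mk (r x.idx) x.val (hr _ x.val_mem),
    DisjUnion.contMDiff_iff.2 ⟨DisjUnion.contMDiff_val, fun a =>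
      (DisjUnion.eventually_idx a).mono fun b hb => congrArg r hb⟩⟩
  arr := ⟨fun a => .mk (r a.idx.1, r a.idx.2) a.val
      ⟨hr _ (CoverArrows.src_mem 𝒢 𝒱 a), hr _ (CoverArrows.tgt_mem 𝒢 𝒱 a)⟩,
    DisjUnion.contMDiff_iff.2 ⟨DisjUnion.contMDiff_val, fun a =>
      (DisjUnion.eventually_idx a).mono fun b hb => congrArg (Prod.map r r) hb⟩⟩
  src_arr _ := rfl
  tgt_arr _ := rfl
  arr_one _ := rfl
  arr_mul a b h := by
    have h' : 𝒢.src a.val = 𝒢.tgt b.val := congrArg DisjUnion.val h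
    refine DisjUnion.ext' ?_ ((𝒢.val_coverMul h').trans (Eq.symm (𝒢.val_coverMul h')))
    refine Eq.trans ?_ (Eq.symm (𝒢.idx_coverMul h'))
    exact congrArg (Prod.map r r) (𝒢.idx_coverMul h')

end LieGroupoid

/-! ### Differentiable cohomology in degree one -/

namespace LieGroupoid

variable {n m : ℕ} {M : Type u} {G : Type w}
  [TopologicalSpace M] [ChartedSpace (EuclideanSpace ℝ (Fin n)) M]
  [TopologicalSpace G] [ChartedSpace (EuclideanSpace ℝ (Fin m)) G]
  {n' m' : ℕ} {M' : Type u'} {G' : Type w'}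
  [TopologicalSpace M'] [ChartedSpace (EuclideanSpace ℝ (Fin n')) M']
  [TopologicalSpace G'] [ChartedSpace (EuclideanSpace ℝ (Fin m')) G']

section Coefficients

variable (𝒢 : LieGroupoid n m M G) {EA : Type*} [NormedAddCommGroup EA] [NormedSpace ℝ EA]
  {HA : Type*} [TopologicalSpace HA] (IA : ModelWithCorners ℝ EA HA)
  (A : Type*) [CommGroup A] [TopologicalSpace A] [ChartedSpace HA A] [LieGroup IA ∞ A]
  {EB : Type*} [NormedAddCommGroup EB] [NormedSpace ℝ EB]
  {HB : Type*} [TopologicalSpace HB] (IB : ModelWithCorners ℝ EB HB)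
  (B : Type*) [CommGroup B] [TopologicalSpace B] [ChartedSpace HB B] [LieGroup IB ∞ B]

/-- The group of differentiable 1-cocycles with coefficients in an abelian Lie group: the smooth
groupoid homomorphisms to it. -/
def Z1 : Subgroup (G → A) where
  carrier := {c | ContMDiff (𝓡 m) IA ∞ c ∧ ∀ g h, 𝒢.src g = 𝒢.tgt h → c (𝒢.mul g h) = c g * c h}
  mul_mem' {c d} hc hd := by
    have : ContMDiffMul IA ∞ A := LieGroup.toContMDiffMul
    refine ⟨hc.1.mul hd.1, fun g h hgh => ?_⟩
    simp only [Pi.mul_apply, hc.2 g h hgh, hd.2 g h hgh]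
    exact mul_mul_mul_comm _ _ _ _
  one_mem' := ⟨contMDiff_const, fun _ _ _ => (_root_.mul_one _).symm⟩
  inv_mem' {c} hc := by
    refine ⟨hc.1.inv, fun g h hgh => ?_⟩
    simp only [Pi.inv_apply, hc.2 g h hgh]
    exact _root_.mul_inv _ _

/-- The group of differentiable 1-coboundaries with coefficients in an abelian Lie group. -/
def B1 : Subgroup (G → A) where
  carrier := {c | ∃ f : M → A, ContMDiff (𝓡 n) IA ∞ f ∧ ∀ g, c g = f (𝒢.src g) / f (𝒢.tgt g)}
  mul_mem' := by
    rintro c d ⟨f, hf, hc⟩ ⟨f', hf', hd⟩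
    have : ContMDiffMul IA ∞ A := LieGroup.toContMDiffMul
    refine ⟨f * f', hf.mul hf', fun g => ?_⟩
    simp only [Pi.mul_apply, hc, hd]
    exact div_mul_div_comm _ _ _ _
  one_mem' := ⟨1, contMDiff_const, fun _ => by simp⟩
  inv_mem' := by
    rintro c ⟨f, hf, hc⟩
    refine ⟨f⁻¹, hf.inv, fun g => ?_⟩
    simp only [Pi.inv_apply, hc]
    rw [inv_div, inv_div_inv]

theorem B1_le_Z1 : 𝒢.B1 IA A ≤ 𝒢.Z1 IA A := by
  rintro c ⟨f, hf, hc⟩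
  refine ⟨?_, fun g h hgh => ?_⟩
  · have : c = fun g => f (𝒢.src g) / f (𝒢.tgt g) := funext hc
    rw [this]
    exact (hf.comp 𝒢.src.contMDiff).div (hf.comp 𝒢.tgt.contMDiff)
  · rw [hc, hc, hc, 𝒢.src_mul g h hgh, 𝒢.tgt_mul g h hgh, hgh, mul_comm]
    exact (div_mul_div_cancel _ _ _).symm

/-- The first differentiable cohomology group of a Lie groupoid with coefficients in an abelian Lie
group. -/
abbrev H1 := 𝒢.Z1 IA A ⧸ (𝒢.B1 IA A).subgroupOf (𝒢.Z1 IA A)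

variable {𝒢}

/-- The pull-back of cocycles along a morphism of Lie groupoids. -/
def Hom.pullZ1 {𝒢' : LieGroupoid n' m' M' G'} (Φ : 𝒢'.Hom 𝒢) : 𝒢.Z1 IA A →* 𝒢'.Z1 IA A where
  toFun c := ⟨c.1 ∘ Φ.arr, c.2.1.comp Φ.arr.contMDiff, fun g h hgh => by
    have h' : 𝒢.src (Φ.arr g) = 𝒢.tgt (Φ.arr h) := by rw [Φ.src_arr, Φ.tgt_arr, hgh]
    simp only [Function.comp_apply, Φ.arr_mul g h hgh, c.2.2 _ _ h']⟩
  map_one' := rfl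
  map_mul' _ _ := rfl

/-- The pull-back of cohomology classes along a morphism of Lie groupoids. -/
def Hom.pullH1 {𝒢' : LieGroupoid n' m' M' G'} (Φ : 𝒢'.Hom 𝒢) : 𝒢.H1 IA A →* 𝒢'.H1 IA A :=
  QuotientGroup.map _ _ (Φ.pullZ1 IA A) (by
    rintro c ⟨f, hf, hc⟩
    refine ⟨f ∘ Φ.base, hf.comp Φ.base.contMDiff, fun g => ?_⟩
    have := hc (Φ.arr g)
    rw [Φ.src_arr, Φ.tgt_arr] at this
    exact this)

variable {IA IB A B}

/-- The map on cohomology induced by a morphism of abelian Lie groups. -/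
def H1.mapCoeff (φ : A →* B) (hφ : ContMDiff IA IB ∞ φ) : 𝒢.H1 IA A →* 𝒢.H1 IB B :=
  QuotientGroup.map _ _
    (MonoidHom.mk' (fun c : 𝒢.Z1 IA A => (⟨φ ∘ c.1, hφ.comp c.2.1, fun g h hgh => by
        simp only [Function.comp_apply, c.2.2 g h hgh, map_mul]⟩ : 𝒢.Z1 IB B))
      (fun c d => Subtype.ext (funext fun g => map_mul φ (c.1 g) (d.1 g)))) (by
    rintro c ⟨f, hf, hc⟩
    refine ⟨φ ∘ f, hφ.comp hf, fun g => ?_⟩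
    exact (congrArg φ (hc g)).trans (map_div φ _ _))

end Coefficients

section Real

variable (𝒢 : LieGroupoid n m M G)

/-- The space of real valued differentiable 1-cocycles. -/
def RealZ1 : Submodule ℝ (G → ℝ) where
  carrier := {c | ContMDiff (𝓡 m) 𝓘(ℝ, ℝ) ∞ c ∧
    ∀ g h, 𝒢.src g = 𝒢.tgt h → c (𝒢.mul g h) = c g + c h}
  add_mem' {c d} hc hd := by
    refine ⟨hc.1.add hd.1, fun g h hgh => ?_⟩
    simp only [Pi.add_apply, hc.2 g h hgh, hd.2 g h hgh]
    ring
  zero_mem' := ⟨contMDiff_const, fun _ _ _ => (add_zero _).symm⟩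
  smul_mem' r c hc := by
    refine ⟨(contDiff_const_smul r).contMDiff.comp hc.1, fun g h hgh => ?_⟩
    simp only [Pi.smul_apply, hc.2 g h hgh, smul_add]

/-- The space of real valued differentiable 1-coboundaries. -/
def RealB1 : Submodule ℝ (G → ℝ) where
  carrier := {c | ∃ f : M → ℝ, ContMDiff (𝓡 n) 𝓘(ℝ, ℝ) ∞ f ∧
    ∀ g, c g = f (𝒢.src g) - f (𝒢.tgt g)}
  add_mem' := by
    rintro c d ⟨f, hf, hc⟩ ⟨f', hf', hd⟩
    refine ⟨f + f', hf.add hf', fun g => ?_⟩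
    simp only [Pi.add_apply, hc, hd]
    ring
  zero_mem' := ⟨0, contMDiff_const, fun _ => by simp⟩
  smul_mem' := by
    rintro r c ⟨f, hf, hc⟩
    refine ⟨r • f, (contDiff_const_smul r).contMDiff.comp hf, fun g => ?_⟩
    simp only [Pi.smul_apply, hc, smul_sub]

/-- The first differentiable cohomology of a Lie groupoid (with real coefficients), a real vector
space. -/
abbrev RealH1 := 𝒢.RealZ1 ⧸ 𝒢.RealB1.submoduleOf 𝒢.RealZ1

variable {𝒢}

/-- The pull-back of real cohomology classes along a morphism of Lie groupoids. -/
def Hom.pullRealH1 {𝒢' : LieGroupoid n' m' M' G'} (Φ : 𝒢'.Hom 𝒢) : 𝒢.RealH1 →ₗ[ℝ] 𝒢'.RealH1 :=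
  Submodule.mapQ _ _
    { toFun := fun c => (⟨c.1 ∘ Φ.arr, c.2.1.comp Φ.arr.contMDiff, fun g h hgh => by
        have h' : 𝒢.src (Φ.arr g) = 𝒢.tgt (Φ.arr h) := by rw [Φ.src_arr, Φ.tgt_arr, hgh]
        simp only [Function.comp_apply, Φ.arr_mul g h hgh, c.2.2 _ _ h']⟩ : 𝒢'.RealZ1)
      map_add' := fun _ _ => rfl
      map_smul' := fun _ _ => rfl } (by
    rintro c ⟨f, hf, hc⟩
    refine ⟨f ∘ Φ.base, hf.comp Φ.base.contMDiff, fun g => ?_⟩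
    have := hc (Φ.arr g)
    rw [Φ.src_arr, Φ.tgt_arr] at this
    exact this)

theorem contMDiff_logAbs : ContMDiff 𝓘(ℝ, ℝ) 𝓘(ℝ, ℝ) ∞ (fun a : ℝˣ => Real.log |(a : ℝ)|) := by
  intro a
  have h : ContMDiffAt 𝓘(ℝ, ℝ) 𝓘(ℝ, ℝ) ∞ Real.log (a : ℝ) :=
    (Real.contDiffAt_log.2 a.ne_zero).contMDiffAt
  simp only [Real.log_abs]
  exact h.comp a (Units.contMDiff_val a)

/-- The map `[c] ↦ [ln |c|]`. -/
def H1.logAbs : 𝒢.H1 𝓘(ℝ, ℝ) ℝˣ →* Multiplicative 𝒢.RealH1 :=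
  QuotientGroup.lift _
    (MonoidHom.mk' (fun c : 𝒢.Z1 𝓘(ℝ, ℝ) ℝˣ => Multiplicative.ofAdd (Submodule.Quotient.mk
        (⟨fun g => Real.log |(c.1 g : ℝ)|, contMDiff_logAbs.comp c.2.1, fun g h hgh => by
          simp only [c.2.2 g h hgh, Units.val_mul, abs_mul]
          exact Real.log_mul (abs_ne_zero.2 (c.1 g).ne_zero) (abs_ne_zero.2 (c.1 h).ne_zero)⟩ :
          𝒢.RealZ1)))
      (fun c d => by
        rw [← ofAdd_add, ← Submodule.Quotient.mk_add]
        refine congrArg (fun x => Multiplicative.ofAdd (Submodule.Quotient.mk x))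
          (Subtype.ext (funext fun g => ?_))
        change Real.log |((c.1 g * d.1 g : ℝˣ) : ℝ)| = _
        rw [Units.val_mul, abs_mul]
        exact Real.log_mul (abs_ne_zero.2 (c.1 g).ne_zero) (abs_ne_zero.2 (d.1 g).ne_zero))) (by
    rintro c ⟨f, hf, hc⟩
    refine congrArg Multiplicative.ofAdd ((Submodule.Quotient.mk_eq_zero _).2
      ⟨fun x => Real.log |(f x : ℝ)|, contMDiff_logAbs.comp hf, fun g => ?_⟩)
    have : c.1 g = f (𝒢.src g) / f (𝒢.tgt g) := hc g
    change Real.log |((c.1 g : ℝˣ) : ℝ)| = _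
    rw [this, Units.val_div_eq_div_val, abs_div]
    exact Real.log_div (abs_ne_zero.2 (f _).ne_zero) (abs_ne_zero.2 (f _).ne_zero))

end Real

end LieGroupoid

/-- The group `ℤ₂ = {1, -1}` as a zero-dimensional manifold. -/
instance : ChartedSpace (EuclideanSpace ℝ (Fin 0)) ℤˣ := ChartedSpace.ofDiscreteTopology

/-- The group `ℤ₂ = {1, -1}` as a zero-dimensional Lie group. -/
instance : LieGroup (𝓡 0) ∞ ℤˣ where
  toIsManifold := IsManifold.of_discreteTopology _
  contMDiff_mul := contMDiff_of_discreteTopology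
  contMDiff_inv := contMDiff_of_discreteTopology

/-- The homomorphism `sign : ℝ^* → {1, -1}`. -/
def signUnits : ℝˣ →* ℤˣ where
  toFun a := if 0 < (a : ℝ) then 1 else -1
  map_one' := by simp
  map_mul' a b := by
    rcases lt_or_gt_of_ne a.ne_zero with ha | ha <;> rcases lt_or_gt_of_ne b.ne_zero with hb | hb
    · simp [ha.not_gt, hb.not_gt, mul_pos_of_neg_of_neg ha hb]
    · simp [ha.not_gt, hb, (mul_neg_of_neg_of_pos ha hb).not_gt]
    · simp [ha, hb.not_gt, (mul_neg_of_pos_of_neg ha hb).not_gt]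
    · simp [ha, hb]

theorem contMDiff_signUnits : ContMDiff 𝓘(ℝ, ℝ) (𝓡 0) ∞ signUnits := by
  intro a
  have h : ∀ᶠ b : ℝˣ in 𝓝 a, signUnits b = signUnits a := by
    rcases lt_or_gt_of_ne a.ne_zero with ha | ha
    · have := (Units.continuous_val.tendsto a).eventually (gt_mem_nhds ha)
      filter_upwards [this] with b hb
      simp [signUnits, ha.not_gt, hb.not_gt]
    · have := (Units.continuous_val.tendsto a).eventually (lt_mem_nhds ha)
      filter_upwards [this] with b hb
      simp [signUnits, ha, hb]
  exact (contMDiffAt_const (c := signUnits a)).congr_of_eventuallyEq h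

namespace LieGroupoid

variable {n m : ℕ} {M : Type u} {G : Type w}
  [TopologicalSpace M] [ChartedSpace (EuclideanSpace ℝ (Fin n)) M]
  [TopologicalSpace G] [ChartedSpace (EuclideanSpace ℝ (Fin m)) G]

/-- The map `[c] ↦ [sign c]`. -/
def H1.sign {𝒢 : LieGroupoid n m M G} : 𝒢.H1 𝓘(ℝ, ℝ) ℝˣ →* 𝒢.H1 (𝓡 0) ℤˣ :=
  H1.mapCoeff signUnits contMDiff_signUnits

/-! ### Čech-type differentiable cohomology -/

section Cech

variable [IsManifold (𝓡 n) ∞ M] [IsManifold (𝓡 m) ∞ G] (𝒢 : LieGroupoid n m M G)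
  {EA : Type*} [NormedAddCommGroup EA] [NormedSpace ℝ EA]
  {HA : Type*} [TopologicalSpace HA] (IA : ModelWithCorners ℝ EA HA)
  (A : Type*) [CommGroup A] [TopologicalSpace A] [ChartedSpace HA A] [LieGroup IA ∞ A]

theorem exists_refine {𝒰 𝒱 : OpenCover M} (h : 𝒰 ≤ 𝒱) :
    ∃ r : 𝒱.carrier → 𝒰.carrier, ∀ V, V.1 ≤ (r V).1 := by
  choose f hf hf' using h
  exact ⟨fun V => ⟨f V.1 V.2, hf V.1 V.2⟩, fun V => hf' V.1 V.2⟩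

/-- The restriction of cohomology classes to a refinement of an open cover. -/
def resH1 {𝒰 𝒱 : OpenCover M} (h : 𝒰 ≤ 𝒱) :
    (𝒢.cover 𝒰).H1 IA A →* (𝒢.cover 𝒱).H1 IA A :=
  (𝒢.refineMap (exists_refine h).choose (exists_refine h).choose_spec).pullH1 IA A

variable {IA A} in
/-- The restriction to a refinement does not depend on the choice of the refinement map. -/
theorem pullH1_refineMap_eq {𝒰 𝒱 : OpenCover M} (r r' : 𝒱.carrier → 𝒰.carrier)
    (hr : ∀ V, V.1 ≤ (r V).1) (hr' : ∀ V, V.1 ≤ (r' V).1) (x : (𝒢.cover 𝒰).H1 IA A) :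
    (𝒢.refineMap r hr).pullH1 IA A x = (𝒢.refineMap r' hr').pullH1 IA A x := by
  induction x using QuotientGroup.induction_on with | _ c
  refine QuotientGroup.eq.2 ?_
  let φ : 𝒱.Space → 𝒢.CoverArrows 𝒰 := fun x => .mk (r x.idx, r' x.idx) (𝒢.one x.val)
      ⟨by rw [𝒢.src_one]; exact hr _ x.val_mem, by rw [𝒢.tgt_one]; exact hr' _ x.val_mem⟩
  have hφ : ContMDiff (𝓡 n) (𝓡 m) ∞ φ :=
    DisjUnion.contMDiff_iff.2 ⟨𝒢.one.contMDiff.comp DisjUnion.contMDiff_val, fun a =>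
      (DisjUnion.eventually_idx a).mono fun b hb => congrArg (fun i => (r i, r' i)) hb⟩
  refine ⟨fun x => (c.1 (φ x))⁻¹, (c.2.1.comp hφ).inv, fun a => ?_⟩
  have h₁ := c.2.2 ((𝒢.refineMap r' hr').arr a) (φ ((𝒢.cover 𝒱).src a))
    (DisjUnion.ext' rfl (𝒢.tgt_one _).symm)
  have h₂ := c.2.2 (φ ((𝒢.cover 𝒱).tgt a)) ((𝒢.refineMap r hr).arr a)
    (DisjUnion.ext' rfl (𝒢.src_one _))
  have h₃ : (𝒢.cover 𝒰).mul ((𝒢.refineMap r' hr').arr a) (φ ((𝒢.cover 𝒱).src a)) =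
      (𝒢.cover 𝒰).mul (φ ((𝒢.cover 𝒱).tgt a)) ((𝒢.refineMap r hr).arr a) := by
    have e₁ : 𝒢.src ((𝒢.refineMap r' hr').arr a).val = 𝒢.tgt (φ ((𝒢.cover 𝒱).src a)).val :=
      (𝒢.tgt_one _).symm
    have e₂ : 𝒢.src (φ ((𝒢.cover 𝒱).tgt a)).val = 𝒢.tgt ((𝒢.refineMap r hr).arr a).val :=
      𝒢.src_one _
    refine DisjUnion.ext' ((𝒢.idx_coverMul e₁).trans (𝒢.idx_coverMul e₂).symm)
      ((𝒢.val_coverMul e₁).trans (Eq.trans ?_ (𝒢.val_coverMul e₂).symm))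
    exact (𝒢.mul_one a.val).trans (𝒢.one_mul a.val).symm
  rw [h₃, h₂] at h₁
  change (c.1 ((𝒢.refineMap r hr).arr a))⁻¹ * c.1 ((𝒢.refineMap r' hr').arr a) =
    (c.1 (φ ((𝒢.cover 𝒱).src a)))⁻¹ / (c.1 (φ ((𝒢.cover 𝒱).tgt a)))⁻¹
  rw [inv_div_inv, inv_mul_eq_iff_eq_mul, ← mul_div_assoc, eq_div_iff_mul_eq']
  exact h₁.symm.trans (mul_comm _ _)

instance : DirectedSystem (fun 𝒰 : OpenCover M => (𝒢.cover 𝒰).H1 IA A)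
    (fun _ _ h => 𝒢.resH1 IA A h) where
  map_self 𝒰 x := by
    refine (𝒢.pullH1_refineMap_eq _ id _ (fun V => le_rfl) x).trans ?_
    induction x using QuotientGroup.induction_on with | _ c
    rfl
  map_map 𝒰 𝒱 𝒲 h₁ h₂ x := by
    refine Eq.trans ?_ (𝒢.pullH1_refineMap_eq
      ((exists_refine h₁).choose ∘ (exists_refine h₂).choose) _
      (fun V => ((exists_refine h₂).choose_spec V).trans ((exists_refine h₁).choose_spec _)) _ x)
    induction x using QuotientGroup.induction_on with | _ c
    rfl

/-- The Čech-type differentiable cohomology group in degree one: the filtered colimit of the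
differentiable cohomology groups of the pull-backs of the groupoid along the open covers of the
base, with respect to refinement. -/
abbrev CechH1 := DirectLimit (fun 𝒰 : OpenCover M => (𝒢.cover 𝒰).H1 IA A)
  (fun _ _ h => 𝒢.resH1 IA A h)

variable {IA A}

/-- The class in Čech-type cohomology that is represented by a class over an open cover. -/
def CechH1.of (𝒰 : OpenCover M) (x : (𝒢.cover 𝒰).H1 IA A) : 𝒢.CechH1 IA A := ⟦⟨𝒰, x⟩⟧

end Cech

end LieGroupoid

/-! ### Smooth line bundles -/

/-- A smooth real line bundle over the manifold `M`. -/
structure LineBundle (n : ℕ) (M : Type u) [TopologicalSpace M]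
    [ChartedSpace (EuclideanSpace ℝ (Fin n)) M] where
  fib : M → Type v
  [addCommGroup : ∀ x, AddCommGroup (fib x)]
  [module : ∀ x, Module ℝ (fib x)]
  [topFib : ∀ x, TopologicalSpace (fib x)]
  [topTotal : TopologicalSpace (TotalSpace ℝ fib)]
  [fiberBundle : FiberBundle ℝ fib]
  [vectorBundle : VectorBundle ℝ ℝ fib]
  [contMDiffVectorBundle : ContMDiffVectorBundle ∞ ℝ fib (𝓡 n)]

attribute [instance] LineBundle.addCommGroup LineBundle.module LineBundle.topFib
  LineBundle.topTotal LineBundle.fiberBundle LineBundle.vectorBundle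
  LineBundle.contMDiffVectorBundle

/-- A family of 1-dimensional vector spaces over `M` together with local frames near each point
that are related by smooth functions. -/
structure FrameAtlas (n : ℕ) {M : Type u} [TopologicalSpace M]
    [ChartedSpace (EuclideanSpace ℝ (Fin n)) M] (fib : M → Type v) [∀ x, AddCommGroup (fib x)]
    [∀ x, Module ℝ (fib x)] where
  dom : M → Set M
  isOpen_dom : ∀ i, IsOpen (dom i)
  mem_dom : ∀ i, i ∈ dom i
  frame : ∀ _ : M, ∀ x, fib x
  coord : ∀ _ : M, ∀ x, fib x →ₗ[ℝ] ℝ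
  coord_frame : ∀ i, ∀ x ∈ dom i, coord i x (frame i x) = 1
  coord_smul_frame : ∀ i, ∀ x ∈ dom i, ∀ v, coord i x v • frame i x = v
  smooth : ∀ i j, ContMDiffOn (𝓡 n) 𝓘(ℝ, ℝ) ∞ (fun x => coord j x (frame i x)) (dom i ∩ dom j)

namespace FrameAtlas

variable {n : ℕ} {M : Type u} [TopologicalSpace M]
    [ChartedSpace (EuclideanSpace ℝ (Fin n)) M] {fib : M → Type v} [∀ x, AddCommGroup (fib x)]
    [∀ x, Module ℝ (fib x)] (𝒜 : FrameAtlas n fib)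

/-- The local trivialization given by a local frame. -/
def pretriv (i : M) : Pretrivialization ℝ (π ℝ fib) where
  toFun p := (p.1, 𝒜.coord i p.1 p.2)
  invFun q := ⟨q.1, q.2 • 𝒜.frame i q.1⟩
  source := π ℝ fib ⁻¹' 𝒜.dom i
  target := 𝒜.dom i ×ˢ univ
  map_source' _ hp := ⟨hp, mem_univ _⟩
  map_target' _ hq := hq.1
  left_inv' := by
    rintro ⟨x, v⟩ hp
    exact congrArg (TotalSpace.mk x) (𝒜.coord_smul_frame i x hp v)
  right_inv' := by
    rintro ⟨x, a⟩ hq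
    simp only [map_smul, 𝒜.coord_frame i x hq.1, smul_eq_mul, _root_.mul_one]
  open_target := (𝒜.isOpen_dom i).prod isOpen_univ
  baseSet := 𝒜.dom i
  open_baseSet := 𝒜.isOpen_dom i
  source_eq := rfl
  target_eq := rfl
  proj_toFun _ _ := rfl

/-- The topology on the fibers. -/
@[reducible] def topFib (x : M) : TopologicalSpace (fib x) :=
  TopologicalSpace.induced (𝒜.coord x x) inferInstance

theorem pretriv_symm {i x : M} (hx : x ∈ 𝒜.dom i) (a : ℝ) :
    TotalSpace.mk' ℝ x ((𝒜.pretriv i).symm x a) = ⟨x, a • 𝒜.frame i x⟩ :=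
  (𝒜.pretriv i).mk_symm hx a

theorem coordChange_eq {i j b : M} (hb : b ∈ 𝒜.dom i ∩ 𝒜.dom j) (a : ℝ) :
    (𝒜.coord j b (𝒜.frame i b) • ContinuousLinearMap.id ℝ ℝ) a =
      (𝒜.pretriv j ⟨b, (𝒜.pretriv i).symm b a⟩).2 := by
  have h := congrArg (fun p => (𝒜.pretriv j p).2) (𝒜.pretriv_symm hb.1 a)
  refine Eq.trans ?_ h.symm
  change _ = 𝒜.coord j b (a • 𝒜.frame i b)
  simp [mul_comm]

/-- The line bundle with the given fibers and local frames, as a prebundle. -/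
def prebundle : letI := 𝒜.topFib; VectorPrebundle ℝ ℝ fib :=
  letI := 𝒜.topFib
  { pretrivializationAtlas := range 𝒜.pretriv
    pretrivialization_linear' := by
      rintro _ ⟨i, rfl⟩
      exact ⟨fun x _ => (𝒜.coord i x).isLinear⟩
    pretrivializationAt := 𝒜.pretriv
    mem_base_pretrivializationAt := 𝒜.mem_dom
    pretrivialization_mem_atlas := mem_range_self
    exists_coordChange := by
      rintro _ ⟨i, rfl⟩ _ ⟨j, rfl⟩
      exact ⟨fun b => 𝒜.coord j b (𝒜.frame i b) • ContinuousLinearMap.id ℝ ℝ,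
        (𝒜.smooth i j).continuousOn.smul continuousOn_const, fun b hb a => 𝒜.coordChange_eq hb a⟩
    totalSpaceMk_isInducing := fun b =>
      (isEmbedding_prodMkRight b).isInducing.comp ⟨rfl⟩ }

/-- The line bundle with the given fibers and local frames. -/
def lineBundle : LineBundle n M :=
  letI := 𝒜.topFib
  letI := 𝒜.prebundle.totalSpaceTopology
  letI := 𝒜.prebundle.toFiberBundle
  letI : VectorBundle ℝ ℝ fib := 𝒜.prebundle.toVectorBundle
  have : 𝒜.prebundle.IsContMDiff (𝓡 n) ∞ := ⟨by
    rintro _ ⟨i, rfl⟩ _ ⟨j, rfl⟩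
    refine ⟨fun b => 𝒜.coord j b (𝒜.frame i b) • ContinuousLinearMap.id ℝ ℝ, ?_,
      fun b hb a => 𝒜.coordChange_eq hb a⟩
    have h : ContMDiff 𝓘(ℝ, ℝ) 𝓘(ℝ, ℝ →L[ℝ] ℝ) ∞
        (fun a : ℝ => a • ContinuousLinearMap.id ℝ ℝ) :=
      (contDiff_id.smul contDiff_const).contMDiff
    exact h.comp_contMDiffOn (𝒜.smooth i j)⟩
  letI : ContMDiffVectorBundle ∞ ℝ fib (𝓡 n) := 𝒜.prebundle.contMDiffVectorBundle (𝓡 n)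
  { fib := fib }

theorem trivializationAt_apply (i : M) (p : TotalSpace ℝ 𝒜.lineBundle.fib) :
    (trivializationAt ℝ 𝒜.lineBundle.fib i p).2 = 𝒜.coord i p.1 p.2 := rfl

end FrameAtlas

namespace LineBundle

variable {n : ℕ} {M : Type u} [TopologicalSpace M] [ChartedSpace (EuclideanSpace ℝ (Fin n)) M]
  {n' : ℕ} {M' : Type u'} [TopologicalSpace M'] [ChartedSpace (EuclideanSpace ℝ (Fin n')) M']
  (L : LineBundle.{u, v} n M) (L' : LineBundle.{u', v'} n' M')

/-- The pull-back of a line bundle along a smooth map. -/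
def pull (f : C^∞⟮𝓡 n', M'; 𝓡 n, M⟯) : LineBundle.{u', v} n' M' where
  fib := f *ᵖ L.fib
  addCommGroup x := L.addCommGroup (f x)
  module x := L.module (f x)
  topFib x := L.topFib (f x)
  topTotal := Pullback.TotalSpace.topologicalSpace ℝ L.fib f
  fiberBundle := FiberBundle.pullback f
  vectorBundle := VectorBundle.pullback ℝ f
  contMDiffVectorBundle := ContMDiffVectorBundle.pullback ℝ L.fib (𝓡 n') f

/-- The coordinate in the preferred trivialization at `i`. -/
def crd (i x : M) (w : L.fib x) : ℝ := (trivializationAt ℝ L.fib i ⟨x, w⟩).2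

theorem crd_smul {i x : M} (hx : x ∈ (trivializationAt ℝ L.fib i).baseSet) (a : ℝ)
    (w : L.fib x) : L.crd i x (a • w) = a * L.crd i x w :=
  ((trivializationAt ℝ L.fib i).linear ℝ hx).map_smul a w

theorem crd_injective {i x : M} (hx : x ∈ (trivializationAt ℝ L.fib i).baseSet) :
    Function.Injective (L.crd i x) :=
  ((trivializationAt ℝ L.fib i).linearEquivAt ℝ x hx).injective

theorem crd_ne_zero {i x : M} (hx : x ∈ (trivializationAt ℝ L.fib i).baseSet) {w : L.fib x}
    (hw : w ≠ 0) : L.crd i x w ≠ 0 :=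
  ((trivializationAt ℝ L.fib i).linearEquivAt ℝ x hx).map_ne_zero_iff.2 hw

theorem mem_base (x : M) : x ∈ (trivializationAt ℝ L.fib x).baseSet :=
  mem_baseSet_trivializationAt ℝ L.fib x

theorem eq_div_smul {i x : M} (hx : x ∈ (trivializationAt ℝ L.fib i).baseSet) {w₀ : L.fib x}
    (h : L.crd i x w₀ ≠ 0) (w : L.fib x) : w = (L.crd i x w / L.crd i x w₀) • w₀ :=
  L.crd_injective hx (by rw [L.crd_smul hx, div_mul_cancel₀ _ h])

theorem exists_smul_eq {x : M} {w₀ : L.fib x} (h : w₀ ≠ 0) (w : L.fib x) : ∃ a : ℝ, w = a • w₀ :=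
  ⟨_, L.eq_div_smul (L.mem_base x) (L.crd_ne_zero (L.mem_base x) h) w⟩

/-- A section is smooth at a point. -/
def SmoothAt (σ : ∀ x, L.fib x) (x : M) : Prop :=
  ContMDiffAt (𝓡 n) ((𝓡 n).prod 𝓘(ℝ, ℝ)) ∞ (fun y => TotalSpace.mk' ℝ y (σ y)) x

variable {E : Type*} [NormedAddCommGroup E] [NormedSpace ℝ E] {H : Type*} [TopologicalSpace H]
  {I : ModelWithCorners ℝ E H} {K : Type*} [TopologicalSpace K] [ChartedSpace H K]

variable {L}

theorem eventually_mem_base {f : K → M} {k : K} (hf : ContMDiffAt I (𝓡 n) ∞ f k) :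
    ∀ᶠ k' in 𝓝 k, f k' ∈ (trivializationAt ℝ L.fib (f k)).baseSet :=
  hf.continuousAt.eventually
    ((trivializationAt ℝ L.fib (f k)).open_baseSet.mem_nhds (L.mem_base _))

theorem contMDiffAt_iff {f : K → M} {σ : ∀ k, L.fib (f k)} {k : K} :
    ContMDiffAt I ((𝓡 n).prod 𝓘(ℝ, ℝ)) ∞ (fun k => TotalSpace.mk' ℝ (f k) (σ k)) k ↔
      ContMDiffAt I (𝓡 n) ∞ f k ∧
        ContMDiffAt I 𝓘(ℝ, ℝ) ∞ (fun k' => L.crd (f k) (f k') (σ k')) k :=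
  contMDiffAt_totalSpace

theorem contMDiffAt_smul {f : K → M} {σ : ∀ k, L.fib (f k)} {c : K → ℝ} {k : K}
    (hσ : ContMDiffAt I ((𝓡 n).prod 𝓘(ℝ, ℝ)) ∞ (fun k => TotalSpace.mk' ℝ (f k) (σ k)) k)
    (hc : ContMDiffAt I 𝓘(ℝ, ℝ) ∞ c k) :
    ContMDiffAt I ((𝓡 n).prod 𝓘(ℝ, ℝ)) ∞ (fun k => TotalSpace.mk' ℝ (f k) (c k • σ k)) k := by
  rw [contMDiffAt_iff] at hσ ⊢
  refine ⟨hσ.1, (hc.mul hσ.2).congr_of_eventuallyEq ?_⟩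
  filter_upwards [eventually_mem_base (L := L) hσ.1] with k' hk'
  exact L.crd_smul hk' _ _

/-- The quotient of two smooth sections is smooth. -/
theorem contMDiffAt_coeff {f : K → M} {σ τ : ∀ k, L.fib (f k)} {c : K → ℝ} {k : K}
    (hσ : ContMDiffAt I ((𝓡 n).prod 𝓘(ℝ, ℝ)) ∞ (fun k => TotalSpace.mk' ℝ (f k) (σ k)) k)
    (hτ : ContMDiffAt I ((𝓡 n).prod 𝓘(ℝ, ℝ)) ∞ (fun k => TotalSpace.mk' ℝ (f k) (τ k)) k)
    (hσ₀ : σ k ≠ 0) (hc : ∀ᶠ k' in 𝓝 k, τ k' = c k' • σ k') : ContMDiffAt I 𝓘(ℝ, ℝ) ∞ c k := by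
  rw [contMDiffAt_iff] at hσ hτ
  have hne : L.crd (f k) (f k) (σ k) ≠ 0 := L.crd_ne_zero (L.mem_base _) hσ₀
  have hne' := hσ.2.continuousAt.eventually (isOpen_ne.mem_nhds hne)
  have hd := hτ.2.mul (((contDiffAt_inv ℝ hne).contMDiffAt (n := ∞)).comp k hσ.2)
  refine hd.congr_of_eventuallyEq ?_
  filter_upwards [eventually_mem_base (L := L) hσ.1, hne', hc] with k' hk' hk'' hk
  change c k' = L.crd (f k) (f k') (τ k') * (L.crd (f k) (f k') (σ k'))⁻¹
  rw [hk, L.crd_smul hk', mul_assoc, mul_inv_cancel₀ hk'', _root_.mul_one]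

variable (L) in
theorem exists_frame (x₀ : M) : ∃ σ : ∀ x, L.fib x, L.SmoothAt σ x₀ ∧ σ x₀ ≠ 0 := by
  set e := trivializationAt ℝ L.fib x₀ with he
  have hb : ∀ x (hx : x ∈ e.baseSet), L.crd x₀ x (e.symm x 1) = 1 := by
    intro x hx
    change (e ⟨x, e.symm x 1⟩).2 = 1
    rw [e.apply_mk_symm hx]
  refine ⟨fun x => e.symm x 1, ?_, ?_⟩
  · refine contMDiffAt_iff.2 ⟨contMDiffAt_id, ?_⟩
    refine (contMDiffAt_const (c := (1 : ℝ))).congr_of_eventuallyEq ?_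
    filter_upwards [e.open_baseSet.mem_nhds (L.mem_base x₀)] with x hx
    exact hb x hx
  · intro h
    have h₁ := hb x₀ (L.mem_base x₀)
    rw [show e.symm x₀ 1 = 0 from h] at h₁
    have h₂ := L.crd_smul (L.mem_base x₀) 0 (0 : L.fib x₀)
    rw [zero_smul, zero_mul, h₁] at h₂
    exact one_ne_zero h₂

/-- A fiberwise linear map between line bundles is smooth if near each point it sends some smooth
local frame to a smooth map. -/
theorem contMDiff_of_frames {L' : LineBundle.{u', v'} n' M'} {f : M → M'}
    (F : ∀ x, L.fib x →ₗ[ℝ] L'.fib (f x))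
    (h : ∀ x₀, ∃ σ : ∀ x, L.fib x, L.SmoothAt σ x₀ ∧ σ x₀ ≠ 0 ∧
      ContMDiffAt (𝓡 n) ((𝓡 n').prod 𝓘(ℝ, ℝ)) ∞
        (fun x => TotalSpace.mk' ℝ (f x) (F x (σ x))) x₀) :
    ContMDiff ((𝓡 n).prod 𝓘(ℝ, ℝ)) ((𝓡 n').prod 𝓘(ℝ, ℝ)) ∞
      (fun p : TotalSpace ℝ L.fib => TotalSpace.mk' ℝ (f p.1) (F p.1 p.2)) := by
  rintro ⟨x₀, w₀⟩
  obtain ⟨σ, hσ, hσ₀, hF⟩ := h x₀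
  have hp : ContMDiffAt ((𝓡 n).prod 𝓘(ℝ, ℝ)) (𝓡 n) ∞ (fun p : TotalSpace ℝ L.fib => p.1)
      ⟨x₀, w₀⟩ := contMDiffAt_proj L.fib
  have hσ' : ContMDiffAt ((𝓡 n).prod 𝓘(ℝ, ℝ)) ((𝓡 n).prod 𝓘(ℝ, ℝ)) ∞
      (fun p : TotalSpace ℝ L.fib => TotalSpace.mk' ℝ p.1 (σ p.1)) ⟨x₀, w₀⟩ :=
    hσ.comp_of_eq hp rfl
  have hF' : ContMDiffAt ((𝓡 n).prod 𝓘(ℝ, ℝ)) ((𝓡 n').prod 𝓘(ℝ, ℝ)) ∞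
      (fun p : TotalSpace ℝ L.fib => TotalSpace.mk' ℝ (f p.1) (F p.1 (σ p.1))) ⟨x₀, w₀⟩ :=
    hF.comp_of_eq hp rfl
  have hne : L.crd x₀ x₀ (σ x₀) ≠ 0 := L.crd_ne_zero (L.mem_base _) hσ₀
  have hne' : ∀ᶠ p : TotalSpace ℝ L.fib in 𝓝 ⟨x₀, w₀⟩, L.crd x₀ p.1 (σ p.1) ≠ 0 :=
    (contMDiffAt_iff.1 hσ').2.continuousAt.eventually (isOpen_ne.mem_nhds hne)
  have hb := eventually_mem_base (L := L) hp
  have heq : ∀ᶠ p : TotalSpace ℝ L.fib in 𝓝 ⟨x₀, w₀⟩,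
      p.2 = (L.crd x₀ p.1 p.2 / L.crd x₀ p.1 (σ p.1)) • σ p.1 := by
    filter_upwards [hb, hne'] with p hp₁ hp₂
    exact L.eq_div_smul hp₁ hp₂ _
  have hc : ContMDiffAt ((𝓡 n).prod 𝓘(ℝ, ℝ)) 𝓘(ℝ, ℝ) ∞
      (fun p : TotalSpace ℝ L.fib => L.crd x₀ p.1 p.2 / L.crd x₀ p.1 (σ p.1)) ⟨x₀, w₀⟩ :=
    contMDiffAt_coeff hσ' (contMDiffAt_id (x := (⟨x₀, w₀⟩ : TotalSpace ℝ L.fib))) hσ₀ heq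
  refine (contMDiffAt_smul hF' hc).congr_of_eventuallyEq ?_
  filter_upwards [heq] with p hp
  refine congrArg (TotalSpace.mk' ℝ (f p.1)) ?_
  conv_lhs => rw [hp]
  rw [map_smul]

/-- A map to a pull-back bundle is smooth iff its components are. -/
theorem contMDiffAt_pull_iff {g : C^∞⟮𝓡 n', M'; 𝓡 n, M⟯} {f : K → M'}
    {σ : ∀ k, L.fib (g (f k))} {k : K} :
    ContMDiffAt I ((𝓡 n').prod 𝓘(ℝ, ℝ)) ∞
        (fun k => (TotalSpace.mk' ℝ (f k) (σ k) : TotalSpace ℝ (L.pull g).fib)) k ↔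
      ContMDiffAt I (𝓡 n') ∞ f k ∧
        ContMDiffAt I ((𝓡 n).prod 𝓘(ℝ, ℝ)) ∞ (fun k => TotalSpace.mk' ℝ (g (f k)) (σ k)) k := by
  refine (contMDiffAt_iff (L := L.pull g)).trans (Iff.trans ?_
    (and_congr Iff.rfl (contMDiffAt_iff (L := L)).symm))
  constructor
  · rintro ⟨h₁, h₂⟩
    exact ⟨h₁, g.contMDiff.contMDiffAt.comp k h₁, h₂⟩
  · rintro ⟨h₁, h₂, h₃⟩
    exact ⟨h₁, h₃⟩

end LineBundle

namespace FrameAtlas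

variable {n : ℕ} {M : Type u} [TopologicalSpace M]
  [ChartedSpace (EuclideanSpace ℝ (Fin n)) M] {fib : M → Type v} [∀ x, AddCommGroup (fib x)]
  [∀ x, Module ℝ (fib x)] {fib' : M → Type v'} [∀ x, AddCommGroup (fib' x)]
  [∀ x, Module ℝ (fib' x)]

/-- The tensor products of local frames. -/
def tensor (𝒜 : FrameAtlas n fib) (𝒜' : FrameAtlas n fib') :
    FrameAtlas n (fun x => fib x ⊗[ℝ] fib' x) where
  dom i := 𝒜.dom i ∩ 𝒜'.dom i
  isOpen_dom i := (𝒜.isOpen_dom i).inter (𝒜'.isOpen_dom i)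
  mem_dom i := ⟨𝒜.mem_dom i, 𝒜'.mem_dom i⟩
  frame i x := 𝒜.frame i x ⊗ₜ 𝒜'.frame i x
  coord i x := (TensorProduct.lid ℝ ℝ).toLinearMap ∘ₗ
    TensorProduct.map (𝒜.coord i x) (𝒜'.coord i x)
  coord_frame i x hx := by
    simp [𝒜.coord_frame i x hx.1, 𝒜'.coord_frame i x hx.2]
  coord_smul_frame i x hx w := by
    induction w using TensorProduct.induction_on with
    | zero => simp
    | tmul a b =>
      conv_rhs => rw [← 𝒜.coord_smul_frame i x hx.1 a, ← 𝒜'.coord_smul_frame i x hx.2 b]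
      rw [TensorProduct.smul_tmul_smul]
      simp
    | add a b ha hb => rw [map_add, add_smul, ha, hb]
  smooth i j := by
    have h : (𝒜.dom i ∩ 𝒜'.dom i) ∩ (𝒜.dom j ∩ 𝒜'.dom j) ⊆ 𝒜.dom i ∩ 𝒜.dom j :=
      fun x hx => ⟨hx.1.1, hx.2.1⟩
    have h' : (𝒜.dom i ∩ 𝒜'.dom i) ∩ (𝒜.dom j ∩ 𝒜'.dom j) ⊆ 𝒜'.dom i ∩ 𝒜'.dom j :=
      fun x hx => ⟨hx.1.2, hx.2.2⟩
    exact (((𝒜.smooth i j).mono h).mul ((𝒜'.smooth i j).mono h')).congr fun x _ => by simp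

/-- The dual local frames. -/
def dual (𝒜 : FrameAtlas n fib) : FrameAtlas n (fun x => Module.Dual ℝ (fib x)) where
  dom := 𝒜.dom
  isOpen_dom := 𝒜.isOpen_dom
  mem_dom := 𝒜.mem_dom
  frame i x := 𝒜.coord i x
  coord i x := Module.Dual.eval ℝ (fib x) (𝒜.frame i x)
  coord_frame i x hx := 𝒜.coord_frame i x hx
  coord_smul_frame i x hx ξ := by
    ext w
    conv_rhs => rw [← 𝒜.coord_smul_frame i x hx w]
    simp [mul_comm]
  smooth i j := by
    rw [inter_comm]
    exact 𝒜.smooth j i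

/-- The constant frame of the trivial line bundle. -/
def trivial (n : ℕ) (M : Type u) [TopologicalSpace M]
    [ChartedSpace (EuclideanSpace ℝ (Fin n)) M] : FrameAtlas n (fun _ : M => ULift.{v} ℝ) where
  dom _ := univ
  isOpen_dom _ := isOpen_univ
  mem_dom _ := mem_univ _
  frame _ _ := ⟨1⟩
  coord _ _ := ULift.moduleEquiv.toLinearMap
  coord_frame _ _ _ := rfl
  coord_smul_frame _ _ _ w := by
    ext
    simp
  smooth _ _ := contMDiffOn_const

end FrameAtlas

namespace LineBundle

variable {n : ℕ} {M : Type u} [TopologicalSpace M] [ChartedSpace (EuclideanSpace ℝ (Fin n)) M]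
  (L : LineBundle.{u, v} n M) (L' : LineBundle.{u, v'} n M)

/-- The local frames of a line bundle. -/
def frameAtlas : FrameAtlas n L.fib where
  dom i := (trivializationAt ℝ L.fib i).baseSet
  isOpen_dom i := (trivializationAt ℝ L.fib i).open_baseSet
  mem_dom := L.mem_base
  frame i x := (trivializationAt ℝ L.fib i).symm x 1
  coord i x := (trivializationAt ℝ L.fib i).linearMapAt ℝ x
  coord_frame i x hx := (trivializationAt ℝ L.fib i).linearMapAt_symm hx 1
  coord_smul_frame i x hx w := by
    have h := (trivializationAt ℝ L.fib i).symm_linearMapAt (R := ℝ) hx w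
    conv_rhs => rw [← h]
    rw [← (trivializationAt ℝ L.fib i).symmₗ_apply (R := ℝ) hx,
      ← (trivializationAt ℝ L.fib i).symmₗ_apply (R := ℝ) hx, ← map_smul, smul_eq_mul,
      _root_.mul_one]
  smooth i j := by
    have h := contMDiffOn_coordChangeL (n := ∞) (IB := 𝓡 n) (trivializationAt ℝ L.fib i)
      (trivializationAt ℝ L.fib j)
    refine ((h.clm_apply (contMDiffOn_const (c := (1 : ℝ))))).congr fun x hx => ?_
    rw [(trivializationAt ℝ L.fib j).coe_linearMapAt_of_mem (R := ℝ) hx.2]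
    exact ((trivializationAt ℝ L.fib i).coordChangeL_apply (R := ℝ) _ hx 1).symm

theorem coord_eq_crd {i x : M} (hx : x ∈ (trivializationAt ℝ L.fib i).baseSet) (w : L.fib x) :
    L.frameAtlas.coord i x w = L.crd i x w := by
  change (trivializationAt ℝ L.fib i).linearMapAt ℝ x w = _
  rw [(trivializationAt ℝ L.fib i).coe_linearMapAt_of_mem (R := ℝ) hx]
  rfl

/-- The tensor product of two line bundles; its fibers are the tensor products of the fibers. -/
def tensor : LineBundle.{u, max v v'} n M := (L.frameAtlas.tensor L'.frameAtlas).lineBundle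

/-- The dual of a line bundle; its fibers are the dual spaces of the fibers. -/
def dual : LineBundle.{u, v} n M := L.frameAtlas.dual.lineBundle

/-- The trivial line bundle. -/
def trivial (n : ℕ) (M : Type u) [TopologicalSpace M]
    [ChartedSpace (EuclideanSpace ℝ (Fin n)) M] : LineBundle.{u, v} n M :=
  (FrameAtlas.trivial n M).lineBundle

variable {E : Type*} [NormedAddCommGroup E] [NormedSpace ℝ E] {H : Type*} [TopologicalSpace H]
  {I : ModelWithCorners ℝ E H} {K : Type*} [TopologicalSpace K] [ChartedSpace H K]

variable {L L'}

theorem contMDiffAt_tmul {f : K → M} {σ : ∀ k, L.fib (f k)} {τ : ∀ k, L'.fib (f k)} {k : K}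
    (hσ : ContMDiffAt I ((𝓡 n).prod 𝓘(ℝ, ℝ)) ∞ (fun k => TotalSpace.mk' ℝ (f k) (σ k)) k)
    (hτ : ContMDiffAt I ((𝓡 n).prod 𝓘(ℝ, ℝ)) ∞ (fun k => TotalSpace.mk' ℝ (f k) (τ k)) k) :
    ContMDiffAt I ((𝓡 n).prod 𝓘(ℝ, ℝ)) ∞
      (fun k => (TotalSpace.mk' ℝ (f k) (σ k ⊗ₜ[ℝ] τ k) : TotalSpace ℝ (L.tensor L').fib)) k := by
  rw [contMDiffAt_iff] at hσ hτ
  refine (contMDiffAt_iff (L := L.tensor L')).2 ⟨hσ.1, (hσ.2.mul hτ.2).congr_of_eventuallyEq ?_⟩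
  filter_upwards [eventually_mem_base (L := L) hσ.1, eventually_mem_base (L := L') hσ.1]
    with k' h₁ h₂
  change (TensorProduct.lid ℝ ℝ).toLinearMap (TensorProduct.map (L.frameAtlas.coord (f k) (f k'))
    (L'.frameAtlas.coord (f k) (f k')) (σ k' ⊗ₜ[ℝ] τ k')) = _
  simp [L.coord_eq_crd h₁, L'.coord_eq_crd h₂]

/-- A section of the dual bundle is smooth if its pairing with a smooth frame is. -/
theorem contMDiffAt_dual {f : K → M} {σ : ∀ k, L.fib (f k)}
    {ξ : ∀ k, Module.Dual ℝ (L.fib (f k))} {k : K}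
    (hσ : ContMDiffAt I ((𝓡 n).prod 𝓘(ℝ, ℝ)) ∞ (fun k => TotalSpace.mk' ℝ (f k) (σ k)) k)
    (hσ₀ : σ k ≠ 0) (hξ : ContMDiffAt I 𝓘(ℝ, ℝ) ∞ (fun k => ξ k (σ k)) k) :
    ContMDiffAt I ((𝓡 n).prod 𝓘(ℝ, ℝ)) ∞
      (fun k => (TotalSpace.mk' ℝ (f k) (ξ k) : TotalSpace ℝ L.dual.fib)) k := by
  rw [contMDiffAt_iff] at hσ
  have hne : L.crd (f k) (f k) (σ k) ≠ 0 := L.crd_ne_zero (L.mem_base _) hσ₀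
  have hne' := hσ.2.continuousAt.eventually (isOpen_ne.mem_nhds hne)
  have hd := hξ.mul (((contDiffAt_inv ℝ hne).contMDiffAt (n := ∞)).comp k hσ.2)
  refine (contMDiffAt_iff (L := L.dual)).2 ⟨hσ.1, hd.congr_of_eventuallyEq ?_⟩
  filter_upwards [eventually_mem_base (L := L) hσ.1, hne'] with k' h₁ h₂
  have hfr : L.crd (f k) (f k') (L.frameAtlas.frame (f k) (f k')) = 1 := by
    rw [← L.coord_eq_crd h₁]
    exact L.frameAtlas.coord_frame _ _ h₁
  change ξ k' (L.frameAtlas.frame (f k) (f k')) = ξ k' (σ k') * (L.crd (f k) (f k') (σ k'))⁻¹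
  rw [L.eq_div_smul h₁ h₂ (L.frameAtlas.frame (f k) (f k')), hfr, map_smul, smul_eq_mul, mul_comm,
    one_div]

/-- The pairing of smooth sections is smooth. -/
theorem contMDiffAt_pairing {f : K → M} {σ : ∀ k, L.fib (f k)}
    {ξ : ∀ k, Module.Dual ℝ (L.fib (f k))} {k : K}
    (hσ : ContMDiffAt I ((𝓡 n).prod 𝓘(ℝ, ℝ)) ∞ (fun k => TotalSpace.mk' ℝ (f k) (σ k)) k)
    (hξ : ContMDiffAt I ((𝓡 n).prod 𝓘(ℝ, ℝ)) ∞
      (fun k => (TotalSpace.mk' ℝ (f k) (ξ k) : TotalSpace ℝ L.dual.fib)) k) :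
    ContMDiffAt I 𝓘(ℝ, ℝ) ∞ (fun k => ξ k (σ k)) k := by
  have h₁ := contMDiffAt_iff.1 hσ
  have h₂ := (contMDiffAt_iff (L := L.dual)).1 hξ
  refine (h₁.2.mul h₂.2).congr_of_eventuallyEq ?_
  filter_upwards [eventually_mem_base (L := L) h₁.1] with k' hk'
  change _ = L.crd (f k) (f k') (σ k') * ξ k' (L.frameAtlas.frame (f k) (f k'))
  rw [← L.coord_eq_crd hk', ← smul_eq_mul, ← map_smul, L.frameAtlas.coord_smul_frame _ _ hk']

theorem contMDiffAt_trivial {f : K → M} {c : K → ℝ} {k : K} (hf : ContMDiffAt I (𝓡 n) ∞ f k)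
    (hc : ContMDiffAt I 𝓘(ℝ, ℝ) ∞ c k) : ContMDiffAt I ((𝓡 n).prod 𝓘(ℝ, ℝ)) ∞
      (fun k => (TotalSpace.mk' ℝ (f k) ⟨c k⟩ : TotalSpace ℝ (trivial.{u, v} n M).fib)) k :=
  (contMDiffAt_iff (L := trivial.{u, v} n M)).2 ⟨hf, hc⟩

end LineBundle

/-! ### One-dimensional representations -/

namespace LieGroupoid

variable {n m : ℕ} {M : Type u} {G : Type w}
  [TopologicalSpace M] [ChartedSpace (EuclideanSpace ℝ (Fin n)) M]
  [TopologicalSpace G] [ChartedSpace (EuclideanSpace ℝ (Fin m)) G]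

/-- The inverse of an arrow. -/
def Arrow.symm {𝒢 : LieGroupoid n m M G} {x y : M} (g : 𝒢.Arrow x y) : 𝒢.Arrow y x :=
  ⟨𝒢.inv g.1, (𝒢.src_inv _).trans g.2.2, (𝒢.tgt_inv _).trans g.2.1⟩

theorem Arrow.symm_comp {𝒢 : LieGroupoid n m M G} {x y : M} (g : 𝒢.Arrow x y) :
    g.symm.comp g = 𝒢.unit x := by
  obtain ⟨g, rfl, rfl⟩ := g
  exact Subtype.ext (𝒢.inv_mul g)

theorem Arrow.comp_symm {𝒢 : LieGroupoid n m M G} {x y : M} (g : 𝒢.Arrow x y) :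
    g.comp g.symm = 𝒢.unit y := by
  obtain ⟨g, rfl, rfl⟩ := g
  exact Subtype.ext (𝒢.mul_inv g)

theorem Arrow.unit_comp {𝒢 : LieGroupoid n m M G} {x y : M} (g : 𝒢.Arrow x y) :
    (𝒢.unit y).comp g = g := by
  obtain ⟨g, rfl, rfl⟩ := g
  exact Subtype.ext (𝒢.one_mul g)

theorem Arrow.comp_assoc {𝒢 : LieGroupoid n m M G} {x y z t : M} (g : 𝒢.Arrow z t)
    (h : 𝒢.Arrow y z) (k : 𝒢.Arrow x y) : (g.comp h).comp k = g.comp (h.comp k) :=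
  Subtype.ext (𝒢.mul_assoc _ _ _ (g.2.1.trans h.2.2.symm) (h.2.1.trans k.2.2.symm))

theorem Arrow.symm_unit (𝒢 : LieGroupoid n m M G) (x : M) : (𝒢.unit x).symm = 𝒢.unit x := by
  have h := (𝒢.unit x).comp_symm
  rwa [Arrow.unit_comp] at h

theorem Arrow.symm_comp_rev {𝒢 : LieGroupoid n m M G} {x y z : M} (g : 𝒢.Arrow y z)
    (h : 𝒢.Arrow x y) : (g.comp h).symm = h.symm.comp g.symm := by
  have e : (h.symm.comp g.symm).comp (g.comp h) = 𝒢.unit x := by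
    rw [Arrow.comp_assoc, ← Arrow.comp_assoc g.symm, g.symm_comp, Arrow.unit_comp, h.symm_comp]
  have e' : ((h.symm.comp g.symm).comp (g.comp h)).comp (g.comp h).symm = (g.comp h).symm := by
    rw [e, Arrow.unit_comp]
  rw [← e', Arrow.comp_assoc, Arrow.comp_symm]
  refine Subtype.ext ?_
  have := 𝒢.mul_one (h.symm.comp g.symm).1
  rw [(h.symm.comp g.symm).2.1] at this
  exact this

end LieGroupoid

/-- A 1-dimensional representation of a Lie groupoid: a smooth line bundle `L` over the base
together with a linear action `g : L_x → L_y` of the arrows `g : x → y`, compatible with units and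
composition, such that the action map, from the pull-back of `L` along the source map to `L`, is
smooth. -/
structure LineRep {n m : ℕ} {M : Type u} {G : Type w}
    [TopologicalSpace M] [ChartedSpace (EuclideanSpace ℝ (Fin n)) M]
    [TopologicalSpace G] [ChartedSpace (EuclideanSpace ℝ (Fin m)) G] (𝒢 : LieGroupoid n m M G)
    extends LineBundle.{u, v} n M where
  act : ∀ {x y : M}, 𝒢.Arrow x y → (fib x →ₗ[ℝ] fib y)
  act_unit : ∀ x, act (𝒢.unit x) = LinearMap.id
  act_comp : ∀ {x y z : M} (g : 𝒢.Arrow y z) (h : 𝒢.Arrow x y), act (g.comp h) = act g ∘ₗ act h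
  contMDiff_act : ContMDiff ((𝓡 m).prod 𝓘(ℝ, ℝ)) ((𝓡 n).prod 𝓘(ℝ, ℝ)) ∞
    (fun p : TotalSpace ℝ (toLineBundle.pull 𝒢.src).fib =>
      TotalSpace.mk' ℝ (𝒢.tgt p.1) (act (𝒢.arrow p.1) p.2))

namespace LineRep

open LineBundle LieGroupoid

variable {n m : ℕ} {M : Type u} {G : Type w}
  [TopologicalSpace M] [ChartedSpace (EuclideanSpace ℝ (Fin n)) M]
  [TopologicalSpace G] [ChartedSpace (EuclideanSpace ℝ (Fin m)) G] {𝒢 : LieGroupoid n m M G}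
  {E : Type*} [NormedAddCommGroup E] [NormedSpace ℝ E] {H : Type*} [TopologicalSpace H]
  {I : ModelWithCorners ℝ E H} {K : Type*} [TopologicalSpace K] [ChartedSpace H K]

theorem act_symm_act (L : LineRep.{u, v} 𝒢) {x y : M} (g : 𝒢.Arrow x y) (a : L.fib x) :
    L.act g.symm (L.act g a) = a := by
  rw [← LinearMap.comp_apply, ← L.act_comp, g.symm_comp, L.act_unit]; rfl

theorem act_act_symm (L : LineRep.{u, v} 𝒢) {x y : M} (g : 𝒢.Arrow x y) (a : L.fib y) :
    L.act g (L.act g.symm a) = a := by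
  rw [← LinearMap.comp_apply, ← L.act_comp, g.comp_symm, L.act_unit]; rfl

theorem act_ne_zero (L : LineRep.{u, v} 𝒢) {x y : M} (g : 𝒢.Arrow x y) {a : L.fib x}
    (h : a ≠ 0) : L.act g a ≠ 0 := fun h' => h (by rw [← L.act_symm_act g a, h', map_zero])

/-- The action sends smooth sections of the pull-back along the source to smooth sections of
the pull-back along the target. -/
theorem contMDiffAt_act (L : LineRep.{u, v} 𝒢) {γ : K → G} {σ : ∀ k, L.fib (𝒢.src (γ k))} {k : K}
    (hγ : ContMDiffAt I (𝓡 m) ∞ γ k)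
    (hσ : ContMDiffAt I ((𝓡 n).prod 𝓘(ℝ, ℝ)) ∞
      (fun k => TotalSpace.mk' ℝ (𝒢.src (γ k)) (σ k)) k) :
    ContMDiffAt I ((𝓡 n).prod 𝓘(ℝ, ℝ)) ∞
      (fun k => TotalSpace.mk' ℝ (𝒢.tgt (γ k)) (L.act (𝒢.arrow (γ k)) (σ k))) k :=
  ContMDiffAt.comp_of_eq L.contMDiff_act.contMDiffAt (contMDiffAt_pull_iff.2 ⟨hγ, hσ⟩) rfl

theorem mk_act_eq (L : LineRep.{u, v} 𝒢) {x y : M} (g : 𝒢.Arrow x y) (σ : ∀ x, L.fib x) :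
    TotalSpace.mk' ℝ y (L.act g (σ x)) =
      TotalSpace.mk' ℝ (𝒢.tgt g.1) (L.act (𝒢.arrow g.1) (σ (𝒢.src g.1))) := by
  obtain ⟨g, rfl, rfl⟩ := g
  rfl

/-- An action on a line bundle is smooth if it is so on a smooth local frame near each point. -/
theorem contMDiff_act_of_frames (L : LineBundle.{u, v} n M)
    (act : ∀ {x y : M}, 𝒢.Arrow x y → (L.fib x →ₗ[ℝ] L.fib y))
    (h : ∀ g, ∃ σ : ∀ x, L.fib x, L.SmoothAt σ (𝒢.src g) ∧ σ (𝒢.src g) ≠ 0 ∧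
      ContMDiffAt (𝓡 m) ((𝓡 n).prod 𝓘(ℝ, ℝ)) ∞
        (fun g => TotalSpace.mk' ℝ (𝒢.tgt g) (act (𝒢.arrow g) (σ (𝒢.src g)))) g) :
    ContMDiff ((𝓡 m).prod 𝓘(ℝ, ℝ)) ((𝓡 n).prod 𝓘(ℝ, ℝ)) ∞
      (fun p : TotalSpace ℝ (L.pull 𝒢.src).fib =>
        TotalSpace.mk' ℝ (𝒢.tgt p.1) (act (𝒢.arrow p.1) p.2)) := by
  refine contMDiff_of_frames (L := L.pull 𝒢.src) (L' := L) (f := 𝒢.tgt)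
    (fun g => act (𝒢.arrow g)) fun g => ?_
  obtain ⟨σ, h₁, h₂, h₃⟩ := h g
  exact ⟨fun g => σ (𝒢.src g), contMDiffAt_pull_iff.2
    ⟨contMDiffAt_id, h₁.comp_of_eq 𝒢.src.contMDiff.contMDiffAt rfl⟩, h₂, h₃⟩

theorem tmul_ne_zero {L L' : LineBundle.{u, v} n M} {x : M} {a : L.fib x} {b : L'.fib x}
    (ha : a ≠ 0) (hb : b ≠ 0) : (a ⊗ₜ[ℝ] b : L.fib x ⊗[ℝ] L'.fib x) ≠ 0 := by
  intro h
  have h₁ := congrArg (L.frameAtlas.tensor L'.frameAtlas |>.coord x x) h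
  have h₂ : L.crd x x a * L'.crd x x b = 0 := by
    rw [← L.coord_eq_crd (L.mem_base x), ← L'.coord_eq_crd (L'.mem_base x)]
    simpa [FrameAtlas.tensor] using h₁
  exact mul_ne_zero (L.crd_ne_zero (L.mem_base x) ha) (L'.crd_ne_zero (L'.mem_base x) hb) h₂

/-- The tensor product of two 1-dimensional representations, with `g (a ⊗ b) = g a ⊗ g b`. -/
def tensor (L L' : LineRep.{u, v} 𝒢) : LineRep.{u, v} 𝒢 where
  toLineBundle := L.toLineBundle.tensor L'.toLineBundle
  act g := TensorProduct.map (L.act g) (L'.act g)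
  act_unit x := by
    rw [L.act_unit, L'.act_unit]
    exact TensorProduct.map_id
  act_comp g h := by
    rw [L.act_comp, L'.act_comp]
    exact TensorProduct.map_comp _ _ _ _
  contMDiff_act := by
    refine contMDiff_act_of_frames (L.toLineBundle.tensor L'.toLineBundle)
      (fun g => TensorProduct.map (L.act g) (L'.act g)) fun g => ?_
    obtain ⟨σ, hσ, hσ₀⟩ := L.toLineBundle.exists_frame (𝒢.src g)
    obtain ⟨τ, hτ, hτ₀⟩ := L'.toLineBundle.exists_frame (𝒢.src g)
    have hs := 𝒢.src.contMDiff.contMDiffAt (x := g)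
    exact ⟨fun x => σ x ⊗ₜ τ x, contMDiffAt_tmul hσ hτ, tmul_ne_zero hσ₀ hτ₀,
      contMDiffAt_tmul (L.contMDiffAt_act contMDiffAt_id (hσ.comp_of_eq hs rfl))
        (L'.contMDiffAt_act contMDiffAt_id (hτ.comp_of_eq hs rfl))⟩

/-- The trivial 1-dimensional representation. -/
def trivial (𝒢 : LieGroupoid n m M G) : LineRep.{u, v} 𝒢 where
  toLineBundle := LineBundle.trivial n M
  act _ := LinearMap.id
  act_unit _ := rfl
  act_comp _ _ := rfl
  contMDiff_act := by
    refine contMDiff_act_of_frames (LineBundle.trivial n M) (fun _ => LinearMap.id) fun g => ?_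
    refine ⟨fun _ => ⟨1⟩, contMDiffAt_trivial contMDiffAt_id contMDiffAt_const, ?_,
      contMDiffAt_trivial 𝒢.tgt.contMDiff.contMDiffAt contMDiffAt_const⟩
    exact fun h => one_ne_zero (congrArg ULift.down h)

/-- The dual of a 1-dimensional representation, with `g ξ = ξ ∘ g⁻¹`. -/
def dual (L : LineRep.{u, v} 𝒢) : LineRep.{u, v} 𝒢 where
  toLineBundle := L.toLineBundle.dual
  act g := (L.act g.symm).dualMap
  act_unit x := by
    rw [Arrow.symm_unit, L.act_unit]
    exact LinearMap.dualMap_id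
  act_comp g h := by
    rw [Arrow.symm_comp_rev, L.act_comp]
    exact (LinearMap.dualMap_comp_dualMap _ _).symm
  contMDiff_act := by
    refine contMDiff_act_of_frames L.toLineBundle.dual (fun g => (L.act g.symm).dualMap)
      fun g => ?_
    obtain ⟨ξ, hξ, hξ₀⟩ := L.toLineBundle.dual.exists_frame (𝒢.src g)
    obtain ⟨τ, hτ, hτ₀⟩ := L.toLineBundle.exists_frame (𝒢.tgt g)
    refine ⟨ξ, hξ, hξ₀, ?_⟩
    have hs := 𝒢.src.contMDiff.contMDiffAt (x := g)
    have ht := 𝒢.tgt.contMDiff.contMDiffAt (x := g)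
    have hi := 𝒢.inv.contMDiff.contMDiffAt (x := g)
    refine contMDiffAt_dual (L := L.toLineBundle) (f := 𝒢.tgt) (σ := fun g => τ (𝒢.tgt g))
      (hτ.comp_of_eq ht rfl) hτ₀ ?_
    refine contMDiffAt_pairing (L := L.toLineBundle) (f := 𝒢.src)
      (σ := fun g => L.act (𝒢.arrow g).symm (τ (𝒢.tgt g))) (ξ := fun g => ξ (𝒢.src g)) ?_
      (hξ.comp_of_eq hs rfl)
    have e : (fun g => TotalSpace.mk' ℝ (𝒢.src g) (L.act (𝒢.arrow g).symm (τ (𝒢.tgt g)))) =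
        fun g => TotalSpace.mk' ℝ (𝒢.tgt (𝒢.inv g))
          (L.act (𝒢.arrow (𝒢.inv g)) (τ (𝒢.src (𝒢.inv g)))) :=
      funext fun g => L.mk_act_eq (𝒢.arrow g).symm τ
    rw [e]
    exact L.contMDiffAt_act hi (hτ.comp_of_eq (𝒢.src.contMDiff.contMDiffAt.comp g hi)
      (𝒢.src_inv g))

/-- An isomorphism of 1-dimensional representations: an equivariant isomorphism of smooth line
bundles. -/
structure Iso (L L' : LineRep.{u, v} 𝒢) where
  equiv : ∀ x, L.fib x ≃ₗ[ℝ] L'.fib x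
  equiv_act : ∀ {x y : M} (g : 𝒢.Arrow x y) (a : L.fib x),
    equiv y (L.act g a) = L'.act g (equiv x a)
  contMDiff_equiv : ContMDiff ((𝓡 n).prod 𝓘(ℝ, ℝ)) ((𝓡 n).prod 𝓘(ℝ, ℝ)) ∞
    (fun p : TotalSpace ℝ L.fib => TotalSpace.mk' ℝ p.1 (equiv p.1 p.2))
  contMDiff_symm : ContMDiff ((𝓡 n).prod 𝓘(ℝ, ℝ)) ((𝓡 n).prod 𝓘(ℝ, ℝ)) ∞
    (fun p : TotalSpace ℝ L'.fib => TotalSpace.mk' ℝ p.1 ((equiv p.1).symm p.2))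

theorem Iso.smoothAt {L L' : LineRep.{u, v} 𝒢} (F : Iso L L') {σ : ∀ x, L.fib x} {x : M}
    (hσ : L.SmoothAt σ x) : L'.SmoothAt (fun x => F.equiv x (σ x)) x :=
  ContMDiffAt.comp_of_eq F.contMDiff_equiv.contMDiffAt hσ rfl

/-- An equivariant isomorphism that near each point sends a smooth frame to a smooth section is an
isomorphism of representations. -/
def Iso.ofFrames {L L' : LineRep.{u, v} 𝒢} (equiv : ∀ x, L.fib x ≃ₗ[ℝ] L'.fib x)
    (equiv_act : ∀ {x y : M} (g : 𝒢.Arrow x y) (a : L.fib x),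
      equiv y (L.act g a) = L'.act g (equiv x a))
    (h : ∀ x, ∃ σ : ∀ x, L.fib x, L.SmoothAt σ x ∧ σ x ≠ 0 ∧
      L'.SmoothAt (fun x => equiv x (σ x)) x) : Iso L L' where
  equiv := equiv
  equiv_act := equiv_act
  contMDiff_equiv := contMDiff_of_frames (L := L.toLineBundle) (L' := L'.toLineBundle) (f := id)
    (fun x => (equiv x).toLinearMap) h
  contMDiff_symm := by
    refine contMDiff_of_frames (L := L'.toLineBundle) (L' := L.toLineBundle) (f := id)
      (fun x => (equiv x).symm.toLinearMap) fun x => ?_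
    obtain ⟨σ, h₁, h₂, h₃⟩ := h x
    refine ⟨fun x => equiv x (σ x), h₃, (equiv x).map_ne_zero_iff.2 h₂, ?_⟩
    have e : (fun x => TotalSpace.mk' ℝ (id x) ((equiv x).symm.toLinearMap (equiv x (σ x)))) =
        fun x => TotalSpace.mk' ℝ x (σ x) :=
      funext fun x => congrArg (TotalSpace.mk' ℝ x) ((equiv x).symm_apply_apply (σ x))
    exact e ▸ h₁

/-- Being isomorphic. -/
instance setoid (𝒢 : LieGroupoid n m M G) : Setoid (LineRep.{u, v} 𝒢) where
  r L L' := Nonempty (Iso L L')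
  iseqv :=
    { refl := fun L => ⟨⟨fun _ => .refl ℝ _, fun _ _ => rfl, contMDiff_id, contMDiff_id⟩⟩
      symm := by
        rintro L L' ⟨F⟩
        refine ⟨⟨fun x => (F.equiv x).symm, fun {x y} g a => ?_, F.contMDiff_symm,
          F.contMDiff_equiv⟩⟩
        rw [LinearEquiv.symm_apply_eq, F.equiv_act, LinearEquiv.apply_symm_apply]
      trans := by
        rintro L L' L'' ⟨F⟩ ⟨F'⟩
        refine ⟨⟨fun x => (F.equiv x).trans (F'.equiv x), fun {x y} g a => ?_,
          F'.contMDiff_equiv.comp F.contMDiff_equiv, F.contMDiff_symm.comp F'.contMDiff_symm⟩⟩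
        simp only [LinearEquiv.trans_apply, F.equiv_act, F'.equiv_act] }

/-- Tensor products of isomorphisms. -/
def Iso.tensor {L₁ L₁' L₂ L₂' : LineRep.{u, v} 𝒢} (F₁ : Iso L₁ L₁') (F₂ : Iso L₂ L₂') :
    Iso (L₁.tensor L₂) (L₁'.tensor L₂') :=
  .ofFrames (fun x => TensorProduct.congr (F₁.equiv x) (F₂.equiv x))
    (fun {x y} g => LinearMap.congr_fun (f :=
      (TensorProduct.congr (F₁.equiv y) (F₂.equiv y)).toLinearMap ∘ₗ
        TensorProduct.map (L₁.act g) (L₂.act g)) (g :=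
      TensorProduct.map (L₁'.act g) (L₂'.act g) ∘ₗ
        (TensorProduct.congr (F₁.equiv x) (F₂.equiv x)).toLinearMap)
      (TensorProduct.ext' fun a b =>
        congrArg₂ (fun a b => a ⊗ₜ[ℝ] b) (F₁.equiv_act g a) (F₂.equiv_act g b)))
    (fun x => by
      obtain ⟨σ, hσ, hσ₀⟩ := L₁.toLineBundle.exists_frame x
      obtain ⟨τ, hτ, hτ₀⟩ := L₂.toLineBundle.exists_frame x
      exact ⟨fun x => σ x ⊗ₜ τ x, contMDiffAt_tmul hσ hτ, tmul_ne_zero hσ₀ hτ₀,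
        contMDiffAt_tmul (F₁.smoothAt hσ) (F₂.smoothAt hτ)⟩)

theorem tensor_comm (L L' : LineRep.{u, v} 𝒢) : Nonempty (Iso (L.tensor L') (L'.tensor L)) :=
  ⟨.ofFrames (fun x => TensorProduct.comm ℝ (L.fib x) (L'.fib x))
    (fun {x y} g => LinearMap.congr_fun (f :=
      (TensorProduct.comm ℝ (L.fib y) (L'.fib y)).toLinearMap ∘ₗ
        TensorProduct.map (L.act g) (L'.act g)) (g :=
      TensorProduct.map (L'.act g) (L.act g) ∘ₗ
        (TensorProduct.comm ℝ (L.fib x) (L'.fib x)).toLinearMap)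
      (TensorProduct.ext' fun _ _ => rfl))
    (fun x => by
      obtain ⟨σ, hσ, hσ₀⟩ := L.toLineBundle.exists_frame x
      obtain ⟨τ, hτ, hτ₀⟩ := L'.toLineBundle.exists_frame x
      exact ⟨fun x => σ x ⊗ₜ τ x, contMDiffAt_tmul hσ hτ, tmul_ne_zero hσ₀ hτ₀,
        contMDiffAt_tmul hτ hσ⟩)⟩

theorem tensor_assoc (L₁ L₂ L₃ : LineRep.{u, v} 𝒢) :
    Nonempty (Iso ((L₁.tensor L₂).tensor L₃) (L₁.tensor (L₂.tensor L₃))) :=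
  ⟨.ofFrames (fun x => TensorProduct.assoc ℝ (L₁.fib x) (L₂.fib x) (L₃.fib x))
    (fun {x y} g => LinearMap.congr_fun (f :=
      (TensorProduct.assoc ℝ (L₁.fib y) (L₂.fib y) (L₃.fib y)).toLinearMap ∘ₗ
        TensorProduct.map (TensorProduct.map (L₁.act g) (L₂.act g)) (L₃.act g)) (g :=
      TensorProduct.map (L₁.act g) (TensorProduct.map (L₂.act g) (L₃.act g)) ∘ₗ
        (TensorProduct.assoc ℝ (L₁.fib x) (L₂.fib x) (L₃.fib x)).toLinearMap)
      (TensorProduct.ext_threefold fun _ _ _ => rfl))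
    (fun x => by
      obtain ⟨σ, hσ, hσ₀⟩ := L₁.toLineBundle.exists_frame x
      obtain ⟨τ, hτ, hτ₀⟩ := L₂.toLineBundle.exists_frame x
      obtain ⟨ρ, hρ, hρ₀⟩ := L₃.toLineBundle.exists_frame x
      exact ⟨fun x => (σ x ⊗ₜ τ x) ⊗ₜ ρ x,
        contMDiffAt_tmul (L := L₁.toLineBundle.tensor L₂.toLineBundle) (contMDiffAt_tmul hσ hτ) hρ,
        tmul_ne_zero (L := L₁.toLineBundle.tensor L₂.toLineBundle) (tmul_ne_zero hσ₀ hτ₀) hρ₀,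
        contMDiffAt_tmul (L' := L₂.toLineBundle.tensor L₃.toLineBundle) hσ
          (contMDiffAt_tmul hτ hρ)⟩)⟩

theorem trivial_tensor (L : LineRep.{u, v} 𝒢) : Nonempty (Iso ((trivial 𝒢).tensor L) L) :=
  ⟨.ofFrames (fun x => (TensorProduct.congr ULift.moduleEquiv (.refl ℝ (L.fib x))).trans
      (TensorProduct.lid ℝ (L.fib x)))
    (fun {x y} g => LinearMap.congr_fun (f :=
      ((TensorProduct.congr ULift.moduleEquiv (.refl ℝ (L.fib y))).trans
        (TensorProduct.lid ℝ (L.fib y))).toLinearMap ∘ₗ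
        TensorProduct.map LinearMap.id (L.act g)) (g := L.act g ∘ₗ
      ((TensorProduct.congr ULift.moduleEquiv (.refl ℝ (L.fib x))).trans
        (TensorProduct.lid ℝ (L.fib x))).toLinearMap)
      (TensorProduct.ext' fun a b => ((L.act g).map_smul a.down b).symm))
    (fun x => by
      obtain ⟨σ, hσ, hσ₀⟩ := L.toLineBundle.exists_frame x
      have h₁ : (LineBundle.trivial.{u, v} n M).SmoothAt (fun _ => (⟨1⟩ : ULift ℝ)) x :=
        contMDiffAt_trivial contMDiffAt_id contMDiffAt_const
      refine ⟨fun x => (⟨1⟩ : ULift ℝ) ⊗ₜ σ x, contMDiffAt_tmul h₁ hσ,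
        tmul_ne_zero (L := LineBundle.trivial.{u, v} n M)
          (fun h => one_ne_zero (congrArg ULift.down h)) hσ₀,
        contMDiffAt_smul hσ (contMDiffAt_const (c := (1 : ℝ)))⟩)⟩

/-- The evaluation map, for a 1-dimensional space with a nonzero functional. -/
def evalEquiv (L : LineBundle.{u, v} n M) (x : M) :
    (Module.Dual ℝ (L.fib x) ⊗[ℝ] L.fib x) ≃ₗ[ℝ] ULift.{v} ℝ :=
  (LinearEquiv.ofBijective (contractLeft ℝ (L.fib x)) (by
    have h₁ : contractLeft ℝ (L.fib x) (L.frameAtlas.coord x x ⊗ₜ L.frameAtlas.frame x x) = 1 :=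
      L.frameAtlas.coord_frame x x (L.mem_base x)
    refine ⟨(injective_iff_map_eq_zero _).2 fun a ha => ?_, fun c =>
      ⟨c • (L.frameAtlas.coord x x ⊗ₜ L.frameAtlas.frame x x), by
        rw [map_smul, h₁, smul_eq_mul, _root_.mul_one]⟩⟩
    have h₂ := (L.frameAtlas.dual.tensor L.frameAtlas).coord_smul_frame x x
      ⟨L.mem_base x, L.mem_base x⟩ a
    rw [← h₂] at ha ⊢
    rw [map_smul] at ha
    have h₃ := (congrArg _ h₁.symm).trans ha
    rw [smul_eq_mul, _root_.mul_one] at h₃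
    rw [h₃, zero_smul])).trans ULift.moduleEquiv.symm

theorem dual_tensor (L : LineRep.{u, v} 𝒢) : Nonempty (Iso (L.dual.tensor L) (trivial 𝒢)) :=
  ⟨.ofFrames (fun x => evalEquiv L.toLineBundle x)
    (fun {x y} g => LinearMap.congr_fun (f := (evalEquiv L.toLineBundle y).toLinearMap ∘ₗ
        TensorProduct.map (L.act g.symm).dualMap (L.act g)) (g :=
      (evalEquiv L.toLineBundle x).toLinearMap)
      (TensorProduct.ext' fun ξ b =>
        congrArg (fun b => (ULift.up (ξ b) : ULift.{v} ℝ)) (L.act_symm_act g b)))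
    (fun x => by
      obtain ⟨ξ, hξ, hξ₀⟩ := L.toLineBundle.dual.exists_frame x
      obtain ⟨τ, hτ, hτ₀⟩ := L.toLineBundle.exists_frame x
      exact ⟨fun x => ξ x ⊗ₜ τ x, contMDiffAt_tmul hξ hτ,
        tmul_ne_zero (L := L.toLineBundle.dual) hξ₀ hτ₀,
        contMDiffAt_trivial contMDiffAt_id (contMDiffAt_pairing hτ hξ)⟩)⟩

end LineRep

/-- The set of isomorphism classes of 1-dimensional representations of a Lie groupoid. -/
abbrev LieGroupoid.Rep1 {n m : ℕ} {M : Type u} {G : Type w}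
    [TopologicalSpace M] [ChartedSpace (EuclideanSpace ℝ (Fin n)) M]
    [TopologicalSpace G] [ChartedSpace (EuclideanSpace ℝ (Fin m)) G] (𝒢 : LieGroupoid n m M G) :=
  Quotient (LineRep.setoid.{u, v, w} 𝒢)

namespace LineRep

open LineBundle LieGroupoid

variable {n m : ℕ} {M : Type u} {G : Type w}
  [TopologicalSpace M] [ChartedSpace (EuclideanSpace ℝ (Fin n)) M]
  [TopologicalSpace G] [ChartedSpace (EuclideanSpace ℝ (Fin m)) G] {𝒢 : LieGroupoid n m M G}
  {n' m' : ℕ} {M' : Type u'} {G' : Type w'}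
  [TopologicalSpace M'] [ChartedSpace (EuclideanSpace ℝ (Fin n')) M']
  [TopologicalSpace G'] [ChartedSpace (EuclideanSpace ℝ (Fin m')) G']
  {𝒢' : LieGroupoid n' m' M' G'}

/-- The product of isomorphism classes of 1-dimensional representations is the tensor product, the
unit is the trivial representation. -/
instance : CommMonoid (LieGroupoid.Rep1.{u, v, w} 𝒢) where
  mul := Quotient.map₂ tensor fun _ _ ⟨F⟩ _ _ ⟨F'⟩ => ⟨F.tensor F'⟩
  one := ⟦trivial 𝒢⟧
  mul_assoc := by
    rintro ⟨L₁⟩ ⟨L₂⟩ ⟨L₃⟩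
    exact Quotient.sound (tensor_assoc L₁ L₂ L₃)
  mul_comm := by
    rintro ⟨L₁⟩ ⟨L₂⟩
    exact Quotient.sound (tensor_comm L₁ L₂)
  one_mul := by
    rintro ⟨L⟩
    exact Quotient.sound (trivial_tensor L)
  mul_one := by
    rintro ⟨L⟩
    exact Quotient.sound (Setoid.trans (tensor_comm L (trivial 𝒢)) (trivial_tensor L))

theorem mk_dual_mul (L : LineRep.{u, v} 𝒢) :
    (⟦L.dual⟧ * ⟦L⟧ : LieGroupoid.Rep1.{u, v, w} 𝒢) = 1 := Quotient.sound (dual_tensor L)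

/-- The group of isomorphism classes of 1-dimensional representations; the inverse is given by the
dual. -/
instance : CommGroup (LieGroupoid.Rep1.{u, v, w} 𝒢) where
  inv := Quotient.map dual fun L L' h => by
    have e : (⟦L⟧ : LieGroupoid.Rep1.{u, v, w} 𝒢) = ⟦L'⟧ := Quotient.sound h
    refine Quotient.exact (?_ : (⟦L.dual⟧ : LieGroupoid.Rep1.{u, v, w} 𝒢) = ⟦L'.dual⟧)
    refine left_inv_eq_right_inv (mk_dual_mul L) ?_
    rw [mul_comm, e, mk_dual_mul]
  inv_mul_cancel := by
    rintro ⟨L⟩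
    exact mk_dual_mul L

theorem mk_tensor (L L' : LineRep.{u, v} 𝒢) :
    (⟦L.tensor L'⟧ : LieGroupoid.Rep1.{u, v, w} 𝒢) = ⟦L⟧ * ⟦L'⟧ := rfl

theorem _root_.LieGroupoid.Hom.map_unit (Φ : 𝒢'.Hom 𝒢) (x : M') :
    Φ.map (𝒢'.unit x) = 𝒢.unit (Φ.base x) := Subtype.ext (Φ.arr_one x)

theorem _root_.LieGroupoid.Hom.map_comp (Φ : 𝒢'.Hom 𝒢) {x y z : M'} (g : 𝒢'.Arrow y z)
    (h : 𝒢'.Arrow x y) : Φ.map (g.comp h) = (Φ.map g).comp (Φ.map h) :=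
  Subtype.ext (Φ.arr_mul _ _ (g.2.1.trans h.2.2.symm))

/-- The pull-back of a 1-dimensional representation along a morphism of Lie groupoids. -/
def pull (Φ : 𝒢'.Hom 𝒢) (L : LineRep.{u, v} 𝒢) : LineRep.{u', v} 𝒢' where
  toLineBundle := L.toLineBundle.pull Φ.base
  act g := L.act (Φ.map g)
  act_unit x := by
    rw [Φ.map_unit]
    exact L.act_unit (Φ.base x)
  act_comp g h := by
    rw [Φ.map_comp]
    exact L.act_comp (Φ.map g) (Φ.map h)
  contMDiff_act := by
    refine contMDiff_act_of_frames (L.toLineBundle.pull Φ.base) (fun g => L.act (Φ.map g))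
      fun g => ?_
    obtain ⟨τ, hτ, hτ₀⟩ := L.toLineBundle.exists_frame (Φ.base (𝒢'.src g))
    have hb := Φ.base.contMDiff.contMDiffAt (x := 𝒢'.src g)
    refine ⟨fun x => τ (Φ.base x), contMDiffAt_pull_iff.2
      ⟨contMDiffAt_id, hτ.comp_of_eq hb rfl⟩, hτ₀,
      contMDiffAt_pull_iff.2 ⟨𝒢'.tgt.contMDiff.contMDiffAt, ?_⟩⟩
    have e : (fun g => TotalSpace.mk' ℝ (Φ.base (𝒢'.tgt g))
        (L.act (Φ.map (𝒢'.arrow g)) (τ (Φ.base (𝒢'.src g))))) =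
        fun g => TotalSpace.mk' ℝ (𝒢.tgt (Φ.arr g))
          (L.act (𝒢.arrow (Φ.arr g)) (τ (𝒢.src (Φ.arr g)))) :=
      funext fun g => L.mk_act_eq (Φ.map (𝒢'.arrow g)) τ
    have ha := Φ.arr.contMDiff.contMDiffAt (x := g)
    refine ContMDiffAt.congr_of_eventuallyEq ?_ (Filter.EventuallyEq.of_eq e)
    exact L.contMDiffAt_act ha (hτ.comp_of_eq (𝒢.src.contMDiff.contMDiffAt.comp g ha)
      (Φ.src_arr g))

/-- A nowhere vanishing smooth section of the underlying line bundle. -/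
structure Frame (L : LineRep.{u, v} 𝒢) where
  sec : ∀ x, L.fib x
  smooth : ContMDiff (𝓡 n) ((𝓡 n).prod 𝓘(ℝ, ℝ)) ∞ (fun x => TotalSpace.mk' ℝ x (sec x))
  ne_zero : ∀ x, sec x ≠ 0

variable {L : LineRep.{u, v} 𝒢} (σ : L.Frame)

theorem Frame.exists_unit (g : G) :
    ∃ a : ℝˣ, L.act (𝒢.arrow g) (σ.sec (𝒢.src g)) = (a : ℝ) • σ.sec (𝒢.tgt g) := by
  obtain ⟨a, ha⟩ := L.toLineBundle.exists_smul_eq (σ.ne_zero (𝒢.tgt g))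
    (L.act (𝒢.arrow g) (σ.sec (𝒢.src g)))
  have h₀ : a ≠ 0 := by
    rintro rfl
    rw [zero_smul] at ha
    exact L.act_ne_zero (𝒢.arrow g) (σ.ne_zero _) ha
  exact ⟨Units.mk0 a h₀, ha⟩

/-- The function `c` on the arrows with `g · σ(src g) = c(g) σ(tgt g)`, for a nowhere vanishing
section `σ`. -/
def Frame.coeff (g : G) : ℝˣ := (σ.exists_unit g).choose

theorem Frame.act_sec {x y : M} (g : 𝒢.Arrow x y) :
    L.act g (σ.sec x) = (σ.coeff g.1 : ℝ) • σ.sec y := by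
  obtain ⟨g, rfl, rfl⟩ := g
  exact (σ.exists_unit g).choose_spec

theorem Frame.contMDiff_coeff : ContMDiff (𝓡 m) 𝓘(ℝ, ℝ) ∞ σ.coeff := by
  refine ContMDiff.of_comp_isOpenEmbedding Units.isOpenEmbedding_val fun g => ?_
  refine contMDiffAt_coeff (L := L.toLineBundle) (f := 𝒢.tgt)
    (σ := fun g => σ.sec (𝒢.tgt g)) (τ := fun g => L.act (𝒢.arrow g) (σ.sec (𝒢.src g))) ?_ ?_
    (σ.ne_zero _) (Filter.Eventually.of_forall fun g => σ.act_sec (𝒢.arrow g))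
  · exact σ.smooth.contMDiffAt.comp_of_eq 𝒢.tgt.contMDiff.contMDiffAt rfl
  · exact L.contMDiffAt_act contMDiffAt_id
      (σ.smooth.contMDiffAt.comp_of_eq 𝒢.src.contMDiff.contMDiffAt rfl)

/-- The differentiable cocycle `c` with values in `ℝ^*` of a representation with a nowhere vanishing
section `σ`, defined by `g · σ(src g) = c(g) σ(tgt g)`. -/
def Frame.cocycle : 𝒢.Z1 𝓘(ℝ, ℝ) ℝˣ :=
  ⟨σ.coeff, σ.contMDiff_coeff, fun g h hgh => by
    let g' : 𝒢.Arrow (𝒢.src g) (𝒢.tgt g) := 𝒢.arrow g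
    let h' : 𝒢.Arrow (𝒢.src h) (𝒢.src g) := ⟨h, rfl, hgh.symm⟩
    have e := σ.act_sec (g'.comp h')
    rw [L.act_comp, LinearMap.comp_apply, σ.act_sec h', map_smul, σ.act_sec g', smul_smul] at e
    have e' := smul_left_injective ℝ (σ.ne_zero (𝒢.tgt g)) e
    refine Units.ext (e'.symm.trans ?_)
    exact mul_comm _ _⟩

/-- The class in `H^1(𝒢, ℝ^*)` of a representation with a nowhere vanishing section. -/
def Frame.extClass : 𝒢.H1 𝓘(ℝ, ℝ) ℝˣ := QuotientGroup.mk σ.cocycle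

end LineRep

end

/-! Over the units of `M`, the pull-back groupoid of a cover `𝒰` has for each `x ∈ U ∩ V` a unit
arrow from the copy of `x` in `U` to its copy in `V` (`coverUnit`). On these arrows a cocycle
restricts to ordinary Čech data `c_UV`, and every arrow of the pull-back can be moved to other
copies of its source and target by composing with them. The proof plays this Čech part against the
part coming from `G`.

Real coefficients: the data satisfy `c_UW = c_VW + c_UV`. With a partition of unity `ρ`, the average
`f_U = ∑ ρ_W c_UW` satisfies `f_U - f_V = c_UV`, so `c` minus the coboundary of `f` no longer
depends on the copies and descends to `G`. Conversely, if a cocycle pulled back from `G` is the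
coboundary of `f`, then `f_U - f_V` is its value at a unit, which is `0`, and `f` descends. Hence
`pullRealH1_coverMap_bijective`.

Splitting: `λ ↦ (ln |λ|, sign λ)` has the smooth inverse `(r, e) ↦ exp r · e`, so the cohomology
with coefficients in `ℝ^*` splits over each cover. In the colimit the real factor is constant by the
previous point, which gives `cechLogSign_bijective`.

Representations: two frames over a cover differ by a function `f`, and their cocycles by its
coboundary. Together with common refinements this makes the Čech class well defined
(`Frame.of_extClass_eq`). If the class is trivial, rescaling a frame over a fine enough cover makes
its cocycle `1`. Its values on different copies of a point then agree, so it descends to an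
invariant frame of `L`. Conversely, a cocycle over a cover glues copies of `ℝ` to a representation
(`glued`). Hence `rep1ToCech_bijective`.

For `L ⊗ L` the cocycle is `c² = exp (2 ln |c|)`. Writing `ln |c|` as a pull-back from `G` plus the
coboundary of `f`, rescaling by `exp (-2f)` kills the Čech part, so the frame descends. The real
class `θ` is taken to be the first component of the splitting applied to the Čech class. The formula
with the factor `1/2` then only expresses that these maps are homomorphisms. -/

noncomputable section

/-! ### Extending and descending smooth functions on disjoint unions of open sets -/

namespace DisjUnion

variable {X : Type*} [TopologicalSpace X] {ι : Type*} {O : ι → Opens X}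
  {H : Type*} [TopologicalSpace H] {E : Type*} [NormedAddCommGroup E] [NormedSpace ℝ E]
  {I : ModelWithCorners ℝ E H} [ChartedSpace H X]
  {Y : Type*} [TopologicalSpace Y] {H' : Type*} [TopologicalSpace H'] [ChartedSpace H' Y]
  {E' : Type*} [NormedAddCommGroup E'] [NormedSpace ℝ E'] {I' : ModelWithCorners ℝ E' H'}

theorem contMDiffAt_iff {f : Y → DisjUnion O} {y : Y} :
    ContMDiffAt I' I ∞ f y ↔
      ContMDiffAt I' I ∞ (val ∘ f) y ∧ ∀ᶠ y' in 𝓝 y, (f y').idx = (f y).idx := by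
  rw [← contMDiffWithinAt_univ, ← contMDiffWithinAt_univ, contMDiffWithinAt_iff, nhdsWithin_univ]

open Classical in
/-- The restriction of a function to a summand, extended by a constant to the ambient space. -/
def extend {Z : Type*} (φ : DisjUnion O → Z) (y₀ : Z) (i : ι) (x : X) : Z :=
  if h : x ∈ O i then φ (mk i x h) else y₀

theorem extend_of_mem {Z : Type*} (φ : DisjUnion O → Z) (y₀ : Z) {i : ι} {x : X} (h : x ∈ O i) :
    extend φ y₀ i x = φ (mk i x h) := dif_pos h

/-- On `O i` the extension is the composite of `φ` with a smooth local section of `val`. The default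
value `y₀` plays no role near points of `O i`. -/
theorem contMDiffAt_extend {φ : DisjUnion O → Y} (hφ : ContMDiff I I' ∞ φ) (y₀ : Y) {i : ι} {x : X}
    (h : x ∈ O i) : ContMDiffAt I I' ∞ (extend φ y₀ i) x := by
  classical
  -- The default point `mk i x h` keeps the index equal to `i` everywhere, so the index condition of
  -- `contMDiffAt_iff` holds without restriction.
  let s : X → DisjUnion O := fun z => if hz : z ∈ O i then mk i z hz else mk i x h
  have hmem : ∀ᶠ z in 𝓝 x, z ∈ O i := (O i).isOpen.mem_nhds h
  have hs : ContMDiffAt I I ∞ s x := by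
    refine contMDiffAt_iff.2 ⟨contMDiffAt_id.congr_of_eventuallyEq ?_, .of_forall fun z => ?_⟩
    · filter_upwards [hmem] with z hz
      simp [s, dif_pos hz]
    · have : ∀ z, (s z).idx = i := fun z => by
        by_cases hz : z ∈ O i
        · simp [s, dif_pos hz]
        · simp [s, dif_neg hz]
      rw [this, this]
  refine (hφ.contMDiffAt.comp x hs).congr_of_eventuallyEq ?_
  filter_upwards [hmem] with z hz
  simp [s, extend, dif_pos hz]

/-- A smooth function on the disjoint union of the members of an open cover descends to the
ambient space if its values on different copies of a point agree. -/
theorem exists_descend {φ : DisjUnion O → Y} (hφ : ContMDiff I I' ∞ φ)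
    (hO : ∀ x, ∃ i, x ∈ O i) (h : ∀ p q, p.val = q.val → φ p = φ q) :
    ∃ ψ : X → Y, ContMDiff I I' ∞ ψ ∧ ∀ p, ψ p.val = φ p := by
  choose k hk using hO
  refine ⟨fun x => φ (mk (k x) x (hk x)), fun x => ?_, fun p => h _ _ rfl⟩
  -- The choice `k` need not be locally constant. Near `x` the single member `O (k x)` serves for
  -- all points, since `h` allows changing the copy.
  refine (contMDiffAt_extend hφ (φ (mk (k x) x (hk x))) (hk x)).congr_of_eventuallyEq ?_
  filter_upwards [(O (k x)).isOpen.mem_nhds (hk x)] with z hz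
  rw [extend_of_mem _ _ hz]
  exact h _ _ rfl

end DisjUnion

namespace OpenCover

variable {M : Type u} [TopologicalSpace M] (𝒰 : OpenCover M)

theorem exists_mem (x : M) : ∃ U : 𝒰.carrier, x ∈ U.1 := by
  obtain ⟨U, hU, hx⟩ := 𝒰.covers x
  exact ⟨⟨U, hU⟩, hx⟩

/-- A member of the cover containing a given point. -/
def memberAt (x : M) : 𝒰.carrier := (𝒰.exists_mem x).choose

theorem mem_memberAt (x : M) : x ∈ (𝒰.memberAt x).1 := (𝒰.exists_mem x).choose_spec

end OpenCover

/-! ### Arrows of the pull-back groupoid between chosen members of a cover -/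

namespace LieGroupoid

variable {n m : ℕ} {M : Type u} {G : Type w}
  [TopologicalSpace M] [ChartedSpace (EuclideanSpace ℝ (Fin n)) M]
  [TopologicalSpace G] [ChartedSpace (EuclideanSpace ℝ (Fin m)) G]
  (𝒢 : LieGroupoid n m M G) {𝒰 : OpenCover M}

/-- The arrow `g`, as an arrow from the copy of its source in `U` to the copy of its target
in `V`. -/
def coverArrow (U V : 𝒰.carrier) (g : G) (hU : 𝒢.src g ∈ U.1) (hV : 𝒢.tgt g ∈ V.1) :
    𝒢.CoverArrows 𝒰 := .mk (U, V) g ⟨hU, hV⟩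

/-- The unit at `x`, as an arrow from the copy of `x` in `U` to the copy of `x` in `V`. -/
def coverUnit (U V : 𝒰.carrier) (x : M) (hU : x ∈ U.1) (hV : x ∈ V.1) : 𝒢.CoverArrows 𝒰 :=
  𝒢.coverArrow U V (𝒢.one x) (by rwa [𝒢.src_one]) (by rwa [𝒢.tgt_one])

theorem exists_mem_arrowOpens (𝒰 : OpenCover M) (g : G) :
    ∃ UV : 𝒰.carrier × 𝒰.carrier, g ∈ 𝒢.arrowOpens UV.1.1 UV.2.1 :=
  ⟨(𝒰.memberAt (𝒢.src g), 𝒰.memberAt (𝒢.tgt g)), 𝒰.mem_memberAt _, 𝒰.mem_memberAt _⟩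

theorem one_mul_one (x : M) : 𝒢.mul (𝒢.one x) (𝒢.one x) = 𝒢.one x := by
  have := 𝒢.mul_one (𝒢.one x)
  rwa [𝒢.src_one] at this

variable {𝒢} in
theorem realZ1_one {c : G → ℝ} (hc : c ∈ 𝒢.RealZ1) (x : M) : c (𝒢.one x) = 0 := by
  have h := hc.2 (𝒢.one x) (𝒢.one x) (by rw [𝒢.src_one, 𝒢.tgt_one])
  rw [𝒢.one_mul_one] at h
  linarith

/-- A function on arrows of the pull-back to an open cover, along the units from copies of points
in `U` to copies in `V`. -/
theorem contMDiffAt_extend_one {EA : Type*} [NormedAddCommGroup EA] [NormedSpace ℝ EA]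
    {HA : Type*} [TopologicalSpace HA] {IA : ModelWithCorners ℝ EA HA} {A : Type*}
    [TopologicalSpace A] [ChartedSpace HA A] {c : 𝒢.CoverArrows 𝒰 → A}
    (hc : ContMDiff (𝓡 m) IA ∞ c) (a : A) (U V : 𝒰.carrier) {x : M} (hU : x ∈ U.1)
    (hV : x ∈ V.1) :
    ContMDiffAt (𝓡 n) IA ∞ (fun x => DisjUnion.extend c a (U, V) (𝒢.one x)) x :=
  (DisjUnion.contMDiffAt_extend hc a (i := (U, V)) (x := 𝒢.one x)
    ⟨by rwa [𝒢.src_one], by rwa [𝒢.tgt_one]⟩).comp x 𝒢.one.contMDiff.contMDiffAt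

theorem extend_one {A : Type*} (c : 𝒢.CoverArrows 𝒰 → A) (a : A)
    (U V : 𝒰.carrier) {x : M} (hU : x ∈ U.1) (hV : x ∈ V.1) :
    DisjUnion.extend c a (U, V) (𝒢.one x) = c (𝒢.coverUnit U V x hU hV) :=
  DisjUnion.extend_of_mem _ _ _

variable [IsManifold (𝓡 n) ∞ M] [IsManifold (𝓡 m) ∞ G]

theorem src_cover_coverArrow {U V : 𝒰.carrier} {g : G} (hU : 𝒢.src g ∈ U.1)
    (hV : 𝒢.tgt g ∈ V.1) :
    (𝒢.cover 𝒰).src (𝒢.coverArrow U V g hU hV) = .mk U (𝒢.src g) hU := rfl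

theorem tgt_cover_coverArrow {U V : 𝒰.carrier} {g : G} (hU : 𝒢.src g ∈ U.1)
    (hV : 𝒢.tgt g ∈ V.1) :
    (𝒢.cover 𝒰).tgt (𝒢.coverArrow U V g hU hV) = .mk V (𝒢.tgt g) hV := rfl

theorem src_cover_coverUnit {U V : 𝒰.carrier} {x : M} (hU : x ∈ U.1) (hV : x ∈ V.1) :
    (𝒢.cover 𝒰).src (𝒢.coverUnit U V x hU hV) = .mk U x hU := DisjUnion.ext' rfl (𝒢.src_one x)

theorem tgt_cover_coverUnit {U V : 𝒰.carrier} {x : M} (hU : x ∈ U.1) (hV : x ∈ V.1) :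
    (𝒢.cover 𝒰).tgt (𝒢.coverUnit U V x hU hV) = .mk V x hV := DisjUnion.ext' rfl (𝒢.tgt_one x)

theorem coverArrow_mul {U V W : 𝒰.carrier} {g h : G} (e : 𝒢.src g = 𝒢.tgt h)
    (hV : 𝒢.src g ∈ V.1) (hW : 𝒢.tgt g ∈ W.1) (hU : 𝒢.src h ∈ U.1) (hV' : 𝒢.tgt h ∈ V.1) :
    (𝒢.cover 𝒰).mul (𝒢.coverArrow V W g hV hW) (𝒢.coverArrow U V h hU hV') =
      𝒢.coverArrow U W (𝒢.mul g h) (by rwa [𝒢.src_mul _ _ e]) (by rwa [𝒢.tgt_mul _ _ e]) :=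
  DisjUnion.ext' (𝒢.idx_coverMul (a := 𝒢.coverArrow V W g hV hW)
    (b := 𝒢.coverArrow U V h hU hV') e) (𝒢.val_coverMul (a := 𝒢.coverArrow V W g hV hW)
    (b := 𝒢.coverArrow U V h hU hV') e)

/-- With the next two results, this lets units between copies move the source or the target of an
arrow to another member of the cover. All comparisons between copies below rest on it. -/
theorem coverUnit_mul_coverArrow {U V W : 𝒰.carrier} {g : G} (hU : 𝒢.src g ∈ U.1)
    (hV : 𝒢.tgt g ∈ V.1) (hW : 𝒢.tgt g ∈ W.1) :
    (𝒢.cover 𝒰).mul (𝒢.coverUnit V W (𝒢.tgt g) hV hW) (𝒢.coverArrow U V g hU hV) =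
      𝒢.coverArrow U W g hU hW :=
  (𝒢.coverArrow_mul (𝒢.src_one _) _ _ _ _).trans (DisjUnion.ext' rfl (𝒢.one_mul g))

theorem coverArrow_mul_coverUnit {U V W : 𝒰.carrier} {g : G} (hU : 𝒢.src g ∈ U.1)
    (hV : 𝒢.src g ∈ V.1) (hW : 𝒢.tgt g ∈ W.1) :
    (𝒢.cover 𝒰).mul (𝒢.coverArrow V W g hV hW) (𝒢.coverUnit U V (𝒢.src g) hU hV) =
      𝒢.coverArrow U W g hU hW :=
  (𝒢.coverArrow_mul (𝒢.tgt_one _).symm _ _ _ _).trans (DisjUnion.ext' rfl (𝒢.mul_one g))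

theorem coverUnit_mul_coverUnit {U V W : 𝒰.carrier} {x : M} (hU : x ∈ U.1) (hV : x ∈ V.1)
    (hW : x ∈ W.1) :
    (𝒢.cover 𝒰).mul (𝒢.coverUnit V W x hV hW) (𝒢.coverUnit U V x hU hV) =
      𝒢.coverUnit U W x hU hW := by
  have e : 𝒢.src (𝒢.one x) = 𝒢.tgt (𝒢.one x) := by rw [𝒢.src_one, 𝒢.tgt_one]
  exact (𝒢.coverArrow_mul e _ _ _ _).trans (DisjUnion.ext' rfl (𝒢.one_mul_one x))

/-! ### Real cohomology is unchanged by passing to an open cover -/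

section RealCocycles

variable {𝒢}

/-- A real cocycle over an open cover that only depends on the underlying arrow is a pull-back. -/
theorem exists_realZ1_of_val {c : 𝒢.CoverArrows 𝒰 → ℝ} (hc : c ∈ (𝒢.cover 𝒰).RealZ1)
    (h : ∀ a b, a.val = b.val → c a = c b) :
    ∃ d ∈ 𝒢.RealZ1, ∀ a : 𝒢.CoverArrows 𝒰, d a.val = c a := by
  obtain ⟨d, hd, hdc⟩ := DisjUnion.exists_descend hc.1 (𝒢.exists_mem_arrowOpens 𝒰) h
  refine ⟨d, ⟨hd, fun g h e => ?_⟩, hdc⟩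
  -- The two arrows are lifted through the same copy of the middle point `src g = tgt h`, so that
  -- the lifts remain composable.
  have hm := 𝒰.mem_memberAt (𝒢.src g)
  have hm' : 𝒢.tgt h ∈ (𝒰.memberAt (𝒢.src g)).1 :=
    Eq.subst (motive := fun x => x ∈ (𝒰.memberAt (𝒢.src g)).1) e hm
  have := hc.2 (𝒢.coverArrow (𝒰.memberAt (𝒢.src g)) (𝒰.memberAt (𝒢.tgt g)) g hm (𝒰.mem_memberAt _))
    (𝒢.coverArrow (𝒰.memberAt (𝒢.src h)) (𝒰.memberAt (𝒢.src g)) h (𝒰.mem_memberAt _) hm')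
    (DisjUnion.ext' rfl e)
  rw [𝒢.coverArrow_mul e, ← hdc, ← hdc, ← hdc] at this
  exact this

/-- This is the additive Čech cocycle identity for the functions `c_UV` on overlaps, obtained by
passing from `U` to `W` through `V`. -/
theorem realZ1_coverUnit_self {c : 𝒢.CoverArrows 𝒰 → ℝ} (hc : c ∈ (𝒢.cover 𝒰).RealZ1)
    {U V W : 𝒰.carrier} {x : M} (hU : x ∈ U.1) (hV : x ∈ V.1) (hW : x ∈ W.1) :
    c (𝒢.coverUnit U W x hU hW) = c (𝒢.coverUnit V W x hV hW) + c (𝒢.coverUnit U V x hU hV) := by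
  rw [← hc.2 _ _ ((𝒢.src_cover_coverUnit hV hW).trans (𝒢.tgt_cover_coverUnit hU hV).symm),
    𝒢.coverUnit_mul_coverUnit]

/-- The average of a real cocycle over an open cover with respect to a partition of unity. -/
theorem exists_average [T2Space M] [SecondCountableTopology M] {c : 𝒢.CoverArrows 𝒰 → ℝ}
    (hc : c ∈ (𝒢.cover 𝒰).RealZ1) :
    ∃ f : 𝒰.Space → ℝ, ContMDiff (𝓡 n) 𝓘(ℝ, ℝ) ∞ f ∧
      ∀ (U V : 𝒰.carrier) (x : M) (hU : x ∈ U.1) (hV : x ∈ V.1),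
        f (.mk U x hU) = f (.mk V x hV) + c (𝒢.coverUnit U V x hU hV) := by
  have : LocallyCompactSpace M := ChartedSpace.locallyCompactSpace (EuclideanSpace ℝ (Fin n)) M
  obtain ⟨ρ, hρ⟩ := SmoothPartitionOfUnity.exists_isSubordinate (𝓡 n) (s := (univ : Set M))
    isClosed_univ (fun U : 𝒰.carrier => (U.1 : Set M)) (fun U => U.1.isOpen)
    (fun x _ => mem_iUnion.2 (𝒰.exists_mem x))
  have hρ₀ : ∀ V x, x ∉ V.1 → ρ V x = 0 := fun V x hx => by
    by_contra h
    exact hx (hρ V (subset_tsupport _ h))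
  have hfin : ∀ x (a : 𝒰.carrier → ℝ), (Function.support fun V => ρ V x * a V).Finite :=
    fun x a => (ρ.locallyFinite.point_finite x).subset fun V hV => left_ne_zero_of_mul hV
  -- In Čech notation `f_U = ∑ ρ_V c_UV`. The default `0` of `extend` is harmless, as it is used
  -- only where `ρ_V` vanishes.
  refine ⟨fun p => ∑ᶠ V, ρ V p.val * DisjUnion.extend c 0 (p.idx, V) (𝒢.one p.val), ?_, ?_⟩
  · refine contMDiff_finsum (fun V p => ?_) ?_
    -- Inside the closed support, which lies in `V`, the extended cocycle is smooth. Outside it, the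
    -- product is `0` on a neighbourhood.
    · by_cases hp : p.val ∈ tsupport (ρ V)
      · have h₁ := 𝒢.contMDiffAt_extend_one hc.1 0 p.idx V p.val_mem (hρ V hp)
        have h₂ := ((ρ V).contMDiff.contMDiffAt.mul h₁).comp p DisjUnion.contMDiff_val.contMDiffAt
        refine h₂.congr_of_eventuallyEq ?_
        filter_upwards [DisjUnion.eventually_idx p] with q hq
        rw [hq]
        rfl
      · refine (contMDiffAt_const (c := (0 : ℝ))).congr_of_eventuallyEq ?_
        have := DisjUnion.continuous_val.continuousAt.eventually
          ((isClosed_tsupport (ρ V)).isOpen_compl.mem_nhds hp)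
        filter_upwards [this] with q hq
        rw [image_eq_zero_of_notMem_tsupport hq, zero_mul]
    · refine (ρ.locallyFinite.preimage_continuous DisjUnion.continuous_val).subset
        fun V p hp => ?_
      exact left_ne_zero_of_mul hp
  · intro U V x hU hV
    -- Since the weights sum to `1`, the constant `c_UV` can be written as a sum over `W`. The claim
    -- becomes termwise `ρ_W c_UW = ρ_W c_VW + ρ_W c_UV`.
    have hs : ∑ᶠ W, ρ W x * c (𝒢.coverUnit U V x hU hV) = c (𝒢.coverUnit U V x hU hV) := by
      rw [← finsum_mul' _ _ (ρ.locallyFinite.point_finite x), ρ.sum_eq_one (mem_univ x),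
        _root_.one_mul]
    conv_rhs => rw [← hs]
    refine Eq.trans (finsum_congr fun W => ?_) (finsum_add_distrib (hfin _ _) (hfin _ _))
    change ρ W x * DisjUnion.extend c 0 (U, W) (𝒢.one x) =
      ρ W x * DisjUnion.extend c 0 (V, W) (𝒢.one x) + _
    by_cases hW : x ∈ W.1
    · rw [𝒢.extend_one c 0 U W hU hW, 𝒢.extend_one c 0 V W hV hW,
        realZ1_coverUnit_self hc hU hV hW, mul_add]
    · simp [hρ₀ W x hW]

/-- Every real cocycle over an open cover is cohomologous to a pull-back. -/
theorem exists_realZ1_pull [T2Space M] [SecondCountableTopology M] {c : 𝒢.CoverArrows 𝒰 → ℝ}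
    (hc : c ∈ (𝒢.cover 𝒰).RealZ1) :
    ∃ d ∈ 𝒢.RealZ1, ∃ f : 𝒰.Space → ℝ, ContMDiff (𝓡 n) 𝓘(ℝ, ℝ) ∞ f ∧
      ∀ a : 𝒢.CoverArrows 𝒰,
        c a = d a.val + (f ((𝒢.cover 𝒰).src a) - f ((𝒢.cover 𝒰).tgt a)) := by
  obtain ⟨f, hf, hfc⟩ := exists_average hc
  let b : 𝒢.CoverArrows 𝒰 → ℝ := fun a => f ((𝒢.cover 𝒰).src a) - f ((𝒢.cover 𝒰).tgt a)
  have hb : b ∈ (𝒢.cover 𝒰).RealZ1 := by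
    refine ⟨(hf.comp (𝒢.cover 𝒰).src.contMDiff).sub (hf.comp (𝒢.cover 𝒰).tgt.contMDiff),
      fun g h e => ?_⟩
    simp only [b, (𝒢.cover 𝒰).src_mul g h e, (𝒢.cover 𝒰).tgt_mul g h e, e]
    ring
  -- The arrow `g` from `U` to `V'` factors both through `V` and through `U'`. Comparing the two
  -- values of `c` leaves the terms `c_VV'` and `c_UU'`, which are exactly what `b` accounts for.
  have key : ∀ (U V U' V' : 𝒰.carrier) (g : G) (hU : 𝒢.src g ∈ U.1) (hV : 𝒢.tgt g ∈ V.1)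
      (hU' : 𝒢.src g ∈ U'.1) (hV' : 𝒢.tgt g ∈ V'.1),
      (c - b) (𝒢.coverArrow U V g hU hV) = (c - b) (𝒢.coverArrow U' V' g hU' hV') := by
    intro U V U' V' g hU hV hU' hV'
    have h₁ := hc.2 (𝒢.coverUnit V V' (𝒢.tgt g) hV hV') (𝒢.coverArrow U V g hU hV)
      (𝒢.src_cover_coverUnit hV hV')
    have h₂ := hc.2 (𝒢.coverArrow U' V' g hU' hV') (𝒢.coverUnit U U' (𝒢.src g) hU hU')
      (𝒢.tgt_cover_coverUnit hU hU').symm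
    rw [𝒢.coverUnit_mul_coverArrow] at h₁
    rw [𝒢.coverArrow_mul_coverUnit] at h₂
    have h₃ := hfc U U' _ hU hU'
    have h₄ := hfc V V' _ hV hV'
    simp only [Pi.sub_apply, b, src_cover_coverArrow, tgt_cover_coverArrow]
    linarith
  obtain ⟨d, hd, hdc⟩ := exists_realZ1_of_val (Submodule.sub_mem _ hc hb) (by
    intro a a' e
    have e' : a' = 𝒢.coverArrow a'.idx.1 a'.idx.2 a.val (e ▸ a'.val_mem.1) (e ▸ a'.val_mem.2) :=
      DisjUnion.ext' rfl e.symm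
    rw [e']
    exact key a.idx.1 a.idx.2 _ _ a.val a.val_mem.1 a.val_mem.2 _ _)
  refine ⟨d, hd, f, hf, fun a => ?_⟩
  rw [hdc a]
  simp [b]

/-- Surjectivity is the averaging argument. Injectivity needs no partition of unity, because a
primitive of a pulled-back cocycle descends by itself. -/
theorem pullRealH1_coverMap_bijective [T2Space M] [SecondCountableTopology M]
    (𝒢 : LieGroupoid n m M G) (𝒰 : OpenCover M) : Function.Bijective (𝒢.coverMap 𝒰).pullRealH1 := by
  constructor
  · refine (injective_iff_map_eq_zero _).2 fun x hx => ?_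
    induction x using Submodule.Quotient.induction_on with | _ c
    obtain ⟨f, hf, hfc⟩ := (Submodule.Quotient.mk_eq_zero _).1 hx
    replace hfc : ∀ a : 𝒢.CoverArrows 𝒰,
      c.1 a.val = f ((𝒢.cover 𝒰).src a) - f ((𝒢.cover 𝒰).tgt a) := hfc
    obtain ⟨f', hf', hff⟩ := DisjUnion.exists_descend hf 𝒰.exists_mem fun p q e => by
      have hq : p.val ∈ q.idx.1 := e ▸ q.val_mem
      have h₁ := hfc (𝒢.coverUnit p.idx q.idx p.val p.val_mem hq)
      rw [𝒢.src_cover_coverUnit, 𝒢.tgt_cover_coverUnit] at h₁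
      -- The unit between the copies `p` and `q` lies over the identity arrow, where a cocycle
      -- vanishes. Hence the primitive takes equal values at both.
      have h₂ : c.1 (𝒢.one p.val) = 0 := realZ1_one c.2 p.val
      have h₅ : f p - f q = 0 := by
        rw [← h₂]
        refine Eq.trans ?_ h₁.symm
        congr 2
        exact DisjUnion.ext' rfl e.symm
      linarith
    refine (Submodule.Quotient.mk_eq_zero _).2 ⟨f', hf', fun g => ?_⟩
    have := hfc (𝒢.coverArrow _ _ g (𝒰.mem_memberAt _) (𝒰.mem_memberAt _))
    rw [← hff, ← hff] at this
    exact this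
  · intro x
    induction x using Submodule.Quotient.induction_on with | _ c
    obtain ⟨d, hd, f, hf, h⟩ := exists_realZ1_pull c.2
    -- The quotient asks for a primitive of `d - c`, and `c - d` is the coboundary of `f`; hence the
    -- sign.
    refine ⟨Submodule.Quotient.mk ⟨d, hd⟩, ((Submodule.Quotient.eq _).2
      ⟨fun x => - f x, hf.neg, fun a => ?_⟩)⟩
    change d a.val - c.1 a = _
    rw [h a]
    ring

end RealCocycles

end LieGroupoid

/-! ### The decomposition of `ℝ^*` into absolute value and sign -/

/-- The homomorphism `exp : ℝ → ℝ^*`. -/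
def expUnits (r : ℝ) : ℝˣ := Units.mk0 (Real.exp r) (Real.exp_ne_zero r)

theorem contMDiff_expUnits : ContMDiff 𝓘(ℝ, ℝ) 𝓘(ℝ, ℝ) ∞ expUnits :=
  ContMDiff.of_comp_isOpenEmbedding Units.isOpenEmbedding_val Real.contDiff_exp.contMDiff

theorem expUnits_add (a b : ℝ) : expUnits (a + b) = expUnits a * expUnits b :=
  Units.ext (Real.exp_add a b)

theorem expUnits_sub (a b : ℝ) : expUnits (a - b) = expUnits a / expUnits b := by
  rw [eq_div_iff_mul_eq', mul_comm, ← expUnits_add, add_sub_cancel]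

/-- The inclusion `{1, -1} → ℝ^*`. -/
def castSign : ℤˣ →* ℝˣ := Units.map (Int.castRingHom ℝ).toMonoidHom

theorem contMDiff_castSign : ContMDiff (𝓡 0) 𝓘(ℝ, ℝ) ∞ castSign := contMDiff_of_discreteTopology

theorem coe_castSign (e : ℤˣ) : (castSign e : ℝ) = ((e : ℤ) : ℝ) := rfl

/-- This and the two results after it say that `(r, e) ↦ expUnits r * castSign e` is inverse to `λ ↦
(ln |λ|, sign λ)`. -/
theorem expUnits_log_mul_castSign (a : ℝˣ) :
    expUnits (Real.log |(a : ℝ)|) * castSign (signUnits a) = a := by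
  refine Units.ext ?_
  change Real.exp (Real.log |(a : ℝ)|) * (castSign (signUnits a) : ℝ) = a
  rw [Real.exp_log (abs_pos.2 a.ne_zero), coe_castSign]
  rcases lt_or_gt_of_ne a.ne_zero with h | h
  · simp [signUnits, h.not_gt, abs_of_neg h]
  · simp [signUnits, h, abs_of_pos h]

theorem log_abs_expUnits_mul_castSign (r : ℝ) (e : ℤˣ) :
    Real.log |((expUnits r * castSign e : ℝˣ) : ℝ)| = r := by
  have h : |((castSign e : ℝˣ) : ℝ)| = 1 := by
    rw [coe_castSign]
    rcases Int.units_eq_one_or e with rfl | rfl <;> simp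
  rw [Units.val_mul, abs_mul, h, _root_.mul_one]
  change Real.log |Real.exp r| = r
  rw [Real.abs_exp, Real.log_exp]

theorem signUnits_expUnits_mul_castSign (r : ℝ) (e : ℤˣ) :
    signUnits (expUnits r * castSign e) = e := by
  have h₁ : signUnits (expUnits r) = 1 := if_pos (Real.exp_pos r)
  rw [map_mul, h₁, _root_.one_mul]
  rcases Int.units_eq_one_or e with rfl | rfl <;> simp [signUnits, coe_castSign]

/-! ### Splitting the cohomology with coefficients in `ℝ^*` -/

namespace LieGroupoid

section

variable {n m : ℕ} {M : Type u} {G : Type w}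
  [TopologicalSpace M] [ChartedSpace (EuclideanSpace ℝ (Fin n)) M]
  [TopologicalSpace G] [ChartedSpace (EuclideanSpace ℝ (Fin m)) G]
  {n' m' : ℕ} {M' : Type u'} {G' : Type w'}
  [TopologicalSpace M'] [ChartedSpace (EuclideanSpace ℝ (Fin n')) M']
  [TopologicalSpace G'] [ChartedSpace (EuclideanSpace ℝ (Fin m')) G']
  {𝒢 : LieGroupoid n m M G} {𝒢' : LieGroupoid n' m' M' G'}

theorem H1.logAbs_pullH1 (Φ : 𝒢'.Hom 𝒢) (x : 𝒢.H1 𝓘(ℝ, ℝ) ℝˣ) :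
    (H1.logAbs (Φ.pullH1 𝓘(ℝ, ℝ) ℝˣ x)).toAdd = Φ.pullRealH1 (H1.logAbs x).toAdd := by
  induction x using QuotientGroup.induction_on with | _ c
  rfl

theorem H1.sign_pullH1 (Φ : 𝒢'.Hom 𝒢) (x : 𝒢.H1 𝓘(ℝ, ℝ) ℝˣ) :
    H1.sign (Φ.pullH1 𝓘(ℝ, ℝ) ℝˣ x) = Φ.pullH1 (𝓡 0) ℤˣ (H1.sign x) := by
  induction x using QuotientGroup.induction_on with | _ c
  rfl

/-- If `ln |c|` is the coboundary of `f` and `sign c` that of `e`, then `c` is the coboundary of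
`exp f · e`. -/
theorem H1.eq_one_of_logAbs_of_sign {x : 𝒢.H1 𝓘(ℝ, ℝ) ℝˣ} (h₁ : H1.logAbs x = 1)
    (h₂ : H1.sign x = 1) : x = 1 := by
  induction x using QuotientGroup.induction_on with | _ c
  obtain ⟨f, hf, hfc⟩ := (Submodule.Quotient.mk_eq_zero _).1 (congrArg Multiplicative.toAdd h₁)
  obtain ⟨e, he, hec⟩ := (QuotientGroup.eq_one_iff _).1 h₂
  replace hfc : ∀ g, Real.log |(c.1 g : ℝ)| = f (𝒢.src g) - f (𝒢.tgt g) := hfc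
  replace hec : ∀ g, signUnits (c.1 g) = e (𝒢.src g) / e (𝒢.tgt g) := hec
  refine (QuotientGroup.eq_one_iff _).2 ⟨fun x => expUnits (f x) * castSign (e x),
    (contMDiff_expUnits.comp hf).mul (contMDiff_castSign.comp he), fun g => ?_⟩
  refine (expUnits_log_mul_castSign (c.1 g)).symm.trans ?_
  rw [hfc, hec, expUnits_sub, map_div]
  exact div_mul_div_comm _ _ _ _

/-- For representatives `c` of `y` and `d` of `z`, the product `exp c · d` is a cocycle with the
required components. -/
theorem H1.exists_logAbs_sign (y : 𝒢.RealH1) (z : 𝒢.H1 (𝓡 0) ℤˣ) :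
    ∃ x : 𝒢.H1 𝓘(ℝ, ℝ) ℝˣ, (H1.logAbs x).toAdd = y ∧ H1.sign x = z := by
  induction y using Submodule.Quotient.induction_on with | _ c
  induction z using QuotientGroup.induction_on with | _ d
  refine ⟨QuotientGroup.mk ⟨fun g => expUnits (c.1 g) * castSign (d.1 g),
    (contMDiff_expUnits.comp c.2.1).mul (contMDiff_castSign.comp d.2.1), fun g h e => ?_⟩,
    congrArg Submodule.Quotient.mk (Subtype.ext (funext fun g =>
      log_abs_expUnits_mul_castSign _ _)),
    congrArg QuotientGroup.mk (Subtype.ext (funext fun g =>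
      signUnits_expUnits_mul_castSign _ _))⟩
  simp only [c.2.2 g h e, d.2.2 g h e, expUnits_add, map_mul]
  exact mul_mul_mul_comm _ _ _ _

end

/-! ### The splitting in the colimit over open covers -/

section Cech

variable {n m : ℕ} {M : Type u} {G : Type w}
  [TopologicalSpace M] [ChartedSpace (EuclideanSpace ℝ (Fin n)) M]
  [TopologicalSpace G] [ChartedSpace (EuclideanSpace ℝ (Fin m)) G]
  [IsManifold (𝓡 n) ∞ M] [IsManifold (𝓡 m) ∞ G] {𝒢 : LieGroupoid n m M G}
  {EA : Type*} [NormedAddCommGroup EA] [NormedSpace ℝ EA]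
  {HA : Type*} [TopologicalSpace HA] {IA : ModelWithCorners ℝ EA HA}
  {A : Type*} [CommGroup A] [TopologicalSpace A] [ChartedSpace HA A] [LieGroup IA ∞ A]
  {𝒰 𝒱 : OpenCover M}

theorem CechH1.of_resH1 (h : 𝒰 ≤ 𝒱) (x : (𝒢.cover 𝒰).H1 IA A) :
    CechH1.of 𝒢 𝒱 (𝒢.resH1 IA A h x) = CechH1.of 𝒢 𝒰 x :=
  DirectLimit.mk_apply (F := fun 𝒰 : OpenCover M => (𝒢.cover 𝒰).H1 IA A)
    (f := fun _ _ h => 𝒢.resH1 IA A h) 𝒰 𝒱 x h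

/-- The transition maps of the colimit use an arbitrary choice of refinement map. By
`pullH1_refineMap_eq` any other one gives the same class, which is the form needed when frames are
restricted along explicit refinements. -/
theorem CechH1.of_pullH1 (r : 𝒱.carrier → 𝒰.carrier) (hr : ∀ V, V.1 ≤ (r V).1)
    (x : (𝒢.cover 𝒰).H1 IA A) :
    CechH1.of 𝒢 𝒱 ((𝒢.refineMap r hr).pullH1 IA A x) = CechH1.of 𝒢 𝒰 x := by
  have h : 𝒰 ≤ 𝒱 := fun V hV => ⟨_, (r ⟨V, hV⟩).2, hr ⟨V, hV⟩⟩
  rw [← CechH1.of_resH1 h, pullH1_refineMap_eq]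
  rfl

theorem CechH1.of_mul (x y : (𝒢.cover 𝒰).H1 IA A) :
    CechH1.of 𝒢 𝒰 (x * y) = CechH1.of 𝒢 𝒰 x * CechH1.of 𝒢 𝒰 y :=
  (DirectLimit.mul_def (G := fun 𝒰 : OpenCover M => (𝒢.cover 𝒰).H1 IA A)
    (f := fun _ _ h => 𝒢.resH1 IA A h) 𝒰 x y).symm

theorem CechH1.of_eq_one_iff {x : (𝒢.cover 𝒰).H1 IA A} :
    CechH1.of 𝒢 𝒰 x = 1 ↔ ∃ (𝒱 : OpenCover M) (h : 𝒰 ≤ 𝒱), 𝒢.resH1 IA A h x = 1 :=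
  DirectLimit.exists_eq_one _

theorem CechH1.exists_of (x : 𝒢.CechH1 IA A) : ∃ 𝒰 y, x = CechH1.of 𝒢 𝒰 y :=
  DirectLimit.exists_eq_mk _ x

theorem pullRealH1_refineMap (r : 𝒱.carrier → 𝒰.carrier) (hr : ∀ V, V.1 ≤ (r V).1)
    (y : 𝒢.RealH1) :
    (𝒢.refineMap r hr).pullRealH1 ((𝒢.coverMap 𝒰).pullRealH1 y) =
      (𝒢.coverMap 𝒱).pullRealH1 y := by
  induction y using Submodule.Quotient.induction_on with | _ c
  rfl

variable [T2Space M] [SecondCountableTopology M]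

/-- The isomorphism in real cohomology given by the pull-back to an open cover. -/
def coverRealEquiv (𝒢 : LieGroupoid n m M G) (𝒰 : OpenCover M) :
    𝒢.RealH1 ≃ₗ[ℝ] (𝒢.cover 𝒰).RealH1 :=
  .ofBijective _ (pullRealH1_coverMap_bijective 𝒢 𝒰)

theorem pullRealH1_coverRealEquiv_symm (y : (𝒢.cover 𝒰).RealH1) :
    (𝒢.coverMap 𝒰).pullRealH1 ((𝒢.coverRealEquiv 𝒰).symm y) = y :=
  (𝒢.coverRealEquiv 𝒰).apply_symm_apply y

/-- The map from the cohomology of the pull-back to an open cover that is induced by the logarithm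
of the absolute value and the sign. -/
def logSign (𝒢 : LieGroupoid n m M G) (𝒰 : OpenCover M) :
    (𝒢.cover 𝒰).H1 𝓘(ℝ, ℝ) ℝˣ →* Multiplicative 𝒢.RealH1 × 𝒢.CechH1 (𝓡 0) ℤˣ :=
  MonoidHom.mk' (fun x => (Multiplicative.ofAdd ((𝒢.coverRealEquiv 𝒰).symm (H1.logAbs x).toAdd),
    CechH1.of 𝒢 𝒰 (H1.sign x))) fun x y => by
      refine Prod.ext ?_ ?_
      · change Multiplicative.ofAdd _ = Multiplicative.ofAdd _ * Multiplicative.ofAdd _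
        rw [map_mul, toAdd_mul, map_add, ofAdd_add]
      · change CechH1.of 𝒢 𝒰 _ = CechH1.of 𝒢 𝒰 _ * CechH1.of 𝒢 𝒰 _
        rw [map_mul, CechH1.of_mul]

/-- The real component is compared after the injective pull-back to `𝒱`, which factors through the
one to `𝒰`. The sign component is compared in the colimit. -/
theorem logSign_resH1 (h : 𝒰 ≤ 𝒱) (x : (𝒢.cover 𝒰).H1 𝓘(ℝ, ℝ) ℝˣ) :
    𝒢.logSign 𝒰 x = 𝒢.logSign 𝒱 (𝒢.resH1 𝓘(ℝ, ℝ) ℝˣ h x) := by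
  refine Prod.ext (congrArg Multiplicative.ofAdd ?_) ?_
  · refine (LinearEquiv.eq_symm_apply _).2 ?_
    change (𝒢.coverMap 𝒱).pullRealH1 _ = _
    rw [← pullRealH1_refineMap, pullRealH1_coverRealEquiv_symm]
    exact (H1.logAbs_pullH1 _ x).symm
  · change CechH1.of 𝒢 𝒰 (H1.sign x) = CechH1.of 𝒢 𝒱 (H1.sign (𝒢.resH1 𝓘(ℝ, ℝ) ℝˣ h x))
    rw [resH1, H1.sign_pullH1]
    exact (CechH1.of_resH1 h _).symm

/-- The map from Čech-type cohomology that is induced by the logarithm of the absolute value and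
the sign. -/
def cechLogSign (𝒢 : LieGroupoid n m M G) :
    𝒢.CechH1 𝓘(ℝ, ℝ) ℝˣ →* Multiplicative 𝒢.RealH1 × 𝒢.CechH1 (𝓡 0) ℤˣ :=
  MonoidHom.mk' (DirectLimit.lift _ (fun 𝒰 => 𝒢.logSign 𝒰) fun _ _ h x => logSign_resH1 h x)
    (DirectLimit.lift_mul _ _)

theorem cechLogSign_of (x : (𝒢.cover 𝒰).H1 𝓘(ℝ, ℝ) ℝˣ) :
    𝒢.cechLogSign (CechH1.of 𝒢 𝒰 x) = 𝒢.logSign 𝒰 x := rfl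

/-- Only the sign component involves refinements: its triviality or a representative of it fixes a
cover, and over that cover the real component is transported by `coverRealEquiv` and the splitting
of `ℝ^*` applies. -/
theorem cechLogSign_bijective (𝒢 : LieGroupoid n m M G) : Function.Bijective 𝒢.cechLogSign := by
  constructor
  · refine (injective_iff_map_eq_one _).2 fun x hx => ?_
    obtain ⟨𝒰, x, rfl⟩ := CechH1.exists_of x
    obtain ⟨𝒱, h, hs⟩ := CechH1.of_eq_one_iff.1 (congrArg Prod.snd hx)
    refine CechH1.of_eq_one_iff.2 ⟨𝒱, h, H1.eq_one_of_logAbs_of_sign ?_ ?_⟩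
    · rw [cechLogSign_of, logSign_resH1 h] at hx
      have hx' : (𝒢.coverRealEquiv 𝒱).symm (H1.logAbs (𝒢.resH1 𝓘(ℝ, ℝ) ℝˣ h x)).toAdd = 0 :=
        congrArg (fun p => p.1.toAdd) hx
      exact (LinearEquiv.map_eq_zero_iff _).1 hx'
    · rw [resH1, H1.sign_pullH1]
      exact hs
  · rintro ⟨y, z⟩
    obtain ⟨𝒰, z, rfl⟩ := CechH1.exists_of z
    -- The real class is pulled back to the cover that already carries a representative of the sign
    -- class.
    obtain ⟨x, h₁, h₂⟩ := H1.exists_logAbs_sign ((𝒢.coverMap 𝒰).pullRealH1 y.toAdd) z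
    refine ⟨CechH1.of 𝒢 𝒰 x, Prod.ext (congrArg Multiplicative.ofAdd ?_)
      (congrArg (CechH1.of 𝒢 𝒰) h₂)⟩
    rw [h₁]
    exact (𝒢.coverRealEquiv 𝒰).symm_apply_apply _

/-- The splitting of Čech-type cohomology with coefficients in `ℝ^*`. -/
def cechSplitting (𝒢 : LieGroupoid n m M G) :
    𝒢.CechH1 𝓘(ℝ, ℝ) ℝˣ ≃* Multiplicative 𝒢.RealH1 × 𝒢.CechH1 (𝓡 0) ℤˣ :=
  .ofBijective 𝒢.cechLogSign 𝒢.cechLogSign_bijective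

end Cech

end LieGroupoid

/-! ### Cocycles of frames and their behaviour under change of frame, pull-back and tensor product
-/

namespace LineRep

open LineBundle LieGroupoid

section

variable {n m : ℕ} {M : Type u} {G : Type w}
  [TopologicalSpace M] [ChartedSpace (EuclideanSpace ℝ (Fin n)) M]
  [TopologicalSpace G] [ChartedSpace (EuclideanSpace ℝ (Fin m)) G] {𝒢 : LieGroupoid n m M G}
  {n' m' : ℕ} {M' : Type u'} {G' : Type w'}
  [TopologicalSpace M'] [ChartedSpace (EuclideanSpace ℝ (Fin n')) M']
  [TopologicalSpace G'] [ChartedSpace (EuclideanSpace ℝ (Fin m')) G']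
  {𝒢' : LieGroupoid n' m' M' G'} {L L' : LineRep.{u, v} 𝒢}

/-- The coefficient is obtained by choice. It is determined by its defining equation because `σ`
does not vanish, and this is how all coefficients below are computed. -/
theorem Frame.coeff_eq (σ : L.Frame) {x y : M} (g : 𝒢.Arrow x y) {a : ℝˣ}
    (h : L.act g (σ.sec x) = (a : ℝ) • σ.sec y) : σ.coeff g.1 = a :=
  Units.ext (smul_left_injective ℝ (σ.ne_zero y) ((σ.act_sec g).symm.trans h))

theorem Frame.extClass_eq_of_coeff {σ : L.Frame} {τ : L'.Frame}
    {f : M → ℝˣ} (hf : ContMDiff (𝓡 n) 𝓘(ℝ, ℝ) ∞ f)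
    (h : ∀ g, τ.coeff g = σ.coeff g * (f (𝒢.src g) / f (𝒢.tgt g))) :
    σ.extClass = τ.extClass := by
  refine QuotientGroup.eq.2 ⟨f, hf, fun g => ?_⟩
  change (σ.coeff g)⁻¹ * τ.coeff g = _
  rw [h, inv_mul_cancel_left]

/-- Two frames of a line bundle differ by a smooth nowhere vanishing function `f`. Substituting `τ =
f σ` in the defining equation of the cocycle changes it by the coboundary of `f`. -/
theorem Frame.exists_coeff_eq (σ τ : L.Frame) :
    ∃ f : M → ℝˣ, ContMDiff (𝓡 n) 𝓘(ℝ, ℝ) ∞ f ∧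
      ∀ g, τ.coeff g = σ.coeff g * (f (𝒢.src g) / f (𝒢.tgt g)) := by
  have h : ∀ x, ∃ a : ℝˣ, τ.sec x = (a : ℝ) • σ.sec x := fun x => by
    obtain ⟨a, ha⟩ := L.toLineBundle.exists_smul_eq (σ.ne_zero x) (τ.sec x)
    refine ⟨Units.mk0 a ?_, ha⟩
    rintro rfl
    exact τ.ne_zero x (by rw [ha, zero_smul])
  choose f hf using h
  refine ⟨f, ContMDiff.of_comp_isOpenEmbedding Units.isOpenEmbedding_val fun x =>
    contMDiffAt_coeff σ.smooth.contMDiffAt τ.smooth.contMDiffAt (σ.ne_zero x) (.of_forall hf),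
    fun g => ?_⟩
  refine τ.coeff_eq (𝒢.arrow g) ?_
  rw [hf, hf, map_smul, σ.act_sec, smul_smul, smul_smul, ← Units.val_mul, ← Units.val_mul]
  refine congrArg (fun a : ℝˣ => (a : ℝ) • σ.sec (𝒢.tgt g)) ?_
  change f (𝒢.src g) * σ.coeff g = σ.coeff g * (f (𝒢.src g) / f (𝒢.tgt g)) * f (𝒢.tgt g)
  rw [_root_.mul_assoc, div_mul_cancel, mul_comm]

theorem Frame.extClass_unique (σ τ : L.Frame) : σ.extClass = τ.extClass := by
  obtain ⟨f, hf, h⟩ := σ.exists_coeff_eq τ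
  exact extClass_eq_of_coeff hf h

/-- The product of a frame with a smooth function. -/
def Frame.scale (σ : L.Frame) (f : M → ℝˣ) (hf : ContMDiff (𝓡 n) 𝓘(ℝ, ℝ) ∞ f) : L.Frame where
  sec x := (f x : ℝ) • σ.sec x
  smooth x := contMDiffAt_smul σ.smooth.contMDiffAt
    ((Units.contMDiff_val (f x)).comp x hf.contMDiffAt)
  ne_zero x := smul_ne_zero (f x).ne_zero (σ.ne_zero x)

theorem Frame.coeff_scale (σ : L.Frame) (f : M → ℝˣ) (hf : ContMDiff (𝓡 n) 𝓘(ℝ, ℝ) ∞ f) (g : G) :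
    (σ.scale f hf).coeff g = σ.coeff g * (f (𝒢.src g) / f (𝒢.tgt g)) := by
  refine (σ.scale f hf).coeff_eq (𝒢.arrow g) ?_
  change L.act (𝒢.arrow g) ((f (𝒢.src g) : ℝ) • σ.sec (𝒢.src g)) =
    _ • (f (𝒢.tgt g) : ℝ) • σ.sec (𝒢.tgt g)
  rw [map_smul, σ.act_sec, smul_smul, smul_smul, ← Units.val_mul, ← Units.val_mul]
  refine congrArg (fun a : ℝˣ => (a : ℝ) • σ.sec (𝒢.tgt g)) ?_
  change f (𝒢.src g) * σ.coeff g = σ.coeff g * (f (𝒢.src g) / f (𝒢.tgt g)) * f (𝒢.tgt g)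
  rw [_root_.mul_assoc, div_mul_cancel, mul_comm]

/-- A frame of a pull-back, in terms of the original bundle. -/
def pullFrame (Φ : 𝒢'.Hom 𝒢) (sec : ∀ x, L.fib (Φ.base x))
    (smooth : ContMDiff (𝓡 n') ((𝓡 n).prod 𝓘(ℝ, ℝ)) ∞
      (fun x => TotalSpace.mk' ℝ (Φ.base x) (sec x)))
    (ne_zero : ∀ x, sec x ≠ 0) : (L.pull Φ).Frame where
  sec := sec
  smooth x := contMDiffAt_pull_iff.2 ⟨contMDiffAt_id, smooth x⟩
  ne_zero := ne_zero

theorem Frame.smooth_pull {Φ : 𝒢'.Hom 𝒢} (σ : (L.pull Φ).Frame) :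
    ContMDiff (𝓡 n') ((𝓡 n).prod 𝓘(ℝ, ℝ)) ∞
      (fun x => TotalSpace.mk' ℝ (Φ.base x) (σ.sec x : L.fib (Φ.base x))) :=
  fun _ => (contMDiffAt_pull_iff.1 σ.smooth.contMDiffAt).2

/-- The pull-back of a frame. -/
def Frame.pull (σ : L.Frame) (Φ : 𝒢'.Hom 𝒢) : (L.pull Φ).Frame :=
  pullFrame Φ (fun x => σ.sec (Φ.base x)) (σ.smooth.comp Φ.base.contMDiff)
    fun x => σ.ne_zero (Φ.base x)

theorem Frame.extClass_pull (σ : L.Frame) (Φ : 𝒢'.Hom 𝒢) :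
    (σ.pull Φ).extClass = Φ.pullH1 𝓘(ℝ, ℝ) ℝˣ σ.extClass := by
  refine congrArg QuotientGroup.mk (Subtype.ext (funext fun g => ?_))
  exact (σ.pull Φ).coeff_eq (𝒢'.arrow g) (σ.act_sec (Φ.map (𝒢'.arrow g)))

/-- The image of a frame of a pull-back under an isomorphism. -/
def Frame.mapPull {Φ : 𝒢'.Hom 𝒢} (σ : (L.pull Φ).Frame) (F : Iso L L') : (L'.pull Φ).Frame :=
  pullFrame Φ (fun x => F.equiv (Φ.base x) (σ.sec x))
    (F.contMDiff_equiv.comp σ.smooth_pull) fun x => (F.equiv _).map_ne_zero_iff.2 (σ.ne_zero x)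

/-- By equivariance, an isomorphism carries the defining equation of the coefficients of `σ` to that
of its image, so even the cocycles coincide. -/
theorem Frame.extClass_mapPull {Φ : 𝒢'.Hom 𝒢} (σ : (L.pull Φ).Frame) (F : Iso L L') :
    (σ.mapPull F).extClass = σ.extClass := by
  refine congrArg QuotientGroup.mk (Subtype.ext (funext fun g => ?_))
  refine (σ.mapPull F).coeff_eq (𝒢'.arrow g) ?_
  change L'.act (Φ.map (𝒢'.arrow g)) (F.equiv _ (σ.sec _)) = _ • F.equiv _ (σ.sec _)
  have h : L.act (Φ.map (𝒢'.arrow g)) (σ.sec (𝒢'.src g)) =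
    (σ.coeff g : ℝ) • (σ.sec (𝒢'.tgt g) : L.fib (Φ.base _)) := σ.act_sec (𝒢'.arrow g)
  exact (F.equiv_act _ _).symm.trans ((congrArg (F.equiv _) h).trans (map_smul (F.equiv _) _ _))

/-- The tensor product of frames of pull-backs. -/
def Frame.tensorPull {Φ : 𝒢'.Hom 𝒢} (σ : (L.pull Φ).Frame) (τ : (L'.pull Φ).Frame) :
    ((L.tensor L').pull Φ).Frame :=
  pullFrame (L := L.tensor L') Φ
    (fun x => (σ.sec x : L.fib (Φ.base x)) ⊗ₜ[ℝ] (τ.sec x : L'.fib (Φ.base x)))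
    (fun x => contMDiffAt_tmul (σ.smooth_pull x) (τ.smooth_pull x))
    fun x => tmul_ne_zero (L := L.toLineBundle) (L' := L'.toLineBundle) (σ.ne_zero x) (τ.ne_zero x)

theorem Frame.coeff_tensorPull {Φ : 𝒢'.Hom 𝒢} (σ : (L.pull Φ).Frame) (τ : (L'.pull Φ).Frame)
    (g : G') : (σ.tensorPull τ).coeff g = σ.coeff g * τ.coeff g := by
  refine (σ.tensorPull τ).coeff_eq (𝒢'.arrow g) ?_
  have h : L.act (Φ.map (𝒢'.arrow g)) (σ.sec (𝒢'.src g)) =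
    (σ.coeff g : ℝ) • (σ.sec (𝒢'.tgt g) : L.fib (Φ.base _)) := σ.act_sec (𝒢'.arrow g)
  have h' : L'.act (Φ.map (𝒢'.arrow g)) (τ.sec (𝒢'.src g)) =
    (τ.coeff g : ℝ) • (τ.sec (𝒢'.tgt g) : L'.fib (Φ.base _)) := τ.act_sec (𝒢'.arrow g)
  refine (congrArg₂ (fun a b => a ⊗ₜ[ℝ] b) h h').trans ?_
  exact TensorProduct.smul_tmul_smul _ _ _ _

theorem Frame.extClass_tensorPull {Φ : 𝒢'.Hom 𝒢} (σ : (L.pull Φ).Frame) (τ : (L'.pull Φ).Frame) :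
    (σ.tensorPull τ).extClass = σ.extClass * τ.extClass :=
  congrArg QuotientGroup.mk (Subtype.ext (funext fun g => σ.coeff_tensorPull τ g))

/-- A representation with a frame whose cocycle is trivial is trivial. -/
theorem nonempty_iso_trivial {L : LineRep.{u, v} 𝒢} (τ : L.Frame) (h : ∀ g, τ.coeff g = 1) :
    Nonempty (Iso (trivial 𝒢) L) := by
  let F : ∀ x, ULift.{v} ℝ →ₗ[ℝ] L.fib x := fun x =>
    LinearMap.toSpanSingleton ℝ _ (τ.sec x) ∘ₗ ULift.moduleEquiv.toLinearMap
  have hF : ∀ x, Function.Bijective (F x) := fun x => by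
    refine ⟨fun a b hab => ULift.ext _ _ (smul_left_injective ℝ (τ.ne_zero x) hab), fun w => ?_⟩
    obtain ⟨a, ha⟩ := L.toLineBundle.exists_smul_eq (τ.ne_zero x) w
    exact ⟨⟨a⟩, ha.symm⟩
  refine ⟨.ofFrames (fun x => .ofBijective (F x) (hF x)) (fun {x y} g a => ?_) fun x => ?_⟩
  · change (a.down • τ.sec y : L.fib y) = L.act g (a.down • τ.sec x)
    rw [map_smul, τ.act_sec, h, Units.val_one, one_smul]
  · refine ⟨fun _ => (⟨1⟩ : ULift ℝ), contMDiffAt_trivial contMDiffAt_id contMDiffAt_const,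
      fun h => one_ne_zero (congrArg ULift.down h), ?_⟩
    exact contMDiffAt_smul τ.smooth.contMDiffAt (contMDiffAt_const (c := (1 : ℝ)))

end

/-! ### Frames over open covers and their descent -/

section Cover

variable {n m : ℕ} {M : Type u} {G : Type w}
  [TopologicalSpace M] [ChartedSpace (EuclideanSpace ℝ (Fin n)) M]
  [TopologicalSpace G] [ChartedSpace (EuclideanSpace ℝ (Fin m)) G]
  [IsManifold (𝓡 n) ∞ M] [IsManifold (𝓡 m) ∞ G] {𝒢 : LieGroupoid n m M G}
  {L L' : LineRep.{u, v} 𝒢} {𝒰 𝒱 : OpenCover M}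

/-- The restriction of a frame over an open cover to a refinement. -/
def Frame.restrict (σ : (L.pull (𝒢.coverMap 𝒰)).Frame) (r : 𝒱.carrier → 𝒰.carrier)
    (hr : ∀ V, V.1 ≤ (r V).1) : (L.pull (𝒢.coverMap 𝒱)).Frame :=
  pullFrame (𝒢.coverMap 𝒱) (fun x => σ.sec ((𝒢.refineMap r hr).base x))
    (σ.smooth_pull.comp (𝒢.refineMap r hr).base.contMDiff) fun _ => σ.ne_zero _

theorem Frame.extClass_restrict (σ : (L.pull (𝒢.coverMap 𝒰)).Frame)
    (r : 𝒱.carrier → 𝒰.carrier) (hr : ∀ V, V.1 ≤ (r V).1) :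
    (σ.restrict r hr).extClass = (𝒢.refineMap r hr).pullH1 𝓘(ℝ, ℝ) ℝˣ σ.extClass := by
  refine congrArg QuotientGroup.mk (Subtype.ext (funext fun a => ?_))
  exact (σ.restrict r hr).coeff_eq ((𝒢.cover 𝒱).arrow a)
    (σ.act_sec ((𝒢.refineMap r hr).map ((𝒢.cover 𝒱).arrow a)))

/-- The Čech class of a representation does not depend on the choices of cover and frame, and is
invariant under isomorphisms. -/
theorem Frame.of_extClass_eq (F : Iso L L') (σ : (L.pull (𝒢.coverMap 𝒰)).Frame)
    (τ : (L'.pull (𝒢.coverMap 𝒱)).Frame) :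
    CechH1.of 𝒢 𝒰 σ.extClass = CechH1.of 𝒢 𝒱 τ.extClass := by
  -- Over a common refinement, `F` turns the restriction of `σ` into a frame of the pull-back of
  -- `L'`. It is then compared with the restriction of `τ` by `Frame.extClass_unique`.
  obtain ⟨𝒲, h₁, h₂⟩ := exists_ge_ge 𝒰 𝒱
  obtain ⟨r, hr⟩ := exists_refine h₁
  obtain ⟨r', hr'⟩ := exists_refine h₂
  rw [← CechH1.of_pullH1 r hr, ← CechH1.of_pullH1 r' hr', ← Frame.extClass_restrict,
    ← Frame.extClass_restrict, ← (σ.restrict r hr).extClass_mapPull F]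
  exact congrArg _ (Frame.extClass_unique _ _)

/-- A representation has a frame over some open cover. -/
theorem exists_coverFrame (L : LineRep.{u, v} 𝒢) :
    ∃ 𝒰 : OpenCover M, Nonempty (L.pull (𝒢.coverMap 𝒰)).Frame := by
  let B : M → Opens M := fun i => ⟨_, L.frameAtlas.isOpen_dom i⟩
  let 𝒰 : OpenCover M := ⟨range B, fun x => ⟨B x, mem_range_self x, L.mem_base x⟩⟩
  -- The members of the cover are indexed by open sets rather than by points, so for each member a
  -- point whose trivialization has this domain must be chosen.
  choose k hk using fun U : 𝒰.carrier => U.2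
  have hmem : ∀ p : 𝒰.Space, p.val ∈ (trivializationAt ℝ L.fib (k p.idx)).baseSet := fun p => by
    have h := p.val_mem
    rw [← hk] at h
    exact h
  -- In the trivialization preferred at `x`, the frame of index `i` is a transition function of the
  -- bundle.
  have hsm : ∀ i x, x ∈ (trivializationAt ℝ L.fib i).baseSet →
      L.SmoothAt (L.frameAtlas.frame i) x := fun i x hx => by
    refine contMDiffAt_iff.2 ⟨contMDiffAt_id, ?_⟩
    refine ((L.frameAtlas.smooth i x).contMDiffAt
      (Filter.inter_mem ((L.frameAtlas.isOpen_dom i).mem_nhds hx)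
        ((L.frameAtlas.isOpen_dom x).mem_nhds (L.mem_base x)))).congr_of_eventuallyEq ?_
    filter_upwards [(L.frameAtlas.isOpen_dom x).mem_nhds (L.mem_base x)] with y hy
    exact (L.coord_eq_crd hy _).symm
  refine ⟨𝒰, ⟨pullFrame (𝒢.coverMap 𝒰)
    (fun p => L.frameAtlas.frame (k p.idx) p.val) (fun p => ?_) fun p h => ?_⟩⟩
  · have h := (hsm _ _ (hmem p)).comp p DisjUnion.contMDiff_val.contMDiffAt
    refine ContMDiffAt.congr_of_eventuallyEq h ?_
    filter_upwards [DisjUnion.eventually_idx p] with q hq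
    rw [hq]
    rfl
  · have h₁ := L.frameAtlas.coord_frame (k p.idx) p.val (hmem p)
    replace h : L.frameAtlas.frame (k p.idx) p.val = 0 := h
    rw [h, map_zero] at h₁
    exact zero_ne_one h₁

/-- A frame over an open cover descends if its cocycle is trivial on units. -/
theorem Frame.exists_descend (σ : (L.pull (𝒢.coverMap 𝒰)).Frame)
    (h : ∀ (U V : 𝒰.carrier) (x : M) (hU : x ∈ U.1) (hV : x ∈ V.1),
      σ.coeff (𝒢.coverUnit U V x hU hV) = 1) :
    ∃ τ : L.Frame, ∀ a : 𝒢.CoverArrows 𝒰, τ.coeff a.val = σ.coeff a := by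
  have key : ∀ (U V : 𝒰.carrier) (x : M) (hU : x ∈ U.1) (hV : x ∈ V.1),
      (σ.sec (.mk U x hU) : L.fib x) = σ.sec (.mk V x hV) := by
    intro U V x hU hV
    -- The unit between two copies of `x` acts on the fiber `L_x` as the identity. A coefficient `1`
    -- therefore means that the two values of `σ` coincide.
    have h₁ : L.act (𝒢.unit x) (σ.sec (.mk U x hU) : L.fib x) = _ :=
      σ.act_sec (⟨𝒢.coverUnit U V x hU hV, 𝒢.src_cover_coverUnit hU hV,
        𝒢.tgt_cover_coverUnit hU hV⟩ : (𝒢.cover 𝒰).Arrow (.mk U x hU) (.mk V x hV))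
    rw [h, L.act_unit] at h₁
    exact h₁.trans (one_smul ℝ (σ.sec (.mk V x hV) : L.fib x))
  obtain ⟨ψ, hψ, hψσ⟩ := DisjUnion.exists_descend σ.smooth_pull 𝒰.exists_mem (by
    rintro ⟨U, x, hU⟩ ⟨V, y, hV⟩ (rfl : x = y)
    exact congrArg (TotalSpace.mk' ℝ x) (key U V x hU hV))
  have hψ' : ψ = fun x => TotalSpace.mk' ℝ x
      (σ.sec (.mk (𝒰.memberAt x) x (𝒰.mem_memberAt x)) : L.fib x) :=
    funext fun x => hψσ (.mk (𝒰.memberAt x) x (𝒰.mem_memberAt x))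
  let τ : L.Frame := ⟨fun x => σ.sec (.mk (𝒰.memberAt x) x (𝒰.mem_memberAt x)), hψ' ▸ hψ,
    fun _ => σ.ne_zero _⟩
  have hτ : ∀ p : 𝒰.Space, τ.sec p.val = σ.sec p := fun p => key _ _ _ _ p.val_mem
  refine ⟨τ, fun a => τ.coeff_eq (𝒢.arrow a.val) ?_⟩
  have h₁ := hτ ((𝒢.cover 𝒰).src a)
  have h₂ := hτ ((𝒢.cover 𝒰).tgt a)
  exact (congrArg (L.act (𝒢.arrow a.val)) h₁).trans ((σ.act_sec ((𝒢.cover 𝒰).arrow a)).trans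
    (congrArg (fun w : L.fib (𝒢.tgt a.val) => (σ.coeff a : ℝ) • w) h₂.symm))

/-- Squaring removes the sign, so the cocycle of `σ ⊗ σ` is the exponential of the real cocycle `2
ln |c|`. The averaging argument for real cocycles then provides a rescaling whose cocycle is trivial
on units, and the frame descends. -/
theorem nonempty_frame_tensor_self [T2Space M] [SecondCountableTopology M] (L : LineRep.{u, v} 𝒢) :
    Nonempty (L.tensor L).Frame := by
  obtain ⟨𝒰, ⟨σ⟩⟩ := L.exists_coverFrame
  have hc : (fun a => Real.log |(σ.coeff a : ℝ)|) ∈ (𝒢.cover 𝒰).RealZ1 := by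
    refine ⟨contMDiff_logAbs.comp σ.contMDiff_coeff, fun g h e => ?_⟩
    have : σ.coeff ((𝒢.cover 𝒰).mul g h) = σ.coeff g * σ.coeff h := σ.cocycle.2.2 g h e
    simp only [this, Units.val_mul, abs_mul]
    exact Real.log_mul (abs_ne_zero.2 (σ.coeff g).ne_zero) (abs_ne_zero.2 (σ.coeff h).ne_zero)
  obtain ⟨d, hd, f, hf, hdf⟩ := exists_realZ1_pull hc
  -- On units between copies, `2 ln |c|` is the coboundary of `2f`, because the part `d` coming from
  -- `G` vanishes there. The factor `exp (-2f)` cancels it.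
  let e : 𝒰.Space → ℝˣ := fun p => expUnits (-(2 * f p))
  have he : ContMDiff (𝓡 n) 𝓘(ℝ, ℝ) ∞ e :=
    contMDiff_expUnits.comp ((contDiff_const.mul contDiff_id).neg.contMDiff.comp hf)
  obtain ⟨τ, -⟩ := ((σ.tensorPull σ).scale e he).exists_descend fun U V x hU hV => by
    rw [Frame.coeff_scale, Frame.coeff_tensorPull, 𝒢.src_cover_coverUnit, 𝒢.tgt_cover_coverUnit]
    have h₁ := hdf (𝒢.coverUnit U V x hU hV)
    have h₂ : d (𝒢.one x) = 0 := realZ1_one hd x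
    rw [𝒢.src_cover_coverUnit, 𝒢.tgt_cover_coverUnit] at h₁
    replace h₁ : Real.log |(σ.coeff (𝒢.coverUnit U V x hU hV) : ℝ)| =
      d (𝒢.one x) + (f (.mk U x hU) - f (.mk V x hV)) := h₁
    rw [h₂, zero_add] at h₁
    have h₃ : ∀ a : ℝˣ, a * a = expUnits (2 * Real.log |(a : ℝ)|) := fun a => by
      rw [two_mul, expUnits_add]
      refine Units.ext ?_
      change (a : ℝ) * a = Real.exp (Real.log |(a : ℝ)|) * Real.exp (Real.log |(a : ℝ)|)
      rw [Real.exp_log (abs_pos.2 a.ne_zero), abs_mul_abs_self]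
    rw [h₃, h₁, ← expUnits_sub, ← expUnits_add]
    refine Units.ext ((congrArg Real.exp ?_).trans Real.exp_zero)
    ring
  exact ⟨τ⟩

end Cover

end LineRep

/-! ### The representation glued from a cocycle over a cover -/

namespace FrameAtlas

variable {n : ℕ} {M : Type u} [TopologicalSpace M] [ChartedSpace (EuclideanSpace ℝ (Fin n)) M]
  {fib : M → Type v} [∀ x, AddCommGroup (fib x)] [∀ x, Module ℝ (fib x)] (𝒜 : FrameAtlas n fib)
  {E : Type*} [NormedAddCommGroup E] [NormedSpace ℝ E] {H : Type*} [TopologicalSpace H]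
  {I : ModelWithCorners ℝ E H} {K : Type*} [TopologicalSpace K] [ChartedSpace H K]

theorem contMDiffAt_lineBundle_iff {f : K → M} {σ : ∀ k, fib (f k)} {k : K} :
    ContMDiffAt I ((𝓡 n).prod 𝓘(ℝ, ℝ)) ∞
        (fun k => (TotalSpace.mk' ℝ (f k) (σ k) : TotalSpace ℝ 𝒜.lineBundle.fib)) k ↔
      ContMDiffAt I (𝓡 n) ∞ f k ∧
        ContMDiffAt I 𝓘(ℝ, ℝ) ∞ (fun k' => 𝒜.coord (f k) (f k') (σ k')) k :=
  LineBundle.contMDiffAt_iff (L := 𝒜.lineBundle)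

end FrameAtlas

namespace LineRep

open LineBundle LieGroupoid

variable {n m : ℕ} {M : Type u} {G : Type w}
  [TopologicalSpace M] [ChartedSpace (EuclideanSpace ℝ (Fin n)) M]
  [TopologicalSpace G] [ChartedSpace (EuclideanSpace ℝ (Fin m)) G]
  [IsManifold (𝓡 n) ∞ M] [IsManifold (𝓡 m) ∞ G] {𝒢 : LieGroupoid n m M G}
  {𝒰 : OpenCover M}

section OfCocycle

variable (c : (𝒢.cover 𝒰).Z1 𝓘(ℝ, ℝ) ℝˣ)

/-- The action of an arrow on the line bundle that is glued from a cocycle, in terms of the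
preferred members of the cover at its source and target. -/
def gluedAct {x y : M} (g : 𝒢.Arrow x y) : ℝˣ :=
  c.1 (𝒢.coverArrow (𝒰.memberAt x) (𝒰.memberAt y) g.1 (by rw [g.2.1]; exact 𝒰.mem_memberAt x)
    (by rw [g.2.2]; exact 𝒰.mem_memberAt y))

/-- The frame over a member of the cover of the line bundle that is glued from a cocycle, in terms
of the preferred members of the cover at each point. -/
def gluedFrame (U : 𝒰.carrier) (x : M) : ℝˣ :=
  DisjUnion.extend c.1 1 (U, 𝒰.memberAt x) (𝒢.one x)

theorem gluedAct_unit (x : M) : gluedAct c (𝒢.unit x) = 1 := by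
  have hx := 𝒰.mem_memberAt x
  have h := c.2.2 (𝒢.coverUnit _ _ x hx hx) (𝒢.coverUnit _ _ x hx hx)
    ((𝒢.src_cover_coverUnit hx hx).trans (𝒢.tgt_cover_coverUnit hx hx).symm)
  rw [𝒢.coverUnit_mul_coverUnit] at h
  exact left_eq_mul.1 h

theorem gluedAct_comp {x y z : M} (g : 𝒢.Arrow y z) (h : 𝒢.Arrow x y) :
    gluedAct c (g.comp h) = gluedAct c g * gluedAct c h := by
  obtain ⟨h, rfl, rfl⟩ := h
  obtain ⟨g, e, rfl⟩ := g
  exact (congrArg c.1 (𝒢.coverArrow_mul e _ _ _ _).symm).trans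
    (c.2.2 _ _ (DisjUnion.ext' rfl e))

/-- Both sides are the value of `c` on `g` as an arrow from the copy of its source in `U` to the
preferred copy of its target. It says that, in the frames of `U` and `V`, the glued action is
multiplication by `c`. -/
theorem gluedAct_mul_gluedFrame {U V : 𝒰.carrier} {g : G} (hU : 𝒢.src g ∈ U.1)
    (hV : 𝒢.tgt g ∈ V.1) :
    gluedAct c (𝒢.arrow g) * gluedFrame c U (𝒢.src g) =
      c.1 (𝒢.coverArrow U V g hU hV) * gluedFrame c V (𝒢.tgt g) := by
  have hs := 𝒰.mem_memberAt (𝒢.src g)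
  have ht := 𝒰.mem_memberAt (𝒢.tgt g)
  rw [gluedFrame, gluedFrame, 𝒢.extend_one _ _ _ _ hU hs, 𝒢.extend_one _ _ _ _ hV ht]
  refine (c.2.2 _ _ (𝒢.tgt_cover_coverUnit hU hs).symm).symm.trans
    (Eq.trans ?_ ((c.2.2 _ _ (𝒢.src_cover_coverUnit hV ht)).trans (mul_comm _ _)))
  rw [𝒢.coverUnit_mul_coverArrow]
  exact congrArg c.1 (𝒢.coverArrow_mul_coverUnit hU hs ht)

/-- The preferred member jumps with `x`, so `gluedFrame` itself need not be continuous. The quotient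
of two such frames is the value of `c` on units from `U` to `V`, free of the preferred member and
hence smooth. -/
theorem gluedFrame_eq {U V : 𝒰.carrier} {x : M} (hU : x ∈ U.1) (hV : x ∈ V.1) :
    gluedFrame c U x = DisjUnion.extend c.1 1 (U, V) (𝒢.one x) * gluedFrame c V x := by
  have hx := 𝒰.mem_memberAt x
  rw [gluedFrame, gluedFrame, 𝒢.extend_one _ _ _ _ hU hV, 𝒢.extend_one _ _ _ _ hU hx,
    𝒢.extend_one _ _ _ _ hV hx, mul_comm]
  rw [← 𝒢.coverUnit_mul_coverUnit hU hV hx]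
  exact c.2.2 _ _ ((𝒢.src_cover_coverUnit hV hx).trans (𝒢.tgt_cover_coverUnit hU hV).symm)

theorem inv_gluedFrame_mul {U V : 𝒰.carrier} {x : M} (hU : x ∈ U.1) (hV : x ∈ V.1) :
    ((gluedFrame c V x)⁻¹ : ℝˣ) * (gluedFrame c U x : ℝ) =
      ((DisjUnion.extend c.1 1 (U, V) (𝒢.one x) : ℝˣ) : ℝ) := by
  rw [gluedFrame_eq c hU hV, ← Units.val_mul, mul_comm (DisjUnion.extend _ _ _ _),
    inv_mul_cancel_left]

/-- The local frames of the line bundle that is glued from a cocycle. -/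
def gluedAtlas : FrameAtlas n (fun _ : M => ULift.{v} ℝ) where
  dom i := (𝒰.memberAt i).1
  isOpen_dom i := (𝒰.memberAt i).1.isOpen
  mem_dom := 𝒰.mem_memberAt
  frame i x := ⟨gluedFrame c (𝒰.memberAt i) x⟩
  -- `gluedFrame` is a unit of `ℝ` even where its default value `1` is taken, so this is inverse to
  -- the frame at every point.
  coord i x := ((gluedFrame c (𝒰.memberAt i) x)⁻¹ : ℝˣ) • ULift.moduleEquiv.toLinearMap
  coord_frame i x _ := (gluedFrame c (𝒰.memberAt i) x).inv_mul
  coord_smul_frame i x _ w := by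
    refine ULift.ext _ _ ?_
    change ((gluedFrame c (𝒰.memberAt i) x)⁻¹ : ℝˣ) * w.down * (gluedFrame c _ x : ℝ) = w.down
    rw [mul_right_comm, Units.inv_mul, _root_.one_mul]
  smooth i j x hx := by
    have h := 𝒢.contMDiffAt_extend_one c.2.1 1 (𝒰.memberAt i) (𝒰.memberAt j) hx.1 hx.2
    refine (((Units.contMDiff_val (n := ∞) _).comp x h).contMDiffWithinAt).congr (fun y hy => ?_) ?_
    · exact inv_gluedFrame_mul c hy.1 hy.2
    · exact inv_gluedFrame_mul c hx.1 hx.2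

/-- The representation that is glued from a cocycle over an open cover. -/
def glued : LineRep.{u, v} 𝒢 where
  toLineBundle := (gluedAtlas c).lineBundle
  act g := ((gluedAct c g : ℝ) • LinearMap.id : ULift.{v} ℝ →ₗ[ℝ] ULift.{v} ℝ)
  act_unit x := by
    rw [gluedAct_unit]
    exact one_smul ℝ (LinearMap.id : ULift.{v} ℝ →ₗ[ℝ] ULift.{v} ℝ)
  act_comp g h := by
    rw [gluedAct_comp]
    exact LinearMap.ext fun w : ULift.{v} ℝ => mul_smul (gluedAct c g : ℝ) (gluedAct c h : ℝ) w
  contMDiff_act := by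
    refine contMDiff_act_of_frames (gluedAtlas c).lineBundle
      (fun g => ((gluedAct c g : ℝ) • LinearMap.id : ULift.{v} ℝ →ₗ[ℝ] ULift.{v} ℝ)) fun g => ?_
    refine ⟨(gluedAtlas c).frame (𝒢.src g), ?_, ?_, ?_⟩
    · refine (gluedAtlas c).contMDiffAt_lineBundle_iff.2 ⟨contMDiffAt_id, ?_⟩
      refine (contMDiffAt_const (c := (1 : ℝ))).congr_of_eventuallyEq ?_
      exact .of_forall fun x => (gluedFrame c (𝒰.memberAt (𝒢.src g)) x).inv_mul
    · exact fun h => (gluedFrame c _ _).ne_zero (congrArg ULift.down h)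
    -- Expressed in the frames at `src g` and `tgt g`, the action on nearby arrows is `c` itself,
    -- which is smooth.
    · refine (gluedAtlas c).contMDiffAt_lineBundle_iff.2 ⟨𝒢.tgt.contMDiff.contMDiffAt, ?_⟩
      have hs := 𝒰.mem_memberAt (𝒢.src g)
      have ht := 𝒰.mem_memberAt (𝒢.tgt g)
      have h := DisjUnion.contMDiffAt_extend c.2.1 1
        (i := (𝒰.memberAt (𝒢.src g), 𝒰.memberAt (𝒢.tgt g))) (x := g) ⟨hs, ht⟩
      refine ((Units.contMDiff_val (n := ∞) _).comp g h).congr_of_eventuallyEq ?_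
      filter_upwards [(𝒢.arrowOpens _ _).isOpen.mem_nhds ⟨hs, ht⟩] with g' hg'
      change ((gluedFrame c (𝒰.memberAt (𝒢.tgt g)) (𝒢.tgt g'))⁻¹ : ℝˣ) *
        ((gluedAct c (𝒢.arrow g') : ℝ) * (gluedFrame c (𝒰.memberAt (𝒢.src g)) (𝒢.src g') : ℝ)) =
          ((DisjUnion.extend c.1 1 _ g' : ℝˣ) : ℝ)
      rw [← Units.val_mul, gluedAct_mul_gluedFrame c hg'.1 hg'.2, ← Units.val_mul,
        mul_comm (c.1 _), inv_mul_cancel_left]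
      exact congrArg Units.val (DisjUnion.extend_of_mem c.1 1 hg').symm

/-- The frame of the representation that is glued from a cocycle. -/
def gluedCoverFrame : ((glued.{u, v} c).pull (𝒢.coverMap 𝒰)).Frame :=
  pullFrame (L := glued.{u, v} c) (𝒢.coverMap 𝒰)
    (fun p => (⟨gluedFrame c p.idx p.val⟩ : ULift.{v} ℝ))
    (fun p => (gluedAtlas c).contMDiffAt_lineBundle_iff.2
      ⟨DisjUnion.contMDiff_val.contMDiffAt, by
        have hp := 𝒰.mem_memberAt p.val
        have h := (𝒢.contMDiffAt_extend_one c.2.1 1 p.idx (𝒰.memberAt p.val) p.val_mem hp).comp p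
          DisjUnion.contMDiff_val.contMDiffAt
        refine ((Units.contMDiff_val (n := ∞) _).comp p h).congr_of_eventuallyEq ?_
        filter_upwards [DisjUnion.eventually_idx p, DisjUnion.continuous_val.continuousAt.eventually
          ((𝒰.memberAt p.val).1.isOpen.mem_nhds hp)] with q hq hq'
        have hqp := q.val_mem
        rw [hq] at hqp
        change ((gluedFrame c (𝒰.memberAt p.val) q.val)⁻¹ : ℝˣ) * (gluedFrame c q.idx q.val : ℝ) = _
        rw [hq]
        exact inv_gluedFrame_mul c hqp hq'⟩)
    fun p h => (gluedFrame c p.idx p.val).ne_zero (congrArg ULift.down h)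

/-- The cocycle of the tautological frame is `c`, by `gluedAct_mul_gluedFrame` applied to the two
indices of the arrow `a`. This yields surjectivity of the Čech class. -/
theorem extClass_gluedCoverFrame :
    (gluedCoverFrame.{u, v} c).extClass = QuotientGroup.mk c := by
  refine congrArg QuotientGroup.mk (Subtype.ext (funext fun a => ?_))
  refine (gluedCoverFrame.{u, v} c).coeff_eq ((𝒢.cover 𝒰).arrow a) (ULift.ext _ _ ?_)
  have h := congrArg Units.val
    (gluedAct_mul_gluedFrame c (CoverArrows.src_mem 𝒢 𝒰 a) (CoverArrows.tgt_mem 𝒢 𝒰 a))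
  rw [Units.val_mul, Units.val_mul] at h
  exact h

end OfCocycle

/-! ### Representations are classified by their Čech class -/

/-- The Čech class of a representation. -/
def cechClass (L : LineRep.{u, v} 𝒢) : 𝒢.CechH1 𝓘(ℝ, ℝ) ℝˣ :=
  CechH1.of 𝒢 L.exists_coverFrame.choose L.exists_coverFrame.choose_spec.some.extClass

theorem cechClass_eq_of_iso {L L' : LineRep.{u, v} 𝒢} (F : Iso L L')
    (σ : (L'.pull (𝒢.coverMap 𝒰)).Frame) : cechClass L = CechH1.of 𝒢 𝒰 σ.extClass :=
  Frame.of_extClass_eq F _ _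

theorem cechClass_eq {L : LineRep.{u, v} 𝒢} (σ : (L.pull (𝒢.coverMap 𝒰)).Frame) :
    cechClass L = CechH1.of 𝒢 𝒰 σ.extClass :=
  cechClass_eq_of_iso (Setoid.refl L : Nonempty (Iso L L)).some σ

theorem cechClass_tensor (L L' : LineRep.{u, v} 𝒢) :
    cechClass (L.tensor L') = cechClass L * cechClass L' := by
  obtain ⟨𝒰, ⟨σ⟩⟩ := L.exists_coverFrame
  obtain ⟨𝒱, ⟨τ⟩⟩ := L'.exists_coverFrame
  obtain ⟨𝒲, h₁, h₂⟩ := exists_ge_ge 𝒰 𝒱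
  obtain ⟨r, hr⟩ := exists_refine h₁
  obtain ⟨r', hr'⟩ := exists_refine h₂
  rw [cechClass_eq (σ.restrict r hr), cechClass_eq (τ.restrict r' hr'),
    cechClass_eq ((σ.restrict r hr).tensorPull (τ.restrict r' hr')), Frame.extClass_tensorPull,
    CechH1.of_mul]

/-- The map from isomorphism classes of representations to Čech-type cohomology. -/
def rep1ToCech (𝒢 : LieGroupoid n m M G) :
    LieGroupoid.Rep1.{u, v, w} 𝒢 →* 𝒢.CechH1 𝓘(ℝ, ℝ) ℝˣ :=
  MonoidHom.mk' (Quotient.lift cechClass (by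
    rintro L L' ⟨F⟩
    exact cechClass_eq_of_iso F _)) (by
    rintro ⟨L⟩ ⟨L'⟩
    exact cechClass_tensor L L')

theorem rep1ToCech_mk {L : LineRep.{u, v} 𝒢} (σ : (L.pull (𝒢.coverMap 𝒰)).Frame) :
    rep1ToCech 𝒢 ⟦L⟧ = CechH1.of 𝒢 𝒰 σ.extClass := cechClass_eq σ

/-- A trivial class produces an invariant global frame by rescaling and descent, and gluing realizes
every cocycle. -/
theorem rep1ToCech_bijective (𝒢 : LieGroupoid n m M G) :
    Function.Bijective (rep1ToCech.{u, v} 𝒢) := by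
  constructor
  · refine (injective_iff_map_eq_one _).2 ?_
    rintro ⟨L⟩ hL
    obtain ⟨𝒰, ⟨σ⟩⟩ := L.exists_coverFrame
    obtain ⟨𝒱, h, hσ⟩ := CechH1.of_eq_one_iff.1 ((rep1ToCech_mk σ).symm.trans hL)
    rw [resH1, ← Frame.extClass_restrict] at hσ
    set ρ := σ.restrict (exists_refine h).choose (exists_refine h).choose_spec
    obtain ⟨f, hf, hfc⟩ := (QuotientGroup.eq_one_iff _).1 hσ
    replace hfc : ∀ a, ρ.coeff a = f ((𝒢.cover 𝒱).src a) / f ((𝒢.cover 𝒱).tgt a) := hfc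
    -- The cocycle of `ρ` is the coboundary of `f`, so dividing the frame by `f` makes it constantly
    -- `1`. This allows descent and also shows that the descended frame is invariant.
    have h₁ : ∀ a, (ρ.scale f⁻¹ hf.inv).coeff a = 1 := fun a => by
      rw [Frame.coeff_scale, hfc, Pi.inv_apply, Pi.inv_apply, inv_div_inv, div_mul_div_cancel,
        div_self']
    obtain ⟨τ, hτ⟩ := (ρ.scale f⁻¹ hf.inv).exists_descend fun _ _ _ _ _ => h₁ _
    refine (Quotient.sound (nonempty_iso_trivial τ fun g => ?_)).symm
    exact (hτ (𝒢.coverArrow _ _ g (𝒱.mem_memberAt _) (𝒱.mem_memberAt _))).trans (h₁ _)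
  · intro x
    obtain ⟨𝒰, x, rfl⟩ := CechH1.exists_of x
    induction x using QuotientGroup.induction_on with | _ c
    exact ⟨⟦glued c⟧, by rw [rep1ToCech_mk (gluedCoverFrame c), extClass_gluedCoverFrame]⟩

end LineRep

end

/-! ### The main theorem -/

theorem mainTheorem8 {n m : ℕ} {M : Type u} {G : Type w}
    [TopologicalSpace M] [ChartedSpace (EuclideanSpace ℝ (Fin n)) M] [IsManifold (𝓡 n) ∞ M]
    [T2Space M] [SecondCountableTopology M]
    [TopologicalSpace G] [ChartedSpace (EuclideanSpace ℝ (Fin m)) G] [IsManifold (𝓡 m) ∞ G]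
    (𝒢 : LieGroupoid n m M G) :
    -- the pull-back along an open cover induces an isomorphism in real cohomology
    (∀ 𝒰 : OpenCover M, Function.Bijective (𝒢.coverMap 𝒰).pullRealH1) ∧
    -- any `L` becomes trivializable over some open cover, and `L ⊗ L` is trivializable
    (∀ L : LineRep.{u, v, w} 𝒢, ∃ 𝒰 : OpenCover M, Nonempty (L.pull (𝒢.coverMap 𝒰)).Frame) ∧
    (∀ L : LineRep.{u, v, w} 𝒢, Nonempty (L.tensor L).Frame) ∧
    ∃ (θc : LieGroupoid.Rep1.{u, v, w} 𝒢 ≃* 𝒢.CechH1 𝓘(ℝ, ℝ) ℝˣ)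
      (Φ : 𝒢.CechH1 𝓘(ℝ, ℝ) ℝˣ ≃* Multiplicative 𝒢.RealH1 × 𝒢.CechH1 (𝓡 0) ℤˣ)
      (θ : LieGroupoid.Rep1.{u, v, w} 𝒢 → 𝒢.RealH1)
      (sw : LieGroupoid.Rep1.{u, v, w} 𝒢 → 𝒢.CechH1 (𝓡 0) ℤˣ),
      -- `θc` and `sw` are the classes of the cocycles of `L` over covers that trivialize `L`
      (∀ (L : LineRep.{u, v, w} 𝒢) (𝒰 : OpenCover M) (σ : (L.pull (𝒢.coverMap 𝒰)).Frame),
        θc ⟦L⟧ = LieGroupoid.CechH1.of 𝒢 𝒰 σ.extClass ∧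
        sw ⟦L⟧ = LieGroupoid.CechH1.of 𝒢 𝒰 (LieGroupoid.H1.sign σ.extClass)) ∧
      -- `θ` is the characteristic class
      (∀ (L : LineRep.{u, v, w} 𝒢) (σ : L.Frame),
        θ ⟦L⟧ = (LieGroupoid.H1.logAbs σ.extClass).toAdd) ∧
      (∀ L : LineRep.{u, v, w} 𝒢, θ ⟦L⟧ = (1 / 2 : ℝ) • θ ⟦L.tensor L⟧) ∧
      -- `Φ` is induced by `λ ↦ (ln |λ|, sign λ)` and the isomorphisms in real cohomology
      (∀ (𝒰 : OpenCover M) (x : (𝒢.cover 𝒰).H1 𝓘(ℝ, ℝ) ℝˣ),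
        (𝒢.coverMap 𝒰).pullRealH1 (Φ (LieGroupoid.CechH1.of 𝒢 𝒰 x)).1.toAdd =
          (LieGroupoid.H1.logAbs x).toAdd ∧
        (Φ (LieGroupoid.CechH1.of 𝒢 𝒰 x)).2 =
          LieGroupoid.CechH1.of 𝒢 𝒰 (LieGroupoid.H1.sign x)) ∧
      -- the value of `θc` in terms of the splitting
      ∀ L : LineRep.{u, v, w} 𝒢, Φ (θc ⟦L⟧) = (Multiplicative.ofAdd (θ ⟦L⟧), sw ⟦L⟧) := by
  have hΦ : ∀ (𝒰 : OpenCover M) (x : (𝒢.cover 𝒰).H1 𝓘(ℝ, ℝ) ℝˣ),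
      (𝒢.coverMap 𝒰).pullRealH1 (𝒢.cechSplitting (LieGroupoid.CechH1.of 𝒢 𝒰 x)).1.toAdd =
        (LieGroupoid.H1.logAbs x).toAdd := fun 𝒰 x =>
    LieGroupoid.pullRealH1_coverRealEquiv_symm _
  let θc : LieGroupoid.Rep1.{u, v, w} 𝒢 ≃* 𝒢.CechH1 𝓘(ℝ, ℝ) ℝˣ :=
    .ofBijective (LineRep.rep1ToCech 𝒢) (LineRep.rep1ToCech_bijective 𝒢)
  have hθc : ∀ (L : LineRep.{u, v, w} 𝒢) (𝒰 : OpenCover M) (σ : (L.pull (𝒢.coverMap 𝒰)).Frame),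
      θc ⟦L⟧ = LieGroupoid.CechH1.of 𝒢 𝒰 σ.extClass := fun L 𝒰 σ => LineRep.rep1ToCech_mk σ
  -- The classes `θ` and `sw` are defined as the components of the splitting applied to `θc`, so the
  -- last clause holds by definition. What remains are their descriptions by frames and the formula
  -- for `L ⊗ L`.
  refine ⟨LieGroupoid.pullRealH1_coverMap_bijective 𝒢, LineRep.exists_coverFrame,
    LineRep.nonempty_frame_tensor_self, θc, 𝒢.cechSplitting,
    fun x => (𝒢.cechSplitting (θc x)).1.toAdd, fun x => (𝒢.cechSplitting (θc x)).2,
    fun L 𝒰 σ => ⟨hθc L 𝒰 σ, ?_⟩, fun L σ => ?_, fun L => ?_, fun 𝒰 x => ⟨hΦ 𝒰 x, rfl⟩,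
    fun L => rfl⟩
  · beta_reduce
    rw [hθc L 𝒰 σ]
    rfl
  -- A global frame pulls back to a frame over any cover whatsoever. There the splitting is known
  -- explicitly, and injectivity of the pull-back in real cohomology brings the identity back to
  -- `G`.
  · obtain ⟨𝒰⟩ : Nonempty (OpenCover M) := inferInstance
    refine (LieGroupoid.pullRealH1_coverMap_bijective 𝒢 𝒰).1 ?_
    beta_reduce
    rw [hθc L 𝒰 (σ.pull _), hΦ, σ.extClass_pull, LieGroupoid.H1.logAbs_pullH1]
  · beta_reduce
    -- As `θc` and the splitting are homomorphisms, the class of `L ⊗ L` is twice that of `L`.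
    rw [LineRep.mk_tensor, map_mul, map_mul, Prod.fst_mul, toAdd_mul, ← two_smul ℝ, smul_smul]
    norm_num
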